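/- **Graphs.** Graphs are non-empty finite multigraphs $G=(V,E)$ (loops and multiple edges allowed) with $s$ labelled legs attached to vertices; the valency $|v|$ counts legs, and counts loops twice. $G$ is *admissible* if it is connected, has no bridge, and $|v|\ge 3$ for all $v\in V$. Its loop number is $|G|=|E|-|V|+1$. A *regular metric* on $G$ is a map $\lambda:E\to\mathbb R_{\ge0}$ whose zero set $Z_\lambda$ is (the edge set of) a forest. Let $n\ge 1$, $s\ge 0$, and $C=\{1,\dots,3(n-1)+s\}$. Consider the following spaces, each a quotient of a disjoint union (over graphs $G$ and their additional structure) of the spaces of regular metrics on $G$, which are subspaces of $\mathbb R^E$. * $\mathcal{MG}_{n,s}$: pairs $(G,\lambda)$ with $G$ admissible with $n$ loops and $s$ legs and $\lambda$ a regular metric, where $(G,\lambda)\sim(G',\lambda')$ if there are an isomorphism $\varphi:G/Z_\lambda\to G'/Z_{\lambda'}$ preserving the labelled legs and $a>0$ with $\lambda'\circ\varphi=a\lambda$ on $E\setminus Z_\lambda$. * $\mathcal{MHG}_{n,s}$: triples $(G,\lambda,c)$ with, in addition, a *holocoloring* of $G$, i.e. an injective map $c:E\to C$; in the relation $\varphi$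 must also preserve the colors of the edges in $E\setminus Z_\lambda$. * $\mathcal{MRG}_{n,s}$ (remembered edges): $(G,\lambda,c,w)$, where $c:E\to C$ is injective and each vertex $v$ carries a label $w(v)\subset C$, the set of colors of the edges previously collapsed to it; here $|w(v)|=|v|-3$, the sets $w(v)$ are pairwise disjoint, and they are disjoint from $c(E)$. When $Z_\lambda$ is collapsed, a new vertex is labelled by the union of the labels of the vertices, and of the colors of the edges, collapsed to it; in the relation $\varphi$ must preserve the colors of the edges in $E\setminus Z_\lambda$ and the labels of all vertices of $G/Z_\lambda$. The group $\mathrm{Perm}(C)$ acts on $\mathcal{MHG}_{n,s}$ and $\mathcal{MRG}_{n,s}$ by permuting colors. **Proposition.** Let $X$ be $\mathcal{MHG}_{n,s}$ or $\mathcal{MRG}_{n,s}$, and let $\pi:X\to\mathcal{MG}_{n,s}$ be the map that forgets the coloring (and the vertex labels). Then $\pi$ is a topological quotient map, and for every $k\ge0$ the induced map $\pi_*:H_k(X;\mathbb Q)\to H_k(\mathcal{MG}_{n,s};\mathbb Q)$ on singular homology is surjective. A right inverse is given by averaging over all colorings: there is a linear map $\tau:H_k(\mathcal{MG}_{n,s};\mathbb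 Q)\to H_k(X;\mathbb Q)$ with $\pi_*\circ\tau=\mathrm{id}$ such that 1. $\tau$ is induced on representatives by $$(G,z)\longmapsto\sum_{c}\frac1{\kappa_G}\,(G,z,c),$$ where $z$ is a singular $k$-chain in the space of regular metrics on $G$, $(G,z)$ and $(G,z,c)$ are its images in $\mathcal{MG}_{n,s}$ and $X$, $c$ runs over all $\kappa_G$ holocolorings of $G$ (for $\mathcal{MRG}_{n,s}$: over all $\kappa_G$ pairs $(c,w)$ as above). That is, if finitely many graphs $G$ and chains $z_G$ are such that $\zeta=\sum_G(G,z_G)$ and $\zeta'=\sum_G\sum_c\frac1{\kappa_G}(G,z_G,c)$ are cycles, then $\tau[\zeta]=[\zeta']$. 2. $\tau\circ\pi_*=\frac1{|C|!}\sum_{g\in\mathrm{Perm}(C)}g_*$. -/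

import Mathlib

open CategoryTheory

namespace GraphModuli

noncomputable section

/-! ### Graphs -/

/-- A multigraph (loops and multiple edges allowed) with vertex set `V`, set of internal edges `E`
and `s` legs. The legs are labelled basepoints: `leg i` is the vertex carrying the `i`-th leg. -/
structure LGraph (s : ℕ) (V E : Type) where
  ends : E → Sym2 V
  leg : Fin s → V

namespace LGraph

variable {s : ℕ} {V E V' E' V'' E'' : Type}

/-- Isomorphisms of graphs, fixing the labels of the legs. -/
structure Iso (G : LGraph s V E) (G' : LGraph s V' E') where
  vert : V ≃ V'
  edge : E ≃ E'
  ends_edge : ∀ e, G'.ends (edge e) = (G.ends e).map vert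
  leg_eq : ∀ i, G'.leg i = vert (G.leg i)

def Iso.refl (G : LGraph s V E) : Iso G G where
  vert := Equiv.refl V
  edge := Equiv.refl E
  ends_edge e := by
    change G.ends e = (G.ends e).map id
    rw [Sym2.map_id]; rfl
  leg_eq _ := rfl

def Iso.trans {G : LGraph s V E} {G' : LGraph s V' E'} {G'' : LGraph s V'' E''}
    (f : Iso G G') (g : Iso G' G'') : Iso G G'' where
  vert := f.vert.trans g.vert
  edge := f.edge.trans g.edge
  ends_edge e := by
    change G''.ends (g.edge (f.edge e)) = _
    rw [g.ends_edge, f.ends_edge, Sym2.map_map]; rfl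
  leg_eq i := by rw [g.leg_eq, f.leg_eq]; rfl

def Iso.symm {G : LGraph s V E} {G' : LGraph s V' E'} (f : Iso G G') : Iso G' G where
  vert := f.vert.symm
  edge := f.edge.symm
  ends_edge e := by
    obtain ⟨e, rfl⟩ := f.edge.surjective e
    rw [f.ends_edge, Sym2.map_map]
    have : (⇑f.vert.symm ∘ ⇑f.vert) = id := by ext x; simp
    rw [this, Sym2.map_id]; simp
  leg_eq i := by rw [f.leg_eq]; simp

variable (G : LGraph s V E)

/-- Two vertices are joined by an edge of `Z`. -/
def Joined (Z : Set E) (x y : V) : Prop := ∃ e ∈ Z, G.ends e = s(x, y)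

/-- The set of connected components of the subgraph with all vertices of `G` and edge set `Z`. -/
def Comp (Z : Set E) : Type := Quot (G.Joined Z)

/-- The component of a vertex. -/
def comp (Z : Set E) (v : V) : G.Comp Z := Quot.mk _ v

/-- The subgraph with all vertices of `G` and edge set `Z` is connected (and non-empty). -/
def ConnectedOn (Z : Set E) : Prop := Nonempty V ∧ Subsingleton (G.Comp Z)

/-- The loop number (first Betti number) of the subgraph with all vertices of `G` and edge
set `Z`. -/
def loops (Z : Set E) : ℤ := (Z.ncard : ℤ) - Nat.card V + Nat.card (G.Comp Z)

/-- `Z` is the edge set of a forest in `G`. -/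
def IsForest (Z : Set E) : Prop := G.loops Z = 0

/-- The valency of a vertex; legs are counted, and loops are counted twice. -/
def valency [Fintype E] [DecidableEq V] (v : V) : ℕ :=
  (∑ e, (G.ends e).toMultiset.count v) + (Finset.univ.filter fun i => G.leg i = v).card

/-- Admissible graphs: connected, without bridges, and with all vertices at least trivalent. -/
structure Admissible [Fintype E] [DecidableEq V] : Prop where
  connected : G.ConnectedOn Set.univ
  noBridge : ∀ e, G.ConnectedOn {e}ᶜ
  three_le_valency : ∀ v, 3 ≤ G.valency v

/-- The graph `G / Z`: all edges of `Z` are collapsed. Its vertices are the connected components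
of the subgraph `Z`. -/
def contract (Z : Set E) : LGraph s (G.Comp Z) {e : E // e ∉ Z} where
  ends e := (G.ends e).map (G.comp Z)
  leg i := G.comp Z (G.leg i)

end LGraph

/-- Admissible graphs with `n` loops and `s` legs. Every finite graph is isomorphic to one whose
sets of vertices and edges are of the form `Fin a`, `Fin b`; this keeps the collection a set. -/
structure AdmGraph (n s : ℕ) where
  numV : ℕ
  numE : ℕ
  graph : LGraph s (Fin numV) (Fin numE)
  admissible : graph.Admissible
  loops_eq : graph.loops Set.univ = n

variable {n s : ℕ}

/-- The regular metrics on `G`: edge lengths in `ℝ≥0` that vanish at most on a forest. It carries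
the subspace topology of `ℝ ^ E`. -/
def RegMetric (G : AdmGraph n s) : Type :=
  {l : Fin G.numE → ℝ // (∀ e, 0 ≤ l e) ∧ G.graph.IsForest {e | l e = 0}}

instance (G : AdmGraph n s) : TopologicalSpace (RegMetric G) :=
  inferInstanceAs (TopologicalSpace
    {l : Fin G.numE → ℝ // (∀ e, 0 ≤ l e) ∧ G.graph.IsForest {e | l e = 0}})

namespace RegMetric

variable {G : AdmGraph n s}

/-- The length of an edge. -/
def len (l : RegMetric G) (e : Fin G.numE) : ℝ := l.1 e

/-- The set of edges of length zero. -/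
def zero (l : RegMetric G) : Set (Fin G.numE) := {e | l.len e = 0}

/-- The graph in which the edges of length zero are collapsed. -/
def shrunk (l : RegMetric G) : LGraph s (G.graph.Comp l.zero) {e : Fin G.numE // e ∉ l.zero} :=
  G.graph.contract l.zero

/-- `φ` is a homothety between the two metric graphs with the edges of length zero collapsed. -/
def IsHomothety {G' : AdmGraph n s} (l : RegMetric G) (l' : RegMetric G')
    (φ : LGraph.Iso l.shrunk l'.shrunk) : Prop :=
  ∃ a : ℝ, 0 < a ∧ ∀ e, l'.len (φ.edge e).1 = a * l.len e.1

lemma isHomothety_refl (l : RegMetric G) : l.IsHomothety l (.refl _) :=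
  ⟨1, one_pos, fun e => by rw [one_mul]; rfl⟩

lemma IsHomothety.symm {G' : AdmGraph n s} {l : RegMetric G} {l' : RegMetric G'}
    {φ : LGraph.Iso l.shrunk l'.shrunk} (h : l.IsHomothety l' φ) : l'.IsHomothety l φ.symm := by
  obtain ⟨a, ha, h⟩ := h
  refine ⟨a⁻¹, inv_pos.2 ha, fun e => ?_⟩
  obtain ⟨e, rfl⟩ := φ.edge.surjective e
  rw [h]
  simp [LGraph.Iso.symm, ha.ne']

lemma IsHomothety.trans {G' G'' : AdmGraph n s} {l : RegMetric G} {l' : RegMetric G'}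
    {l'' : RegMetric G''} {φ : LGraph.Iso l.shrunk l'.shrunk} {ψ : LGraph.Iso l'.shrunk l''.shrunk}
    (h : l.IsHomothety l' φ) (h' : l'.IsHomothety l'' ψ) : l.IsHomothety l'' (φ.trans ψ) := by
  obtain ⟨a, ha, h⟩ := h
  obtain ⟨b, hb, h'⟩ := h'
  refine ⟨b * a, mul_pos hb ha, fun e => ?_⟩
  rw [mul_assoc, ← h, ← h']
  rfl

end RegMetric

/-! ### The moduli space of graphs -/

/-- Admissible graphs of rank `n` with `s` legs and a regular metric, topologized as the disjoint
union of the spaces of regular metrics. -/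
abbrev MetricGraph (n s : ℕ) : Type := Σ G : AdmGraph n s, RegMetric G

/-- Two metric graphs are equivalent if they become homothetic after collapsing the edges of
length zero. -/
instance metricGraphSetoid (n s : ℕ) : Setoid (MetricGraph n s) where
  r p q := ∃ φ, p.2.IsHomothety q.2 φ
  iseqv :=
    { refl := fun p => ⟨_, p.2.isHomothety_refl⟩
      symm := fun ⟨_, h⟩ => ⟨_, h.symm⟩
      trans := fun ⟨_, h⟩ ⟨_, h'⟩ => ⟨_, h.trans h'⟩ }

/-- The moduli space `MG_{n,s}` of rank `n` graphs with `s` legs, with the quotient topology. -/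
def MG (n s : ℕ) : Type := Quotient (metricGraphSetoid n s)

instance (n s : ℕ) : TopologicalSpace (MG n s) :=
  inferInstanceAs (TopologicalSpace (Quotient (metricGraphSetoid n s)))

/-- The map that sends a regular metric on `G` to the point of `MG_{n,s}` it represents. -/
def MG.cell (G : AdmGraph n s) : C(RegMetric G, MG n s) where
  toFun l := Quotient.mk _ ⟨G, l⟩
  continuous_toFun := continuous_quotient_mk'.comp continuous_sigmaMk

/-! ### Holocolored graphs -/

/-- The set of colors, `C = {1, …, 3(n-1)+s}`. -/
abbrev Color (n s : ℕ) : Type := Fin (3 * (n - 1) + s)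

/-- Holocolorings: injective maps from the set of edges to the set of colors. -/
abbrev HoloColoring (G : AdmGraph n s) : Type := Fin G.numE ↪ Color n s

/-- Holocolored admissible graphs with a regular metric, topologized as a disjoint union. -/
abbrev HoloGraph (n s : ℕ) : Type :=
  Σ p : (Σ G : AdmGraph n s, HoloColoring G), RegMetric p.1

/-- Holocolored metric graphs are equivalent if, after collapsing the edges of length zero, there
is a homothety that preserves the colors of the remaining edges. -/
instance holoGraphSetoid (n s : ℕ) : Setoid (HoloGraph n s) where
  r p q := ∃ φ, p.2.IsHomothety q.2 φ ∧ ∀ e, q.1.2 (φ.edge e).1 = p.1.2 e.1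
  iseqv :=
    { refl := fun p => ⟨_, p.2.isHomothety_refl, fun _ => rfl⟩
      symm := by
        rintro p q ⟨φ, h, hc⟩
        refine ⟨_, h.symm, fun e => ?_⟩
        obtain ⟨e, rfl⟩ := φ.edge.surjective e
        rw [hc]
        simp [LGraph.Iso.symm]
      trans := by
        rintro p q r ⟨φ, h, hc⟩ ⟨ψ, h', hc'⟩
        exact ⟨_, h.trans h', fun e => by rw [← hc, ← hc']; rfl⟩ }

/-- The moduli space `MHG_{n,s}` of holocolored graphs, with the quotient topology. -/
def MHG (n s : ℕ) : Type := Quotient (holoGraphSetoid n s)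

instance (n s : ℕ) : TopologicalSpace (MHG n s) :=
  inferInstanceAs (TopologicalSpace (Quotient (holoGraphSetoid n s)))

namespace MHG

/-- The map that sends a regular metric on `G` to the point of `MHG_{n,s}` that it represents
together with the holocoloring `c`. -/
def cell (G : AdmGraph n s) (c : HoloColoring G) : C(RegMetric G, MHG n s) where
  toFun l := Quotient.mk _ ⟨⟨G, c⟩, l⟩
  continuous_toFun := continuous_quotient_mk'.comp
    (continuous_sigmaMk (σ := fun p : (Σ G : AdmGraph n s, HoloColoring G) => RegMetric p.1)
      (i := ⟨G, c⟩))

/-- The map `π : MHG_{n,s} → MG_{n,s}` that forgets the coloring. -/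
def forget (n s : ℕ) : C(MHG n s, MG n s) where
  toFun := Quotient.map (fun p => ⟨p.1.1, p.2⟩) fun _ _ ⟨φ, h, _⟩ => ⟨φ, h⟩
  continuous_toFun :=
    Continuous.quotient_map' (s := holoGraphSetoid n s) (t := metricGraphSetoid n s)
      (continuous_sigma fun _ => continuous_sigmaMk) _

/-- The action of a permutation of the colors, `(G, λ, c) ↦ (G, λ, g ∘ c)`. -/
def recolor (g : Equiv.Perm (Color n s)) : C(MHG n s, MHG n s) where
  toFun := Quotient.map (fun p => ⟨⟨p.1.1, p.1.2.trans g.toEmbedding⟩, p.2⟩)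
    fun _ _ ⟨φ, h, hc⟩ => ⟨φ, h, fun e => congrArg g (hc e)⟩
  continuous_toFun :=
    Continuous.quotient_map' (s := holoGraphSetoid n s) (t := holoGraphSetoid n s)
      (continuous_sigma fun p => continuous_sigmaMk
        (σ := fun p : (Σ G : AdmGraph n s, HoloColoring G) => RegMetric p.1)
        (i := ⟨p.1, p.2.trans g.toEmbedding⟩)) _

end MHG

/-! ### Holocolored graphs with remembered edges -/

/-- A holocoloring of `G` together with a record of previously collapsed edges: each vertex `v` is
labelled by the set `type v` of the colors of the edges that were collapsed to it. Such a vertex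
arises from a tree with trivalent vertices, which has `valency v - 3` edges, and edges that are
present or were collapsed have different colors. -/
@[ext]
structure RemColoring (G : AdmGraph n s) where
  color : Fin G.numE ↪ Color n s
  type : Fin G.numV → Finset (Color n s)
  card_type : ∀ v, (type v).card + 3 = G.graph.valency v
  color_notMem : ∀ e v, color e ∉ type v
  type_disjoint : ∀ v w, v ≠ w → Disjoint (type v) (type w)

namespace RemColoring

variable {G : AdmGraph n s}

lemma injective_pair : Function.Injective
    fun c : RemColoring G => (c.color, c.type) := by
  intro c c' h
  simp only [Prod.mk.injEq] at h
  exact RemColoring.ext h.1 h.2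

instance : Fintype (RemColoring G) := Fintype.ofInjective _ injective_pair

/-- The label of a vertex of the graph obtained by collapsing the edges in `Z`: it collects the
labels of all vertices, and the colors of all edges of `Z`, that are collapsed to it. -/
def shrunkType (c : RemColoring G) (Z : Set (Fin G.numE)) (q : G.graph.Comp Z) :
    Set (Color n s) :=
  {x | (∃ v, G.graph.comp Z v = q ∧ x ∈ c.type v) ∨
    ∃ e ∈ Z, c.color e = x ∧ ∀ v ∈ G.graph.ends e, G.graph.comp Z v = q}

/-- Recoloring by a permutation of the colors. -/
def recolor (g : Equiv.Perm (Color n s)) (c : RemColoring G) : RemColoring G where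
  color := c.color.trans g.toEmbedding
  type v := (c.type v).map g.toEmbedding
  card_type v := by rw [Finset.card_map, c.card_type]
  color_notMem e v := by simpa using c.color_notMem e v
  type_disjoint v w h := by simpa using c.type_disjoint v w h

lemma shrunkType_recolor (g : Equiv.Perm (Color n s)) (c : RemColoring G) (Z : Set (Fin G.numE))
    (q : G.graph.Comp Z) : (c.recolor g).shrunkType Z q = g '' c.shrunkType Z q := by
  ext x
  obtain ⟨x, rfl⟩ := g.surjective x
  simp [shrunkType, recolor]

end RemColoring

/-- Admissible graphs with a remembering holocoloring and a regular metric, topologized as a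
disjoint union. -/
abbrev RemGraph (n s : ℕ) : Type :=
  Σ p : (Σ G : AdmGraph n s, RemColoring G), RegMetric p.1

/-- Equivalence of graphs with remembered edges: after collapsing the edges of length zero, whose
colors are added to the labels of the vertices, there is a homothety that preserves the colors
of the remaining edges and the labels of the vertices. -/
instance remGraphSetoid (n s : ℕ) : Setoid (RemGraph n s) where
  r p q := ∃ φ, p.2.IsHomothety q.2 φ ∧ (∀ e, q.1.2.color (φ.edge e).1 = p.1.2.color e.1) ∧
    ∀ v, q.1.2.shrunkType q.2.zero (φ.vert v) = p.1.2.shrunkType p.2.zero v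
  iseqv :=
    { refl := fun p => ⟨_, p.2.isHomothety_refl, fun _ => rfl, fun _ => rfl⟩
      symm := by
        rintro p q ⟨φ, h, hc, ht⟩
        refine ⟨_, h.symm, fun e => ?_, fun v => ?_⟩
        · obtain ⟨e, rfl⟩ := φ.edge.surjective e
          rw [hc]
          simp [LGraph.Iso.symm]
        · obtain ⟨v, rfl⟩ := φ.vert.surjective v
          rw [ht]
          simp [LGraph.Iso.symm]
      trans := by
        rintro p q r ⟨φ, h, hc, ht⟩ ⟨ψ, h', hc', ht'⟩
        exact ⟨_, h.trans h', fun e => by rw [← hc, ← hc']; rfl,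
          fun v => by rw [← ht, ← ht']; rfl⟩ }

/-- The moduli space `MRG_{n,s}` of holocolored graphs with remembered edges, with the quotient
topology. -/
def MRG (n s : ℕ) : Type := Quotient (remGraphSetoid n s)

instance (n s : ℕ) : TopologicalSpace (MRG n s) :=
  inferInstanceAs (TopologicalSpace (Quotient (remGraphSetoid n s)))

namespace MRG

/-- The map that sends a regular metric on `G` to the point of `MRG_{n,s}` that it represents
together with the remembering holocoloring `c`. -/
def cell (G : AdmGraph n s) (c : RemColoring G) : C(RegMetric G, MRG n s) where
  toFun l := Quotient.mk _ ⟨⟨G, c⟩, l⟩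
  continuous_toFun := continuous_quotient_mk'.comp
    (continuous_sigmaMk (σ := fun p : (Σ G : AdmGraph n s, RemColoring G) => RegMetric p.1)
      (i := ⟨G, c⟩))

/-- The map `π : MRG_{n,s} → MG_{n,s}` that forgets the coloring and the labels of vertices. -/
def forget (n s : ℕ) : C(MRG n s, MG n s) where
  toFun := Quotient.map (fun p => ⟨p.1.1, p.2⟩) fun _ _ ⟨φ, h, _⟩ => ⟨φ, h⟩
  continuous_toFun :=
    Continuous.quotient_map' (s := remGraphSetoid n s) (t := metricGraphSetoid n s)
      (continuous_sigma fun _ => continuous_sigmaMk) _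

/-- The action of a permutation of the colors on edge colors and vertex labels. -/
def recolor (g : Equiv.Perm (Color n s)) : C(MRG n s, MRG n s) where
  toFun := Quotient.map (fun p => ⟨⟨p.1.1, p.1.2.recolor g⟩, p.2⟩)
    fun _ _ ⟨φ, h, hc, ht⟩ => ⟨φ, h, fun e => congrArg g (hc e), fun v => by
      change (RemColoring.recolor g _).shrunkType _ _ = (RemColoring.recolor g _).shrunkType _ _
      rw [RemColoring.shrunkType_recolor, RemColoring.shrunkType_recolor, ht]⟩
  continuous_toFun :=
    Continuous.quotient_map' (s := remGraphSetoid n s) (t := remGraphSetoid n s)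
      (continuous_sigma fun p => continuous_sigmaMk
        (σ := fun p : (Σ G : AdmGraph n s, RemColoring G) => RegMetric p.1)
        (i := ⟨p.1, p.2.recolor g⟩)) _

end MRG

/-! ### Rational singular homology -/

/-- The singular chain complex with rational coefficients. -/
def chains (X : Type) [TopologicalSpace X] : ChainComplex (ModuleCat.{0} ℚ) ℕ :=
  ((AlgebraicTopology.singularChainComplexFunctor (ModuleCat.{0} ℚ)).obj
    (ModuleCat.of ℚ ℚ)).obj (TopCat.of X)

/-- The chain map induced by a continuous map. -/
def chainsMap {X Y : Type} [TopologicalSpace X] [TopologicalSpace Y] (f : C(X, Y)) :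
    chains X ⟶ chains Y :=
  ((AlgebraicTopology.singularChainComplexFunctor (ModuleCat.{0} ℚ)).obj
    (ModuleCat.of ℚ ℚ)).map (TopCat.ofHom f)

/-- The singular homology `H_k(X; ℚ)`. -/
abbrev Hlgy (k : ℕ) (X : Type) [TopologicalSpace X] : ModuleCat.{0} ℚ := (chains X).homology k

/-- The linear map induced on homology by a continuous map. -/
def Hlgy.map (k : ℕ) {X Y : Type} [TopologicalSpace X] [TopologicalSpace Y] (f : C(X, Y)) :
    Hlgy k X →ₗ[ℚ] Hlgy k Y :=
  (HomologicalComplex.homologyMap (chainsMap f) k).hom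

/-- The linear map induced on singular `k`-chains by a continuous map. -/
def chainPush (k : ℕ) {X Y : Type} [TopologicalSpace X] [TopologicalSpace Y] (f : C(X, Y)) :
    (chains X).X k →ₗ[ℚ] (chains Y).X k :=
  ((chainsMap f).f k).hom

/-- The `k`-chain underlying a `k`-cycle. -/
def cycleChain {k : ℕ} {X : Type} [TopologicalSpace X] (z : (chains X).cycles k) :
    (chains X).X k :=
  ((chains X).iCycles k).hom z

/-- The homology class of a `k`-cycle. -/
def cycleClass {k : ℕ} {X : Type} [TopologicalSpace X] (z : (chains X).cycles k) : Hlgy k X :=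
  ((chains X).homologyπ k).hom z

/-- Suppose that every graph `G` has a finite set `Col G` of colorings and that `X` is a space of
colored graphs, with maps `cell G c` from the space of regular metrics on `G` to `X`.
A linear map `τ : H_k(MG_{n,s}; ℚ) → H_k(X; ℚ)` is given by averaging over all colorings if it is
induced on representatives by `(G, z) ↦ ∑_c (1 / κ_G) (G, z, c)`, where `z` is a `k`-chain of
metrics on `G` and `κ_G` is the number of colorings of `G`: if a cycle `ζ` in `MG_{n,s}` is the sum
of the chains `(G, z_G)` and a cycle `ζ'` in `X` is the sum of their averages, then `τ` sends the
class of `ζ` to that of `ζ'`. -/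
def IsColoringAverage {k : ℕ} {X : Type} [TopologicalSpace X] (Col : AdmGraph n s → Type)
    [∀ G, Fintype (Col G)] (cell : ∀ G, Col G → C(RegMetric G, X))
    (τ : Hlgy k (MG n s) →ₗ[ℚ] Hlgy k X) : Prop :=
  ∀ (F : Finset (AdmGraph n s)) (z : ∀ G : AdmGraph n s, (chains (RegMetric G)).X k)
    (ζ : (chains (MG n s)).cycles k) (ζ' : (chains X).cycles k),
    cycleChain ζ = ∑ G ∈ F, chainPush k (MG.cell G) (z G) →
    cycleChain ζ' = ∑ G ∈ F, ∑ c : Col G,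
      (1 / (Fintype.card (Col G) : ℚ)) • chainPush k (cell G c) (z G) →
    τ (cycleClass ζ) = cycleClass ζ'

end

end GraphModuli

open GraphModuli

/-! The finite group `Perm(C)` acts on X, and its orbits are the fibres of `π`
(`ColoringKind.isOrbitMap`), so the claim is a rational transfer for a quotient by a finite group.
For holocolorings, transitivity on fibres only needs that a bijection between subsets of C extends
to a permutation. For remembered edges it rests on a count, `RemColoring.ncard_shrunkType`:
components of a forest are trees, so after collapsing, a label still has valency minus three
elements; these labels and the remaining edge colors partition C.

Singular simplices of a quotient need not lift, so chains cannot simply be averaged over lifts.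
Instead, the map from the invariant chains of X to the chains of `MG` is shown to be a
quasi-isomorphism, in the form that its mapping cone is acyclic (`ConeAcyclic`). Since invariants
can be restored by averaging over ℚ, barycentric subdivision yields a Mayer–Vietoris principle
(`ConeAcyclic.union`). This reduces the problem to a finite open cover all of whose intersections
deform, equivariantly, until the deforming map is locally constant (`HasContraction.coneAcyclic`).
Then only constant simplices remain, and for these a set-theoretic section of `π` followed by
averaging suffices.

The cover consists of the sets `MG.cutSet n s m`: the `m` longest edges are well defined and the
other edges form a forest. On the intersection over `m ∈ S`, lengths are moved linearly to multiples
of the number of `m ∈ S` for which the edge is among the `m` longest. This preserves the sets of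
longest edges, and the final metric is locally constant up to scaling.

Acyclicity gives surjectivity of `π_*` and shows that the group average of `g_*` kills the kernel of
`π_*`; hence the average factors through `π_*`, and the factor is `τ`
(`IsOrbitMap.exists_transfer`). The formula on representatives follows since `ζ'` is invariant and
maps to `ζ`. -/

namespace GraphModuli

/-! ### Singular chains and formal chains of vertex lists. -/

noncomputable section

/-! ### The total singular chain module -/

section SingChain

variable {X Y Z : Type} [TopologicalSpace X] [TopologicalSpace Y] [TopologicalSpace Z]

/-- Singular simplices of all dimensions. -/
abbrev SingSimplex (X : Type) [TopologicalSpace X] : Type :=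
  Σ m : ℕ, C(stdSimplex ℝ (Fin (m + 1)), X)

/-- Rational singular chains of all dimensions. -/
abbrev SingChain (X : Type) [TopologicalSpace X] : Type := SingSimplex X →₀ ℚ

/-- The inclusion of the `i`-th face of the standard simplex. -/
def faceMap {m : ℕ} (i : Fin (m + 2)) :
    C(stdSimplex ℝ (Fin (m + 1)), stdSimplex ℝ (Fin (m + 2))) :=
  ⟨stdSimplex.map i.succAbove, stdSimplex.continuous_map _⟩

/-- The boundary of a singular simplex. -/
def simplexBdry : SingSimplex X → SingChain X
  | ⟨0, _⟩ => 0
  | ⟨m + 1, σ⟩ => ∑ i : Fin (m + 2), (-1 : ℚ) ^ (i : ℕ) • Finsupp.single ⟨m, σ.comp (faceMap i)⟩ 1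

/-- The boundary operator on chains. -/
def bdry : SingChain X →ₗ[ℚ] SingChain X := Finsupp.linearCombination ℚ simplexBdry

@[simp]
lemma bdry_single (σ : SingSimplex X) : bdry (Finsupp.single σ 1) = simplexBdry σ := by
  simp [bdry]

/-- Postcomposition of a singular simplex with a continuous map. -/
def SingSimplex.push (f : C(X, Y)) (σ : SingSimplex X) : SingSimplex Y := ⟨σ.1, f.comp σ.2⟩

/-- The map on chains induced by a continuous map. -/
def push (f : C(X, Y)) : SingChain X →ₗ[ℚ] SingChain Y :=
  Finsupp.lmapDomain ℚ ℚ (SingSimplex.push f)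

@[simp]
lemma push_single (f : C(X, Y)) (σ : SingSimplex X) (a : ℚ) :
    push f (Finsupp.single σ a) = Finsupp.single (σ.push f) a := by
  simp [push]

lemma push_push (g : C(Y, Z)) (f : C(X, Y)) (c : SingChain X) :
    push g (push f c) = push (g.comp f) c := by
  simp only [push, Finsupp.lmapDomain_apply, ← Finsupp.mapDomain_comp]
  rfl

lemma bdry_push (f : C(X, Y)) (c : SingChain X) : bdry (push f c) = push f (bdry c) := by
  refine LinearMap.congr_fun (f := bdry ∘ₗ push f) (g := push f ∘ₗ bdry) ?_ c
  ext σ : 2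
  obtain ⟨_ | m, σ⟩ := σ
  · simp [SingSimplex.push, simplexBdry]
  · simp [SingSimplex.push, simplexBdry, map_sum, ContinuousMap.comp_assoc]

end SingChain

/-! ### Chains of lists of points -/

/-- Formal linear combinations of lists of points. -/
abbrev ListChain (V : Type) : Type := List V →₀ ℚ

section ListChain

variable {V W : Type}

/-- Prepend a point to all lists. -/
def cone (v : V) : ListChain V →ₗ[ℚ] ListChain V := Finsupp.lmapDomain ℚ ℚ (List.cons v)

@[simp]
lemma cone_single (v : V) (l : List V) (a : ℚ) :
    cone v (Finsupp.single l a) = Finsupp.single (v :: l) a := by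
  simp [cone]

/-- Apply a map to all points. -/
def listPush (f : V → W) : ListChain V →ₗ[ℚ] ListChain W := Finsupp.lmapDomain ℚ ℚ (List.map f)

@[simp]
lemma listPush_single (f : V → W) (l : List V) (a : ℚ) :
    listPush f (Finsupp.single l a) = Finsupp.single (l.map f) a := by
  simp [listPush]

lemma listPush_cone (f : V → W) (v : V) (c : ListChain V) :
    listPush f (cone v c) = cone (f v) (listPush f c) := by
  refine LinearMap.congr_fun (f := listPush f ∘ₗ cone v) (g := cone (f v) ∘ₗ listPush f) ?_ c
  ext l : 2
  simp

/-- The alternating sum of the faces of a list. -/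
def listBdry (l : List V) : ListChain V :=
  ∑ i : Fin l.length, (-1 : ℚ) ^ (i : ℕ) • Finsupp.single (l.eraseIdx i) 1

/-- The augmented boundary operator. -/
def lbdry : ListChain V →ₗ[ℚ] ListChain V := Finsupp.linearCombination ℚ listBdry

@[simp]
lemma lbdry_single (l : List V) : lbdry (Finsupp.single l 1) = listBdry l := by
  simp [lbdry]

@[simp]
lemma listBdry_nil : listBdry ([] : List V) = 0 := by
  simp [listBdry]

/-- Deleting the head leaves `l`; deleting a later entry commutes with prepending `v` but shifts the
index, hence the sign. -/
lemma listBdry_cons (v : V) (l : List V) :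
    listBdry (v :: l) = Finsupp.single l 1 - cone v (listBdry l) := by
  simp only [listBdry, List.length_cons, Fin.sum_univ_succ, map_sum, map_smul, cone_single]
  simp [pow_succ, sub_eq_add_neg]

/-- Because the empty list is allowed, the boundary is augmented and this formula needs no
correction in the lowest degree. -/
lemma lbdry_cone (v : V) (c : ListChain V) : lbdry (cone v c) = c - cone v (lbdry c) := by
  refine LinearMap.congr_fun (f := lbdry ∘ₗ cone v) (g := LinearMap.id - cone v ∘ₗ lbdry) ?_ c
  ext l : 2
  simp [listBdry_cons]

lemma lbdry_listBdry (l : List V) : lbdry (listBdry l) = 0 := by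
  induction l with
  | nil => simp
  | cons v l ih => simp [listBdry_cons, lbdry_cone, ih]

lemma lbdry_lbdry (c : ListChain V) : lbdry (lbdry c) = 0 := by
  refine LinearMap.congr_fun (f := lbdry ∘ₗ lbdry) (g := 0) ?_ c
  ext l : 2
  simp [lbdry_listBdry]

lemma lbdry_listPush (f : V → W) (c : ListChain V) :
    lbdry (listPush f c) = listPush f (lbdry c) := by
  refine LinearMap.congr_fun (f := lbdry ∘ₗ listPush f) (g := listPush f ∘ₗ lbdry) ?_ c
  ext l : 2
  simp only [LinearMap.comp_apply, Finsupp.lsingle_apply, listPush_single, lbdry_single]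
  induction l with
  | nil => simp
  | cons v l ih => simp [listBdry_cons, listPush_cone, ih]

/-! #### The prism -/

/-- The triangulation of the prism over a list. -/
def listPrism : List V → ListChain (V × unitInterval)
  | [] => 0
  | v :: l => Finsupp.single ((v, 0) :: (v, 1) :: l.map (·, 1)) 1 - cone (v, 0) (listPrism l)

/-- The linear extension of the prism operator. -/
def lprism : ListChain V →ₗ[ℚ] ListChain (V × unitInterval) :=
  Finsupp.linearCombination ℚ listPrism

@[simp]
lemma lprism_single (l : List V) : lprism (Finsupp.single l 1) = listPrism l := by
  simp [lprism]

lemma lprism_cone (v : V) (c : ListChain V) :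
    lprism (cone v c) = cone (v, 0) (cone (v, 1) (listPush (·, 1) c)) - cone (v, 0) (lprism c) := by
  refine LinearMap.congr_fun (f := lprism ∘ₗ cone v)
    (g := cone (v, 0) ∘ₗ cone (v, 1) ∘ₗ listPush (·, 1) - cone (v, 0) ∘ₗ lprism) ?_ c
  ext l : 2
  simp [listPrism]

/-- In the inductive step the inner wall, the cone from `(v, 0)` over the top copy of `l`, occurs in
both summands of the prism with opposite signs and cancels. -/
lemma lbdry_listPrism (l : List V) :
    lbdry (listPrism l) = Finsupp.single (l.map (·, 1)) 1 - Finsupp.single (l.map (·, 0)) 1 -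
      lprism (listBdry l) := by
  induction l with
  | nil => simp [listPrism]
  | cons v l ih =>
    have h (t : unitInterval) : lbdry (Finsupp.single (l.map (·, t)) 1) =
        listPush (·, t) (listBdry l) := by
      rw [← lbdry_single l, ← lbdry_listPush, listPush_single]
    simp only [listPrism, map_sub, lbdry_single, listBdry_cons, lbdry_cone, ih, lprism_cone,
      cone_single, lprism_single, List.map_cons]
    rw [← h, lbdry_single]
    abel

lemma listPush_listPrism (f : V → W) (l : List V) :
    listPush (Prod.map f id) (listPrism l) = listPrism (l.map f) := by
  induction l with
  | nil => simp [listPrism]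
  | cons v l ih =>
    simp only [listPrism, map_sub, listPush_cone, ih, List.map_cons, listPush_single, List.map_map,
      Prod.map]
    rfl

end ListChain

end

/-! ### Affine simplices, realization of lists, natural operators and prisms. -/

noncomputable section

/-! ### Affine simplices -/

/-- Spaces in which points span affine simplices. -/
class AffineSpan (K : Type) [TopologicalSpace K] where
  /-- The affine simplex with the given vertices. -/
  aff {m : ℕ} (p : Fin (m + 1) → K) : C(stdSimplex ℝ (Fin (m + 1)), K)
  aff_vertex {m : ℕ} (p : Fin (m + 1) → K) (i : Fin (m + 1)) : aff p (stdSimplex.vertex i) = p i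

open AffineSpan

/-- The affine simplex spanned by points of a convex set. -/
def convexAff {E : Type} [NormedAddCommGroup E] [NormedSpace ℝ E] {K : Set E} (hK : Convex ℝ K)
    {m : ℕ} (p : Fin (m + 1) → K) : C(stdSimplex ℝ (Fin (m + 1)), K) where
  toFun t := ⟨∑ i, t.1 i • (p i : E),
    hK.sum_mem (fun i _ => t.2.1 i) t.2.2 fun i _ => (p i).2⟩
  continuous_toFun := by
    refine Continuous.subtype_mk (continuous_finsetSum _ fun i _ => ?_) _
    exact ((continuous_apply i).comp continuous_subtype_val).smul continuous_const

lemma convexAff_vertex {E : Type} [NormedAddCommGroup E] [NormedSpace ℝ E] {K : Set E}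
    (hK : Convex ℝ K) {m : ℕ} (p : Fin (m + 1) → K) (i : Fin (m + 1)) :
    convexAff hK p (stdSimplex.vertex i) = p i := by
  apply Subtype.ext
  simp [convexAff, Pi.single_apply]

instance {m : ℕ} : AffineSpan (stdSimplex ℝ (Fin m)) where
  aff := convexAff (convex_stdSimplex ℝ _)
  aff_vertex := convexAff_vertex _

instance : AffineSpan unitInterval where
  aff := convexAff (convex_Icc 0 1)
  aff_vertex := convexAff_vertex _

instance {K L : Type} [TopologicalSpace K] [TopologicalSpace L] [AffineSpan K] [AffineSpan L] :
    AffineSpan (K × L) where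
  aff p := (aff fun i => (p i).1).prodMk (aff fun i => (p i).2)
  aff_vertex p i := by
    change (aff (fun i => (p i).1) (stdSimplex.vertex i), aff (fun i => (p i).2) _) = p i
    rw [aff_vertex, aff_vertex]

section AffineMap

variable {K L M : Type} [TopologicalSpace K] [TopologicalSpace L] [TopologicalSpace M]
  [AffineSpan K] [AffineSpan L] [AffineSpan M]

/-- Maps that preserve affine simplices. -/
def IsAff (g : K → L) : Prop :=
  ∀ (m : ℕ) (p : Fin (m + 1) → K) (t), g (aff p t) = aff (g ∘ p) t

lemma IsAff.prodMap_id {g : K → L} (hg : IsAff g) : IsAff (Prod.map g id : K × M → L × M) :=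
  fun m p t => by
    change (g (aff (fun i => (p i).1) t), aff (fun i => (p i).2) t) = _
    rw [hg]
    rfl

lemma isAff_aff_simplex {m k : ℕ} (p : Fin (m + 1) → stdSimplex ℝ (Fin k)) : IsAff (aff p) := by
  intro j q t
  apply Subtype.ext
  change ∑ i, (∑ a, t.1 a • (q a).1) i • (p i).1 = ∑ a, t.1 a • ∑ i, (q a).1 i • (p i).1
  simp only [Finset.sum_apply, Pi.smul_apply, Finset.sum_smul, Finset.smul_sum, smul_eq_mul,
    mul_smul]
  exact Finset.sum_comm

lemma aff_const_unitInterval {m : ℕ} (x : unitInterval) (t : stdSimplex ℝ (Fin (m + 1))) :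
    aff (fun _ => x) t = x := by
  apply Subtype.ext
  change ∑ i, t.1 i • x.1 = x.1
  rw [← Finset.sum_smul, t.2.2, one_smul]

lemma aff_vertices {m : ℕ} (t : stdSimplex ℝ (Fin (m + 1))) :
    aff (fun i => stdSimplex.vertex (S := ℝ) i) t = t := by
  apply Subtype.ext
  change ∑ i, t.1 i • (stdSimplex.vertex (S := ℝ) i).1 = t.1
  funext j
  simp [Pi.single_apply]

/-- Brings faces of the standard simplex under the naturality statements for `IsAff` maps. -/
lemma faceMap_eq_aff {m : ℕ} (i : Fin (m + 2)) :
    faceMap i = aff fun j => stdSimplex.vertex (S := ℝ) (i.succAbove j) := by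
  ext t j
  change stdSimplex.map i.succAbove t j = (∑ a, t.1 a • (stdSimplex.vertex (S := ℝ) _).1) j
  rw [stdSimplex.map_coe, FunOnFinite.linearMap_apply_apply]
  simp only [Finset.sum_apply, Pi.smul_apply, Pi.single_apply, smul_eq_mul,
    mul_ite, mul_one, mul_zero]
  rw [Finset.sum_filter]
  refine Finset.sum_congr rfl fun a _ => ?_
  simp only [eq_comm]
  rfl

lemma isAff_faceMap {m : ℕ} (i : Fin (m + 2)) : IsAff (faceMap i) := by
  rw [faceMap_eq_aff]
  exact isAff_aff_simplex _

lemma faceMap_vertex {m : ℕ} (i : Fin (m + 2)) (j : Fin (m + 1)) :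
    faceMap i (stdSimplex.vertex j) = stdSimplex.vertex (i.succAbove j) := by
  rw [faceMap_eq_aff, aff_vertex]

/-- The spaces in which affine simplices have affine faces. -/
class AffineFaces (K : Type) [TopologicalSpace K] [AffineSpan K] : Prop where
  aff_face {m : ℕ} (p : Fin (m + 2) → K) (i : Fin (m + 2)) (t) :
    aff p (faceMap i t) = aff (p ∘ i.succAbove) t

lemma convexAff_face {E : Type} [NormedAddCommGroup E] [NormedSpace ℝ E] {K : Set E}
    (hK : Convex ℝ K) {m : ℕ} (p : Fin (m + 2) → K) (i : Fin (m + 2)) (t) :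
    convexAff hK p (faceMap i t) = convexAff hK (p ∘ i.succAbove) t := by
  apply Subtype.ext
  rw [faceMap_eq_aff]
  change ∑ j, (∑ a, t.1 a • (stdSimplex.vertex (S := ℝ) (i.succAbove a)).1) j • (p j : E) =
    ∑ a, t.1 a • (p (i.succAbove a) : E)
  simp only [Finset.sum_apply, Finset.sum_smul]
  rw [Finset.sum_comm]
  simp [Pi.single_apply]

instance {m : ℕ} : AffineFaces (stdSimplex ℝ (Fin m)) := ⟨fun _ _ _ => convexAff_face _ _ _ _⟩

instance : AffineFaces unitInterval := ⟨fun _ _ _ => convexAff_face _ _ _ _⟩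

instance [AffineFaces K] [AffineFaces L] : AffineFaces (K × L) :=
  ⟨fun _ _ _ => Prod.ext (AffineFaces.aff_face _ _ _) (AffineFaces.aff_face _ _ _)⟩

end AffineMap

/-! ### Realization of lists as singular simplices -/

section Realize

variable {K L X Y : Type} [TopologicalSpace K] [TopologicalSpace L] [AffineSpan K] [AffineSpan L]
  [TopologicalSpace X] [TopologicalSpace Y]

/-- The image under `f` of the affine simplex with the given list of vertices. -/
def listSimplex (f : C(K, X)) : List K → SingChain X
  | [] => 0
  | v :: l => Finsupp.single ⟨l.length, f.comp (aff (v :: l).get)⟩ 1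

lemma listSimplex_eq (f : C(K, X)) (l : List K) {m : ℕ} (h : l.length = m + 1) :
    listSimplex f l = Finsupp.single ⟨m, f.comp (aff fun i => l.get (i.cast h.symm))⟩ 1 := by
  obtain _ | ⟨v, l⟩ := l
  · simp at h
  · obtain rfl : l.length = m := by simpa using h
    rfl

/-- The realization of formal combinations of lists. -/
def realize (f : C(K, X)) : ListChain K →ₗ[ℚ] SingChain X :=
  Finsupp.linearCombination ℚ (listSimplex f)

@[simp]
lemma realize_single (f : C(K, X)) (l : List K) :
    realize f (Finsupp.single l 1) = listSimplex f l := by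
  simp [realize]

/-- The augmented boundary of lists matches the unaugmented one of singular chains because the empty
list is realized by zero. -/
lemma bdry_realize [AffineFaces K] (f : C(K, X)) (c : ListChain K) :
    bdry (realize f c) = realize f (lbdry c) := by
  refine LinearMap.congr_fun (f := bdry ∘ₗ realize f) (g := realize f ∘ₗ lbdry) ?_ c
  ext l : 2
  obtain _ | ⟨v, _ | ⟨w, l⟩⟩ := l
  · simp [listSimplex]
  · simp [listSimplex, simplexBdry, listBdry]
  · simp only [LinearMap.comp_apply, Finsupp.lsingle_apply, realize_single, lbdry_single, listBdry,
      map_sum, map_smul, List.length_cons]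
    rw [show listSimplex f (v :: w :: l) =
      Finsupp.single ⟨l.length + 1, f.comp (aff (v :: w :: l).get)⟩ 1 from rfl, bdry_single]
    simp only [simplexBdry]
    refine Finset.sum_congr rfl fun i _ => ?_
    have h : ((v :: w :: l).eraseIdx i).length = l.length + 1 := by
      rw [List.length_eraseIdx_of_lt (by exact i.2)]; simp
    rw [listSimplex_eq f _ h]
    have : (f.comp (aff (v :: w :: l).get)).comp (faceMap i) = f.comp (aff fun j =>
        ((v :: w :: l).eraseIdx i).get (j.cast h.symm)) := ?_
    · rw [this]
    ext t
    simp only [ContinuousMap.comp_apply, AffineFaces.aff_face]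
    -- It remains to see that erasing the entry `i` is precomposition with `i.succAbove`.
    congr 3
    funext j
    simp only [Function.comp_apply, List.get_eq_getElem, Fin.val_cast, List.getElem_eraseIdx,
      Fin.succAbove, Fin.lt_def, Fin.val_castSucc]
    split_ifs <;> simp

lemma push_realize (g : C(X, Y)) (f : C(K, X)) (c : ListChain K) :
    push g (realize f c) = realize (g.comp f) c := by
  refine LinearMap.congr_fun (f := push g ∘ₗ realize f) (g := realize (g.comp f)) ?_ c
  ext l : 2
  obtain _ | ⟨v, l⟩ := l <;> simp [listSimplex, SingSimplex.push, ContinuousMap.comp_assoc]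

lemma listSimplex_map (f : C(L, X)) {g : C(K, L)} (hg : IsAff g) (l : List K) :
    listSimplex f (l.map g) = listSimplex (f.comp g) l := by
  obtain _ | ⟨v, l⟩ := l
  · rfl
  · rw [listSimplex_eq f ((v :: l).map g) (m := l.length) (by simp)]
    simp only [listSimplex]
    congr 2
    ext t
    simp only [ContinuousMap.comp_apply, hg _ _ t]
    congr 3
    funext i
    simp only [List.get_eq_getElem, List.getElem_map, Function.comp_apply, Fin.val_cast]

lemma realize_listPush (f : C(L, X)) {g : C(K, L)} (hg : IsAff g) (c : ListChain K) :
    realize f (listPush g c) = realize (f.comp g) c := by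
  refine LinearMap.congr_fun (f := realize f ∘ₗ listPush g) (g := realize (f.comp g)) ?_ c
  ext l : 2
  simp [listSimplex_map _ hg]

/-- The list of vertices of the standard simplex. -/
def vertexList (m : ℕ) : List (stdSimplex ℝ (Fin (m + 1))) :=
  List.ofFn fun i => stdSimplex.vertex i

lemma listSimplex_map_vertexList {m : ℕ} (f : C(K, X)) (g : C(stdSimplex ℝ (Fin (m + 1)), K)) :
    listSimplex f ((vertexList m).map g) =
      Finsupp.single ⟨m, f.comp (aff fun i => g (stdSimplex.vertex i))⟩ 1 := by
  rw [listSimplex_eq f _ (m := m) (by simp [vertexList])]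
  congr 4
  funext i
  simp only [vertexList, List.get_eq_getElem, List.getElem_map, List.getElem_ofFn]
  rfl

lemma listSimplex_vertexList {m : ℕ} (σ : C(stdSimplex ℝ (Fin (m + 1)), X)) :
    listSimplex σ (vertexList m) = Finsupp.single ⟨m, σ⟩ 1 := by
  have h := listSimplex_map_vertexList σ (.id (stdSimplex ℝ (Fin (m + 1))))
  rw [show ((ContinuousMap.id (stdSimplex ℝ (Fin (m + 1))) : _ → _)) = id from rfl,
    List.map_id] at h
  rw [h]
  congr 2
  ext t
  simp only [ContinuousMap.comp_apply]
  congr 1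
  exact aff_vertices t

/-- With naturality under the affine maps `faceMap i`, this carries boundary formulas for lists over
to singular simplices. -/
lemma listBdry_vertexList (m : ℕ) :
    listBdry (vertexList (m + 1)) =
      ∑ i : Fin (m + 2), (-1 : ℚ) ^ (i : ℕ) • Finsupp.single ((vertexList m).map (faceMap i)) 1 := by
  unfold listBdry
  refine Fintype.sum_equiv (finCongr (by simp [vertexList])) _ _ fun i => ?_
  simp only [finCongr_apply, Fin.val_cast]
  congr 2
  apply List.ext_getElem
  · rw [List.length_eraseIdx_of_lt i.2]; simp [vertexList]
  · intro j h₁ h₂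
    simp only [List.getElem_eraseIdx, vertexList, List.getElem_ofFn, List.getElem_map,
      faceMap_vertex, Fin.succAbove, Fin.lt_def, Fin.val_castSucc]
    by_cases hj : j < i
    · exact (dif_pos hj).trans (congrArg _ (if_pos (c := j < i) hj).symm)
    · exact (dif_neg hj).trans (congrArg _ (if_neg (c := j < i) hj).symm)

end Realize

/-! ### Natural operators on singular chains -/

section Operator

variable {X Y : Type} [TopologicalSpace X] [TopologicalSpace Y]
  (θ : ∀ m, ListChain (stdSimplex ℝ (Fin (m + 1))))

/-- The natural operator on singular chains given by a chain in each standard simplex. -/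
def operator : SingChain X →ₗ[ℚ] SingChain X :=
  Finsupp.linearCombination ℚ fun σ => realize σ.2 (θ σ.1)

@[simp]
lemma operator_single (σ : SingSimplex X) :
    operator θ (Finsupp.single σ 1) = realize σ.2 (θ σ.1) := by
  simp [operator]

lemma operator_push (g : C(X, Y)) (c : SingChain X) :
    operator θ (push g c) = push g (operator θ c) := by
  refine LinearMap.congr_fun (f := operator θ ∘ₗ push g) (g := push g ∘ₗ operator θ) ?_ c
  ext σ : 2
  simp [push_realize, SingSimplex.push]

/-- The prism operator of a homotopy. -/
def prism (H : C(X × unitInterval, Y)) : SingChain X →ₗ[ℚ] SingChain Y :=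
  Finsupp.linearCombination ℚ fun σ =>
    realize (H.comp (σ.2.prodMap (.id _))) (listPrism (vertexList σ.1))

@[simp]
lemma prism_single (H : C(X × unitInterval, Y)) (σ : SingSimplex X) :
    prism H (Finsupp.single σ 1) =
      realize (H.comp (σ.2.prodMap (.id _))) (listPrism (vertexList σ.1)) := by
  simp [prism]

/-- The map at time `t` of a homotopy. -/
def atTime (H : C(X × unitInterval, Y)) (t : unitInterval) : C(X, Y) :=
  H.comp ((ContinuousMap.id X).prodMk (.const _ t))

lemma listSimplex_atTime (H : C(X × unitInterval, Y)) (σ : SingSimplex X) (t : unitInterval) :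
    listSimplex (H.comp (σ.2.prodMap (.id _))) ((vertexList σ.1).map (·, t)) =
      Finsupp.single (σ.push (atTime H t)) 1 := by
  have h := listSimplex_map_vertexList (H.comp (σ.2.prodMap (.id _)))
    ((ContinuousMap.id (stdSimplex ℝ (Fin (σ.1 + 1)))).prodMk (.const _ t))
  change listSimplex _ ((vertexList σ.1).map (·, t)) = _ at h
  rw [h]
  unfold SingSimplex.push
  congr 2
  ext x
  change H (σ.2 (aff (fun i => stdSimplex.vertex i) x), aff (fun i => t) x) = H (σ.2 x, t)
  rw [aff_vertices, aff_const_unitInterval]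

lemma bdry_prism (H : C(X × unitInterval, Y)) (c : SingChain X) :
    bdry (prism H c) = push (atTime H 1) c - push (atTime H 0) c - prism H (bdry c) := by
  refine LinearMap.congr_fun (f := bdry ∘ₗ prism H)
    (g := push (atTime H 1) - push (atTime H 0) - prism H ∘ₗ bdry) ?_ c
  ext σ : 2
  simp only [LinearMap.comp_apply, Finsupp.lsingle_apply, prism_single, bdry_realize,
    lbdry_listPrism, map_sub, realize_single, listSimplex_atTime, LinearMap.sub_apply,
    push_single, bdry_single]
  congr 1
  obtain ⟨_ | m, σ⟩ := σ
  -- The augmented boundary of a vertex is the empty list, whose prism is zero.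
  · simp [simplexBdry, vertexList, listBdry_cons, listPrism]
  · simp only [listBdry_vertexList, simplexBdry, map_sum, map_smul, lprism_single, prism_single]
    refine Finset.sum_congr rfl fun i _ => ?_
    -- The prism over a face is the image of the prism under `faceMap i × id`, which preserves
    -- affine simplices.
    rw [← listPush_listPrism]
    have := realize_listPush (H.comp (σ.prodMap (.id unitInterval)))
      (g := (faceMap i).prodMap (.id unitInterval)) (isAff_faceMap i).prodMap_id
      (listPrism (vertexList m))
    exact congrArg _ this

lemma push_prism {Z : Type} [TopologicalSpace Z] (g : C(Y, Z)) (H : C(X × unitInterval, Y))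
    (c : SingChain X) : push g (prism H c) = prism (g.comp H) c := by
  refine LinearMap.congr_fun (f := push g ∘ₗ prism H) (g := prism (g.comp H)) ?_ c
  ext σ : 2
  simp [push_realize, ContinuousMap.comp_assoc]

lemma prism_push {Z : Type} [TopologicalSpace Z] (g : C(Z, X)) (H : C(X × unitInterval, Y))
    (c : SingChain Z) : prism H (push g c) = prism (H.comp (g.prodMap (.id _))) c := by
  refine LinearMap.congr_fun (f := prism H ∘ₗ push g) (g := prism (H.comp (g.prodMap (.id _)))) ?_ c
  ext σ : 2
  simp only [LinearMap.comp_apply, Finsupp.lsingle_apply, push_single, prism_single]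
  rfl

end Operator

end

/-! ### Barycentric subdivision and chains subordinate to an open cover. -/

noncomputable section

open AffineSpan

/-! ### Barycentric subdivision -/

section Subdivision

variable {K L : Type} [TopologicalSpace K] [TopologicalSpace L] [AffineSpan K] [AffineSpan L]

/-- The barycenter of a non-empty list of points. -/
def listCenter (v : K) (l : List K) : K := aff (v :: l).get stdSimplex.barycenter

lemma listCenter_map {g : K → L} (hg : IsAff g) (v : K) (l : List K) :
    g (listCenter v l) = listCenter (g v) (l.map g) := by
  -- The lengths of `l` and `l.map g` agree only propositionally; a free dimension `m` lets the cast
  -- disappear by `rfl`.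
  have key : ∀ (m : ℕ) (h : l.length = m) (p : Fin (m + 1) → L)
      (_ : ∀ i, p i = g ((v :: l).get (i.cast (by simp [h])))),
      aff (g ∘ (v :: l).get) stdSimplex.barycenter = aff p stdSimplex.barycenter := by
    rintro _ rfl p hp
    congr 1
    congr 1
    funext i
    rw [hp]; rfl
  rw [listCenter, hg, key (l.map g).length (by simp) (g v :: l.map g).get]
  · rfl
  · intro i
    simp only [← List.map_cons, List.get_eq_getElem, List.getElem_map, Fin.val_cast]

/-- The barycentric subdivision of a list. -/
def listSd : List K → ListChain K
  | [] => Finsupp.single [] 1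
  | v :: l => cone (listCenter v l)
      (∑ i : Fin (v :: l).length, (-1 : ℚ) ^ (i : ℕ) • listSd ((v :: l).eraseIdx i))
termination_by l => l.length
decreasing_by
  rw [List.length_eraseIdx_of_lt i.2]
  simp

/-- The linear extension of barycentric subdivision. -/
def lsd : ListChain K →ₗ[ℚ] ListChain K := Finsupp.linearCombination ℚ listSd

@[simp]
lemma lsd_single (l : List K) : lsd (Finsupp.single l 1) = listSd l := by
  simp [lsd]

lemma listSd_cons (v : K) (l : List K) :
    listSd (v :: l) = cone (listCenter v l) (lsd (listBdry (v :: l))) := by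
  rw [listSd]
  simp only [listBdry, map_sum, map_smul, lsd_single]

/-- The homotopy between barycentric subdivision and the identity. -/
def listSdHomotopy : List K → ListChain K
  | [] => 0
  | v :: l => cone (listCenter v l) (Finsupp.single (v :: l) 1 -
      ∑ i : Fin (v :: l).length, (-1 : ℚ) ^ (i : ℕ) • listSdHomotopy ((v :: l).eraseIdx i))
termination_by l => l.length
decreasing_by
  rw [List.length_eraseIdx_of_lt i.2]
  simp

/-- The linear extension of the subdivision homotopy. -/
def lsdHomotopy : ListChain K →ₗ[ℚ] ListChain K := Finsupp.linearCombination ℚ listSdHomotopy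

@[simp]
lemma lsdHomotopy_single (l : List K) : lsdHomotopy (Finsupp.single l 1) = listSdHomotopy l := by
  simp [lsdHomotopy]

lemma listSdHomotopy_cons (v : K) (l : List K) :
    listSdHomotopy (v :: l) = cone (listCenter v l) (Finsupp.single (v :: l) 1 -
      lsdHomotopy (listBdry (v :: l))) := by
  rw [listSdHomotopy]
  simp only [listBdry, map_sum, map_smul, lsdHomotopy_single]

/-- Induction over the faces of a list. -/
lemma list_face_induction {K : Type} {P : List K → Prop} (nil : P [])
    (cons : ∀ v l, (∀ i : Fin (v :: l).length, P ((v :: l).eraseIdx i)) → P (v :: l))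
    (l : List K) : P l := by
  induction h : l.length using Nat.strong_induction_on generalizing l with
  | _ n ih =>
    obtain _ | ⟨v, l⟩ := l
    · exact nil
    · refine cons v l fun i => ih _ ?_ _ rfl
      rw [List.length_eraseIdx_of_lt i.2, ← h]
      simp

/-- Linear maps that agree on all faces agree on the boundary. -/
lemma map_listBdry_congr {K : Type} {M : Type} [AddCommGroup M] [Module ℚ M] {f g : ListChain K →ₗ[ℚ] M}
    {l : List K} (h : ∀ i : Fin l.length,
      f (Finsupp.single (l.eraseIdx i) 1) = g (Finsupp.single (l.eraseIdx i) 1)) :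
    f (listBdry l) = g (listBdry l) := by
  simp only [listBdry, map_sum, map_smul, h]

/-- By the cone formula, the error is the cone over `∂ sd ∂ l`, which by induction on faces is `sd ∂
∂ l = 0`. -/
lemma lbdry_listSd (l : List K) : lbdry (listSd l) = lsd (listBdry l) := by
  induction l using list_face_induction with
  | nil => simp [listSd]
  | cons v l ih =>
    have h : lbdry (lsd (listBdry (v :: l))) = lsd (lbdry (listBdry (v :: l))) :=
      map_listBdry_congr (f := lbdry ∘ₗ lsd) (g := lsd ∘ₗ lbdry) fun i => by simpa using ih i
    rw [listSd_cons, lbdry_cone, h, lbdry_listBdry]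
    simp

/-- Write `T` for the homotopy. By induction `∂ T ∂ l = ∂ l - sd ∂ l`, so the base `l - T ∂ l` of
the cone defining `T l` has boundary `sd ∂ l`, and the cone over that is `sd l`. -/
lemma lbdry_listSdHomotopy (l : List K) :
    lbdry (listSdHomotopy l) = Finsupp.single l 1 - listSd l - lsdHomotopy (listBdry l) := by
  induction l using list_face_induction with
  | nil => simp [listSd, listSdHomotopy]
  | cons v l ih =>
    have h : (lbdry ∘ₗ lsdHomotopy) (listBdry (v :: l)) =
        (LinearMap.id - lsd - lsdHomotopy ∘ₗ lbdry : ListChain K →ₗ[ℚ] ListChain K)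
          (listBdry (v :: l)) :=
      map_listBdry_congr fun i => by
        simp only [LinearMap.comp_apply, LinearMap.sub_apply, LinearMap.id_apply, lbdry_single,
          lsd_single, lsdHomotopy_single]
        exact ih i
    simp only [LinearMap.comp_apply, LinearMap.sub_apply, LinearMap.id_apply, lbdry_listBdry,
      map_zero, sub_zero] at h
    rw [listSdHomotopy_cons, lbdry_cone, map_sub, h, listSd_cons, lbdry_single]
    simp only [sub_sub_cancel]
    abel

lemma listBdry_cons_map {K L : Type} {g : K → L} (v : K) (l : List K) :
    listBdry (g v :: l.map g) = listPush g (listBdry (v :: l)) := by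
  rw [← lbdry_single (v :: l), ← lbdry_listPush]
  simp

lemma listPush_listSd {g : K → L} (hg : IsAff g) (l : List K) :
    listPush g (listSd l) = listSd (l.map g) := by
  induction l using list_face_induction with
  | nil => simp [listSd]
  | cons v l ih =>
    have h : listPush g (lsd (listBdry (v :: l))) = lsd (listPush g (listBdry (v :: l))) :=
      map_listBdry_congr (f := listPush g ∘ₗ lsd) (g := lsd ∘ₗ listPush g) fun i => by
        simpa using ih i
    rw [listSd_cons, listPush_cone, h, List.map_cons, listSd_cons, listCenter_map hg,
      listBdry_cons_map]

lemma listPush_listSdHomotopy {g : K → L} (hg : IsAff g) (l : List K) :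
    listPush g (listSdHomotopy l) = listSdHomotopy (l.map g) := by
  induction l using list_face_induction with
  | nil => simp [listSdHomotopy]
  | cons v l ih =>
    have h : listPush g (lsdHomotopy (listBdry (v :: l))) =
        lsdHomotopy (listPush g (listBdry (v :: l))) :=
      map_listBdry_congr (f := listPush g ∘ₗ lsdHomotopy) (g := lsdHomotopy ∘ₗ listPush g)
        fun i => by simpa using ih i
    rw [listSdHomotopy_cons, listPush_cone, map_sub, h, List.map_cons, listSdHomotopy_cons,
      listCenter_map hg, listBdry_cons_map]
    simp

end Subdivision

/-! ### Subdivision of singular chains -/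

section SingSubdivision

variable {X Y : Type} [TopologicalSpace X] [TopologicalSpace Y]

/-- Barycentric subdivision of singular chains. -/
def singSd : SingChain X →ₗ[ℚ] SingChain X := operator fun m => listSd (vertexList m)

/-- The homotopy between the identity and barycentric subdivision on singular chains. -/
def singSdHomotopy : SingChain X →ₗ[ℚ] SingChain X :=
  operator fun m => listSdHomotopy (vertexList m)

/-- For positive dimension this is naturality under face inclusions. For a vertex the list boundary
is the empty list, and `h0` ensures that its image is still realized by zero. -/
lemma operator_simplexBdry (θ : ∀ (m : ℕ), List (stdSimplex ℝ (Fin (m + 1))) →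
      ListChain (stdSimplex ℝ (Fin (m + 1))))
    (hθ : ∀ m (i : Fin (m + 2)) (l), listPush (faceMap i) (θ m l) = θ (m + 1) (l.map (faceMap i)))
    (h0 : θ 0 [] ∈ Submodule.span ℚ {Finsupp.single [] 1}) (σ : SingSimplex X) :
    operator (fun m => θ m (vertexList m)) (simplexBdry σ) =
      realize σ.2 (Finsupp.linearCombination ℚ (θ σ.1) (listBdry (vertexList σ.1))) := by
  obtain ⟨_ | m, σ⟩ := σ
  · obtain ⟨a, ha⟩ := Submodule.mem_span_singleton.1 h0
    have : listBdry (vertexList 0) = Finsupp.single [] 1 := by simp [vertexList, listBdry_cons]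
    rw [this, Finsupp.linearCombination_single, one_smul, ← ha, map_smul, realize_single]
    simp [simplexBdry, listSimplex]
  · simp only [listBdry_vertexList, simplexBdry, map_sum, map_smul, operator_single,
      Finsupp.linearCombination_single, one_smul]
    refine Finset.sum_congr rfl fun i _ => ?_
    rw [← hθ, realize_listPush _ (isAff_faceMap i)]

lemma bdry_singSd (c : SingChain X) : bdry (singSd c) = singSd (bdry c) := by
  refine LinearMap.congr_fun (f := bdry ∘ₗ singSd) (g := singSd ∘ₗ bdry) ?_ c
  ext σ : 2
  have h := operator_simplexBdry (fun _ => listSd)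
    (fun m i l => listPush_listSd (isAff_faceMap i) l)
    (by rw [listSd]; exact Submodule.mem_span_singleton_self _) σ
  simp only [LinearMap.comp_apply, Finsupp.lsingle_apply, bdry_single, singSd, h, operator_single,
    bdry_realize, lbdry_listSd]
  rfl

lemma bdry_singSdHomotopy (c : SingChain X) :
    bdry (singSdHomotopy c) = c - singSd c - singSdHomotopy (bdry c) := by
  refine LinearMap.congr_fun (f := bdry ∘ₗ singSdHomotopy)
    (g := LinearMap.id - singSd - singSdHomotopy ∘ₗ bdry) ?_ c
  ext σ : 2
  have h := operator_simplexBdry (fun _ => listSdHomotopy)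
    (fun m i l => listPush_listSdHomotopy (isAff_faceMap i) l)
    (by rw [listSdHomotopy]; exact Submodule.zero_mem _) σ
  simp only [LinearMap.comp_apply, Finsupp.lsingle_apply, bdry_single, singSdHomotopy, h,
    operator_single, bdry_realize, lbdry_listSdHomotopy, LinearMap.sub_apply, LinearMap.id_apply,
    singSd, map_sub, realize_single, listSimplex_vertexList]
  rfl

lemma singSd_push (g : C(X, Y)) (c : SingChain X) : singSd (push g c) = push g (singSd c) :=
  operator_push _ _ _

lemma singSdHomotopy_push (g : C(X, Y)) (c : SingChain X) :
    singSdHomotopy (push g c) = push g (singSdHomotopy c) :=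
  operator_push _ _ _

lemma map_aff_vertexList {K : Type} [TopologicalSpace K] [AffineSpan K] (v : K) (l : List K) :
    (vertexList l.length).map (aff (v :: l).get) = v :: l := by
  apply List.ext_getElem
  · simp [vertexList]
  · intro i h₁ h₂
    simp only [vertexList, List.getElem_map, List.getElem_ofFn, aff_vertex]
    rfl

/-- Iterated subdivision of a singular simplex can thus be computed on lists of points in one
standard simplex, where mesh estimates are available. -/
lemma singSd_realize {m : ℕ} (f : C(stdSimplex ℝ (Fin (m + 1)), X)) (c) :
    singSd (realize f c) = realize f (lsd c) := by
  refine LinearMap.congr_fun (f := singSd ∘ₗ realize f) (g := realize f ∘ₗ lsd) ?_ c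
  ext l : 2
  obtain _ | ⟨v, l⟩ := l
  · simp [listSimplex, listSd]
  · simp only [LinearMap.comp_apply, Finsupp.lsingle_apply, realize_single, lsd_single,
      listSimplex, singSd, operator_single]
    rw [← realize_listPush f (isAff_aff_simplex _), listPush_listSd (isAff_aff_simplex _),
      map_aff_vertexList]

lemma iterate_singSd_single (σ : SingSimplex X) (k : ℕ) :
    (singSd ^ k) (Finsupp.single σ 1) =
      realize σ.2 ((lsd ^ k) (Finsupp.single (vertexList σ.1) 1)) := by
  induction k with
  | zero => simp [listSimplex_vertexList]
  | succ k ih => rw [pow_succ', pow_succ', Module.End.mul_apply, ih, singSd_realize]; rfl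

/-- The chains in the subset `V`. -/
def chainsIn (V : Set X) : Submodule ℚ (SingChain X) :=
  Finsupp.supported ℚ ℚ {σ | Set.range σ.2 ⊆ V}

lemma single_mem_chainsIn {V : Set X} {σ : SingSimplex X} (h : Set.range σ.2 ⊆ V) :
    Finsupp.single σ 1 ∈ chainsIn V := Finsupp.single_mem_supported _ _ h

lemma realize_mem {K : Type} [TopologicalSpace K] [AffineSpan K] {f : C(K, X)} {c : ListChain K}
    {M : Submodule ℚ (SingChain X)} (h : ∀ l ∈ c.support, listSimplex f l ∈ M) :
    realize f c ∈ M := by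
  rw [realize, Finsupp.linearCombination_apply, Finsupp.sum]
  exact Submodule.sum_mem _ fun l hl => M.smul_mem _ (h l hl)

lemma listSimplex_mem {K : Type} [TopologicalSpace K] [AffineSpan K] {f : C(K, X)} {V : Set X}
    (h : ∀ x, f x ∈ V) (l : List K) : listSimplex f l ∈ chainsIn V := by
  obtain _ | ⟨v, l⟩ := l
  · exact Submodule.zero_mem _
  · exact single_mem_chainsIn (by rintro _ ⟨t, rfl⟩; exact h _)

/-- A linear map preserves chains in `V` as soon as it does so on simplices. -/
lemma map_mem_of_single {V : Set X} {M : Submodule ℚ (SingChain Y)}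
    (f : SingChain X →ₗ[ℚ] SingChain Y)
    (h : ∀ σ : SingSimplex X, Set.range σ.2 ⊆ V → f (Finsupp.single σ 1) ∈ M) {c : SingChain X}
    (hc : c ∈ chainsIn V) : f c ∈ M := by
  rw [chainsIn, Finsupp.supported_eq_span_single] at hc
  induction hc using Submodule.span_induction with
  | mem x hx => obtain ⟨σ, hσ, rfl⟩ := hx; exact h σ hσ
  | zero => simp
  | add x y _ _ hx hy => rw [map_add]; exact M.add_mem hx hy
  | smul a x _ hx => rw [map_smul]; exact M.smul_mem a hx

/-- All simplices produced from `σ` factor through `σ`. -/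
lemma operator_mem {θ : ∀ m, ListChain (stdSimplex ℝ (Fin (m + 1)))} {V : Set X} {c : SingChain X}
    (hc : c ∈ chainsIn V) : operator θ c ∈ chainsIn V :=
  map_mem_of_single (operator θ) (fun σ hσ => by
    rw [operator_single]
    exact realize_mem fun l _ => listSimplex_mem (fun x => hσ ⟨x, rfl⟩) l) hc

lemma bdry_mem {V : Set X} {c : SingChain X} (hc : c ∈ chainsIn V) : bdry c ∈ chainsIn V :=
  map_mem_of_single bdry (fun σ hσ => by
    rw [bdry_single]
    obtain ⟨_ | m, σ⟩ := σ
    · exact Submodule.zero_mem _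
    · refine Submodule.sum_mem _ fun i _ => Submodule.smul_mem _ _ (single_mem_chainsIn ?_)
      rintro _ ⟨t, rfl⟩
      exact hσ ⟨_, rfl⟩) hc

lemma push_mem {g : C(X, Y)} {V : Set Y} {c : SingChain X} (hc : c ∈ chainsIn (g ⁻¹' V)) :
    push g c ∈ chainsIn V :=
  map_mem_of_single (push g) (fun σ hσ => by
    rw [push_single]
    refine single_mem_chainsIn ?_
    rintro _ ⟨t, rfl⟩
    exact hσ ⟨t, rfl⟩) hc

lemma chainsIn_mono {V W : Set X} (h : V ⊆ W) : chainsIn V ≤ chainsIn W :=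
  Finsupp.supported_mono fun _ hσ => hσ.trans h

/-! #### Mesh -/

lemma dist_aff_le {m k : ℕ} {x : stdSimplex ℝ (Fin k)} {p : Fin (m + 1) → stdSimplex ℝ (Fin k)}
    {r : ℝ} (h : ∀ i, dist x (p i) ≤ r) (t) : dist x (aff p t) ≤ r := by
  have := (convex_closedBall x.1 r).sum_mem (t := Finset.univ) (w := t.1) (z := fun i => (p i).1)
    (fun i _ => t.2.1 i) t.2.2 fun i _ => by
      rw [Metric.mem_closedBall, dist_comm]; exact h i
  rw [Metric.mem_closedBall, dist_comm] at this
  exact this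

/-- The difference of the barycenter and `p j` is the mean of the `m + 1` vectors `p i - p j`, one
of which is zero. -/
lemma dist_center_le {m k : ℕ} {p : Fin (m + 1) → stdSimplex ℝ (Fin k)} {d : ℝ}
    (h : ∀ i j, dist (p i) (p j) ≤ d) (j : Fin (m + 1)) :
    dist (aff p stdSimplex.barycenter) (p j) ≤ m / (m + 1) * d := by
  have hb : ((aff p stdSimplex.barycenter).1 : Fin k → ℝ) - (p j).1 =
      ∑ i, ((m : ℝ) + 1)⁻¹ • ((p i).1 - (p j).1) := by
    change ∑ i, (stdSimplex.barycenter (𝕜 := ℝ) (X := Fin (m + 1))).1 i • (p i).1 - _ = _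
    have hi : ∀ i, (stdSimplex.barycenter (𝕜 := ℝ) (X := Fin (m + 1))).1 i = ((m : ℝ) + 1)⁻¹ :=
      fun i => by simp
    simp only [hi, smul_sub, Finset.sum_sub_distrib,
      Finset.sum_const, Finset.card_univ, Fintype.card_fin, ← Nat.cast_smul_eq_nsmul ℝ, smul_smul]
    push_cast
    rw [mul_inv_cancel₀ (by positivity), one_smul]
  rw [Subtype.dist_eq, dist_eq_norm, hb, ← Finset.add_sum_erase _ _ (Finset.mem_univ j), sub_self,
    smul_zero, zero_add]
  refine (norm_sum_le _ _).trans ?_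
  have : ∀ i ∈ Finset.univ.erase j, ‖((m : ℝ) + 1)⁻¹ • ((p i).1 - (p j).1)‖ ≤
      ((m : ℝ) + 1)⁻¹ * d := fun i _ => by
    rw [norm_smul, Real.norm_of_nonneg (by positivity), ← dist_eq_norm]
    exact mul_le_mul_of_nonneg_left (h i j) (by positivity)
  refine (Finset.sum_le_sum this).trans ?_
  rw [Finset.sum_const, Finset.card_erase_of_mem (Finset.mem_univ _), Finset.card_univ,
    Fintype.card_fin, nsmul_eq_mul, Nat.add_sub_cancel]
  exact le_of_eq (by ring)

lemma exists_face_of_mem_listSd {K : Type} [TopologicalSpace K] [AffineSpan K] {v : K}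
    {l l' : List K} (h : l' ∈ (listSd (v :: l)).support) :
    ∃ i : Fin (v :: l).length, ∃ l'' ∈ (listSd ((v :: l).eraseIdx i)).support,
      l' = listCenter v l :: l'' := by
  classical
  rw [listSd_cons, cone, Finsupp.lmapDomain_apply] at h
  obtain ⟨l'', hl'', rfl⟩ := Finset.mem_image.1 (Finsupp.mapDomain_support h)
  simp only [listBdry, map_sum, map_smul, lsd_single] at hl''
  obtain ⟨i, -, hi⟩ := Finsupp.mem_support_finsetSum _ hl''
  exact ⟨i, l'', Finsupp.support_smul hi, rfl⟩

/-- The clause on closed balls serves the induction: it bounds the distance from the new barycenter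
to the vertices of the subdivided faces. A common bound `N` on dimensions gives one contraction
factor for all faces. -/
lemma listSd_mesh {k N : ℕ} {d : ℝ} (l : List (stdSimplex ℝ (Fin k))) (hN : l.length ≤ N + 1)
    (hd : ∀ v ∈ l, ∀ w ∈ l, dist v w ≤ d) : ∀ l' ∈ (listSd l).support,
      l'.length ≤ l.length ∧ (∀ x r, (∀ v ∈ l, dist x v ≤ r) → ∀ w ∈ l', dist x w ≤ r) ∧
      ∀ v ∈ l', ∀ w ∈ l', dist v w ≤ N / (N + 1) * d := by
  induction l using list_face_induction with
  | nil =>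
    intro l' hl'
    rw [listSd] at hl'
    obtain rfl := Finset.mem_singleton.1 (Finsupp.support_single_subset hl')
    simp
  | cons v l ih =>
    intro l' hl'
    obtain ⟨i, l'', hl'', rfl⟩ := exists_face_of_mem_listSd hl'
    have hsub : ∀ w ∈ (v :: l).eraseIdx i, w ∈ v :: l := fun w hw => List.mem_of_mem_eraseIdx hw
    have hlen : ((v :: l).eraseIdx i).length = l.length := by
      rw [List.length_eraseIdx_of_lt i.2]; simp
    obtain ⟨h₁, h₂, h₃⟩ := ih i (by rw [hlen]; simp only [List.length_cons] at hN; omega) (fun a ha b hb => hd a (hsub a ha) b (hsub b hb)) l'' hl''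
    have hd0 : 0 ≤ d := (dist_nonneg (x := v) (y := v)).trans (hd v (by simp) v (by simp))
    have hget : ∀ j, dist (listCenter v l) ((v :: l).get j) ≤ N / (N + 1) * d := fun j => by
      refine (dist_center_le (fun a b => hd _ (List.get_mem _ _) _ (List.get_mem _ _)) j).trans ?_
      refine mul_le_mul_of_nonneg_right ?_ hd0
      have : (l.length : ℝ) ≤ N := by exact_mod_cast (by simpa using hN : l.length ≤ N)
      rw [div_le_div_iff₀ (by positivity) (by positivity)]
      nlinarith
    have hmem : ∀ w ∈ v :: l, dist (listCenter v l) w ≤ N / (N + 1) * d := fun w hw => by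
      obtain ⟨j, rfl⟩ := List.get_of_mem hw
      exact hget j
    have hc : ∀ w ∈ l'', dist (listCenter v l) w ≤ N / (N + 1) * d :=
      h₂ _ _ fun w hw => hmem w (hsub w hw)
    refine ⟨by simp only [List.length_cons]; omega, fun x r hx w hw => ?_, fun a ha b hb => ?_⟩
    · obtain rfl | hw := List.mem_cons.1 hw
      · exact dist_aff_le (fun j => hx _ (List.get_mem _ _)) _
      · exact h₂ x r (fun a ha => hx a (hsub a ha)) w hw
    · obtain rfl | ha := List.mem_cons.1 ha <;> obtain rfl | hb := List.mem_cons.1 hb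
      · rw [dist_self]; positivity
      · exact hc b hb
      · rw [dist_comm]; exact hc a ha
      · exact h₃ a ha b hb

lemma iterate_lsd_mesh {k N : ℕ} {d : ℝ} {c : ListChain (stdSimplex ℝ (Fin k))}
    (hc : ∀ l ∈ c.support, l.length ≤ N + 1 ∧ ∀ v ∈ l, ∀ w ∈ l, dist v w ≤ d) (j : ℕ) :
    ∀ l ∈ ((lsd ^ j) c).support, l.length ≤ N + 1 ∧
      ∀ v ∈ l, ∀ w ∈ l, dist v w ≤ (N / (N + 1) : ℝ) ^ j * d := by
  induction j with
  | zero => simpa using hc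
  | succ j ih =>
    intro l hl
    rw [pow_succ', Module.End.mul_apply, lsd, Finsupp.linearCombination_apply] at hl
    obtain ⟨l₀, hl₀, hl⟩ := Finsupp.mem_support_finsetSum _ hl
    obtain ⟨h₁, h₂⟩ := ih l₀ hl₀
    obtain ⟨h₃, -, h₄⟩ := listSd_mesh l₀ h₁ h₂ l (Finsupp.support_smul hl)
    refine ⟨h₃.trans h₁, ?_⟩
    rw [pow_succ', mul_assoc]
    exact h₄

lemma iterate_singSd_mem_sup {A B : Set X} (j : ℕ) {c : SingChain X}
    (hc : c ∈ chainsIn A ⊔ chainsIn B) : (singSd ^ j) c ∈ chainsIn A ⊔ chainsIn B := by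
  induction j with
  | zero => exact hc
  | succ j ih =>
    obtain ⟨a, ha, b, hb, h⟩ := Submodule.mem_sup.1 ih
    rw [pow_succ', Module.End.mul_apply, ← h, map_add]
    exact Submodule.add_mem_sup (operator_mem ha) (operator_mem hb)

/-- Sufficiently fine subdivisions are subordinate to an open cover by two sets. -/
lemma exists_iterate_singSd_mem {A B : Set X} (hA : IsOpen A) (hB : IsOpen B) {c : SingChain X}
    (hc : c ∈ chainsIn (A ∪ B)) : ∃ k, (singSd ^ k) c ∈ chainsIn A ⊔ chainsIn B := by
  rw [chainsIn, Finsupp.supported_eq_span_single] at hc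
  induction hc using Submodule.span_induction with
  | zero => exact ⟨0, by simp⟩
  | add x y _ _ hx hy =>
    obtain ⟨k₁, h₁⟩ := hx
    obtain ⟨k₂, h₂⟩ := hy
    refine ⟨k₁ + k₂, ?_⟩
    rw [map_add]
    refine Submodule.add_mem _ ?_ ?_
    · rw [add_comm, pow_add]; exact iterate_singSd_mem_sup _ h₁
    · rw [pow_add]; exact iterate_singSd_mem_sup _ h₂
  | smul a x _ hx =>
    obtain ⟨k, h⟩ := hx
    exact ⟨k, by rw [map_smul]; exact Submodule.smul_mem _ _ h⟩
  | mem x hx =>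
    obtain ⟨⟨m, σ⟩, hσ, rfl⟩ := hx
    obtain ⟨δ, hδ, hball⟩ := lebesgue_number_lemma_of_metric
      (s := (Set.univ : Set (stdSimplex ℝ (Fin (m + 1))))) (ι := Bool)
      (c := fun b => σ ⁻¹' (bif b then A else B)) isCompact_univ
      (fun b => by cases b; exacts [hB.preimage σ.continuous, hA.preimage σ.continuous])
      (fun x _ => by
        obtain h | h := hσ ⟨x, rfl⟩
        · exact Set.mem_iUnion.2 ⟨true, h⟩
        · exact Set.mem_iUnion.2 ⟨false, h⟩)
    have hlt : ((m : ℝ) / (m + 1)) < 1 := by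
      rw [div_lt_one (by positivity)]; exact lt_add_one _
    obtain ⟨k, hk⟩ : ∃ k : ℕ, ((m : ℝ) / (m + 1)) ^ k * 2 < δ := by
      have := (tendsto_pow_atTop_nhds_zero_of_lt_one (by positivity) hlt).mul_const 2
      rw [zero_mul] at this
      exact (this.eventually_lt_const hδ).exists
    refine ⟨k, ?_⟩
    rw [iterate_singSd_single]
    refine realize_mem fun l hl => ?_
    -- The simplex lies in the unit ball around the origin, so its diameter is at most 2.
    have hmesh := (iterate_lsd_mesh (N := m) (d := 2) (fun l hl => by
      obtain rfl := Finset.mem_singleton.1 (Finsupp.support_single_subset hl)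
      refine ⟨by simp [vertexList], fun v _ w _ => ?_⟩
      have hv := stdSimplex_subset_closedBall v.2
      have hw := stdSimplex_subset_closedBall w.2
      rw [Metric.mem_closedBall] at hv hw
      exact (dist_triangle_right v.1 w.1 0).trans (by linarith)) k l hl).2
    obtain _ | ⟨v, l⟩ := l
    · exact Submodule.zero_mem _
    · obtain ⟨b, hb⟩ := hball v trivial
      have : ∀ t, σ (aff (v :: l).get t) ∈ (bif b then A else B) := fun t => by
        refine hb (Metric.mem_ball.2 ?_)
        rw [dist_comm]
        exact (dist_aff_le (fun j => hmesh v (by simp) _ (List.get_mem _ _)) t).trans_lt hk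
      cases b
      · refine Submodule.mem_sup_right (single_mem_chainsIn ?_)
        rintro _ ⟨t, rfl⟩; exact this t
      · refine Submodule.mem_sup_left (single_mem_chainsIn ?_)
        rintro _ ⟨t, rfl⟩; exact this t

end SingSubdivision

end

/-! ### Acyclicity of the mapping cone for quotients by finite groups. -/

noncomputable section

/-! ### Quotients by finite groups -/

section Quotient

variable {X Y P : Type} [TopologicalSpace X] [TopologicalSpace Y] [Group P] [Fintype P]

/-- `π` is a surjection whose fibres are the orbits of the action `ρ` of the group `P`. -/
structure IsOrbitMap (π : C(X, Y)) (ρ : P → C(X, X)) : Prop where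
  mul : ∀ g h, ρ (g * h) = (ρ g).comp (ρ h)
  map_act : ∀ g x, π (ρ g x) = π x
  transitive : ∀ x x', π x = π x' → ∃ g, ρ g x = x'
  surjective : Function.Surjective π

variable {π : C(X, Y)} {ρ : P → C(X, X)}

/-- The chains that are invariant under a family of maps. -/
def invChains (ρ : P → C(X, X)) : Submodule ℚ (SingChain X) :=
  ⨅ g, LinearMap.eqLocus (push (ρ g)) LinearMap.id

omit [Group P] [Fintype P] in
lemma mem_invChains {x : SingChain X} : x ∈ invChains ρ ↔ ∀ g, push (ρ g) x = x := by
  simp [invChains, Submodule.mem_iInf]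

/-- The average of a chain over a finite group. -/
def avg (ρ : P → C(X, X)) : SingChain X →ₗ[ℚ] SingChain X :=
  (Fintype.card P : ℚ)⁻¹ • ∑ g, push (ρ g)

omit [Group P] in
lemma avg_apply (x : SingChain X) :
    avg ρ x = (Fintype.card P : ℚ)⁻¹ • ∑ g, push (ρ g) x := by
  simp [avg]

lemma card_ne_zero_rat : (Fintype.card P : ℚ) ≠ 0 := by
  exact_mod_cast Fintype.card_ne_zero

lemma avg_of_mem {x : SingChain X} (hx : x ∈ invChains ρ) : avg ρ x = x := by
  rw [mem_invChains] at hx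
  simp only [avg_apply, hx, Finset.sum_const, Finset.card_univ, ← Nat.cast_smul_eq_nsmul ℚ,
    smul_smul, inv_mul_cancel₀ (card_ne_zero_rat (P := P)), one_smul]

omit [Group P] in
lemma bdry_avg (x : SingChain X) : bdry (avg ρ x) = avg ρ (bdry x) := by
  simp only [avg_apply, map_smul, map_sum, bdry_push]

namespace IsOrbitMap

variable (h : IsOrbitMap π ρ)
include h

omit [Fintype P] in
lemma push_push (g : P) (x : SingChain X) : push π (push (ρ g) x) = push π x := by
  rw [GraphModuli.push_push]
  congr 1
  congr 1
  ext y
  exact h.map_act g y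

lemma avg_push_act (g : P) (x : SingChain X) : avg ρ (push (ρ g) x) = avg ρ x := by
  simp only [avg_apply, GraphModuli.push_push, ← h.mul]
  congr 1
  exact Fintype.sum_equiv (Equiv.mulRight g) _ _ fun _ => rfl

lemma avg_mem (x : SingChain X) : avg ρ x ∈ invChains ρ := by
  rw [mem_invChains]
  intro g
  simp only [avg_apply, map_smul, map_sum, GraphModuli.push_push, ← h.mul]
  congr 1
  exact Fintype.sum_equiv (Equiv.mulLeft g) _ _ fun _ => rfl

lemma push_avg (x : SingChain X) : push π (avg ρ x) = push π x := by
  simp only [avg_apply, map_smul, map_sum, h.push_push, Finset.sum_const, Finset.card_univ,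
    ← Nat.cast_smul_eq_nsmul ℚ, smul_smul, inv_mul_cancel₀ (card_ne_zero_rat (P := P)), one_smul]

lemma avg_mem_chainsIn {V : Set Y} {x : SingChain X} (hx : x ∈ chainsIn (π ⁻¹' V)) :
    avg ρ x ∈ chainsIn (π ⁻¹' V) := by
  rw [avg_apply]
  refine Submodule.smul_mem _ _ (Submodule.sum_mem _ fun g _ => push_mem ?_)
  have : ρ g ⁻¹' (π ⁻¹' V) = π ⁻¹' V := by
    ext y
    simp only [Set.mem_preimage, h.map_act]
  rwa [this]

end IsOrbitMap

/-- The pair `(x, y)` is a boundary in the mapping cone of the map from the invariant chains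
of the preimage of `V` to the chains of `V`. -/
def ConeBounds (π : C(X, Y)) (ρ : P → C(X, X)) (V : Set Y) (x : SingChain X) (y : SingChain Y) :
    Prop :=
  ∃ u ∈ chainsIn (π ⁻¹' V), u ∈ invChains ρ ∧ ∃ v ∈ chainsIn V,
    bdry u = x ∧ bdry v = y - push π u

/-- The mapping cone of the map from the invariant chains of the preimage of `V` to the chains
of `V` is acyclic. -/
def ConeAcyclic (π : C(X, Y)) (ρ : P → C(X, X)) (V : Set Y) : Prop :=
  ∀ x ∈ chainsIn (π ⁻¹' V), x ∈ invChains ρ → ∀ y ∈ chainsIn V, bdry x = 0 → bdry y = push π x →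
    ConeBounds π ρ V x y

omit [Group P] [Fintype P] in
lemma ConeBounds.add {V : Set Y} {x x' : SingChain X} {y y' : SingChain Y}
    (h : ConeBounds π ρ V x y) (h' : ConeBounds π ρ V x' y') :
    ConeBounds π ρ V (x + x') (y + y') := by
  obtain ⟨u, hu, hui, v, hv, h₁, h₂⟩ := h
  obtain ⟨u', hu', hui', v', hv', h₁', h₂'⟩ := h'
  refine ⟨u + u', add_mem hu hu', add_mem hui hui', v + v', add_mem hv hv', ?_, ?_⟩
  · rw [map_add, h₁, h₁']
  · rw [map_add, h₂, h₂', map_add]; abel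

omit [Group P] [Fintype P] in
lemma ConeBounds.mono {V W : Set Y} (hVW : V ⊆ W) {x : SingChain X} {y : SingChain Y}
    (h : ConeBounds π ρ V x y) : ConeBounds π ρ W x y := by
  obtain ⟨u, hu, hui, v, hv, h₁, h₂⟩ := h
  exact ⟨u, chainsIn_mono (Set.preimage_mono hVW) hu, hui, v, chainsIn_mono hVW hv, h₁, h₂⟩

omit [Group P] [Fintype P] in
lemma operator_mem_inv {θ : ∀ m, ListChain (stdSimplex ℝ (Fin (m + 1)))} {x : SingChain X}
    (hx : x ∈ invChains ρ) : operator θ x ∈ invChains ρ := by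
  rw [mem_invChains] at hx ⊢
  intro g
  rw [← operator_push, hx]

omit [Group P] [Fintype P] in
/-- Subdivision does not change classes in the mapping cone. -/
lemma ConeBounds.of_singSd {V : Set Y} {x : SingChain X} {y : SingChain Y}
    (hx : x ∈ chainsIn (π ⁻¹' V)) (hxi : x ∈ invChains ρ) (hy : y ∈ chainsIn V)
    (hdx : bdry x = 0) (hdy : bdry y = push π x)
    (h : ConeBounds π ρ V (singSd x) (singSd y)) : ConeBounds π ρ V x y := by
  -- The subdivision homotopies of `x` and `y` fill the difference; naturality makes the first
  -- invariant and compatible with `π`.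
  have h' : ConeBounds π ρ V (x - singSd x) (y - singSd y) := by
    refine ⟨singSdHomotopy x, operator_mem hx, operator_mem_inv hxi, singSdHomotopy y,
      operator_mem hy, ?_, ?_⟩
    · rw [bdry_singSdHomotopy, hdx, map_zero, sub_zero]
    · rw [bdry_singSdHomotopy, hdy, singSdHomotopy_push]
  simpa using h'.add h

omit [Group P] [Fintype P] in
lemma ConeBounds.of_iterate {V : Set Y} (k : ℕ) {x : SingChain X} {y : SingChain Y}
    (hx : x ∈ chainsIn (π ⁻¹' V)) (hxi : x ∈ invChains ρ) (hy : y ∈ chainsIn V)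
    (hdx : bdry x = 0) (hdy : bdry y = push π x)
    (h : ConeBounds π ρ V ((singSd ^ k) x) ((singSd ^ k) y)) : ConeBounds π ρ V x y := by
  induction k generalizing x y with
  | zero => simpa using h
  | succ k ih =>
    refine .of_singSd hx hxi hy hdx hdy (ih (operator_mem hx) (operator_mem_inv hxi)
      (operator_mem hy) ?_ ?_ ?_)
    · rw [bdry_singSd, hdx, map_zero]
    · rw [bdry_singSd, hdy, singSd_push]
    · rw [pow_succ] at h
      exact h

/-- Preimages under `π` are stable under the action, so averaging both parts of a splitting keeps
them in place and makes them invariant. Mayer–Vietoris for invariant chains needs the division by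
the group order here. -/
lemma IsOrbitMap.exists_split (h : IsOrbitMap π ρ) {A B : Set Y} {x : SingChain X}
    (hx : x ∈ chainsIn (π ⁻¹' A) ⊔ chainsIn (π ⁻¹' B)) (hxi : x ∈ invChains ρ) :
    ∃ a ∈ chainsIn (π ⁻¹' A), a ∈ invChains ρ ∧ ∃ b ∈ chainsIn (π ⁻¹' B), b ∈ invChains ρ ∧
      x = a + b := by
  obtain ⟨a, ha, b, hb, hab⟩ := Submodule.mem_sup.1 hx
  refine ⟨avg ρ a, h.avg_mem_chainsIn ha, h.avg_mem a, avg ρ b, h.avg_mem_chainsIn hb,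
    h.avg_mem b, ?_⟩
  rw [← map_add, hab, avg_of_mem hxi]

omit [Group P] [Fintype P] in
lemma bdry_mem_inv {x : SingChain X} (hx : x ∈ invChains ρ) : bdry x ∈ invChains ρ := by
  rw [mem_invChains] at hx ⊢
  intro g
  rw [← bdry_push, hx]

/-- Inherited from lists, since every simplex realizes its vertex list. -/
lemma bdry_bdry {Z : Type} [TopologicalSpace Z] (c : SingChain Z) : bdry (bdry c) = 0 := by
  refine LinearMap.congr_fun (f := bdry ∘ₗ bdry) (g := 0) ?_ c
  ext σ : 2
  simp only [LinearMap.comp_apply, Finsupp.lsingle_apply, ← listSimplex_vertexList σ.2]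
  rw [← realize_single, bdry_realize, bdry_realize, lbdry_lbdry, map_zero]
  rfl

lemma mem_chainsIn_inter {Z : Type} [TopologicalSpace Z] {A B : Set Z} {c : SingChain Z}
    (hA : c ∈ chainsIn A) (hB : c ∈ chainsIn B) : c ∈ chainsIn (A ∩ B) :=
  fun _ hσ => Set.subset_inter (hA hσ) (hB hσ)

/-- The Mayer–Vietoris principle. -/
lemma ConeAcyclic.union (h : IsOrbitMap π ρ) {A B : Set Y} (hA : IsOpen A) (hB : IsOpen B)
    (hcA : ConeAcyclic π ρ A) (hcB : ConeAcyclic π ρ B) (hcAB : ConeAcyclic π ρ (A ∩ B)) :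
    ConeAcyclic π ρ (A ∪ B) := by
  have small : ∀ x ∈ chainsIn (π ⁻¹' A) ⊔ chainsIn (π ⁻¹' B), x ∈ invChains ρ →
      ∀ y ∈ chainsIn A ⊔ chainsIn B, bdry x = 0 → bdry y = push π x →
      ConeBounds π ρ (A ∪ B) x y := by
    intro x hx hxi y hy hdx hdy
    obtain ⟨a, ha, hai, b, hb, hbi, rfl⟩ := h.exists_split hx hxi
    obtain ⟨a', ha', b', hb', rfl⟩ := Submodule.mem_sup.1 hy
    rw [map_add] at hdx
    rw [map_add, map_add] at hdy
    have e₁ : -bdry a = bdry b := neg_eq_of_add_eq_zero_right hdx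
    have e₂ : bdry a' - push π a = -(bdry b' - push π b) := by
      rw [neg_sub, sub_eq_sub_iff_add_eq_add, hdy, add_comm]
    -- The defect `(-∂a, ∂a' - π a)` of `(a, a')` from being a cone cycle is minus that of `(b,
    -- b')`, so it lives over `A ∩ B`, and it is itself a cone cycle. With a filling `(u, v)`, both
    -- `(a + u, a' - v)` and `(b - u, b' + v)` become cone cycles.
    obtain ⟨u, hu, hui, v, hv, hdu, hdv⟩ := hcAB (-bdry a)
      (mem_chainsIn_inter (neg_mem (bdry_mem ha)) (e₁ ▸ bdry_mem hb))
      (neg_mem (bdry_mem_inv hai)) (bdry a' - push π a)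
      (mem_chainsIn_inter (sub_mem (bdry_mem ha') (push_mem ha))
        (e₂ ▸ neg_mem (sub_mem (bdry_mem hb') (push_mem hb))))
      (by rw [map_neg, bdry_bdry, neg_zero])
      (by rw [map_sub, bdry_bdry, bdry_push, map_neg, zero_sub])
    have huA := chainsIn_mono (Set.preimage_mono (f := π) (Set.inter_subset_left (s := A))) hu
    have huB := chainsIn_mono (Set.preimage_mono (f := π) (Set.inter_subset_right (s := A))) hu
    have hvA := chainsIn_mono (Set.inter_subset_left (s := A)) hv
    have hvB := chainsIn_mono (Set.inter_subset_right (s := A)) hv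
    have r₁ := hcA (a + u) (add_mem ha huA) (add_mem hai hui) (a' - v) (sub_mem ha' hvA)
      (by rw [map_add, hdu, add_neg_cancel]) (by rw [map_sub, hdv, map_add]; abel)
    have r₂ := hcB (b - u) (sub_mem hb huB) (sub_mem hbi hui) (b' + v) (add_mem hb' hvB)
      (by rw [map_sub, hdu, e₁, sub_self]) (by rw [map_add, hdv, e₂, map_sub]; abel)
    have r := (r₁.mono Set.subset_union_left).add (r₂.mono (Set.subset_union_right (s := A)))
    rwa [add_add_sub_cancel, sub_add_add_cancel] at r
  intro x hx hxi y hy hdx hdy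
  obtain ⟨k₁, h₁⟩ := exists_iterate_singSd_mem (hA.preimage π.continuous)
    (hB.preimage π.continuous) hx
  obtain ⟨k₂, h₂⟩ := exists_iterate_singSd_mem hA hB hy
  have hinv : ∀ k, (singSd ^ k) x ∈ invChains ρ ∧ bdry ((singSd ^ k) x) = 0 ∧
      bdry ((singSd ^ k) y) = push π ((singSd ^ k) x) := by
    intro k
    induction k with
    | zero => exact ⟨hxi, hdx, hdy⟩
    | succ k ih =>
      simp only [pow_succ', Module.End.mul_apply]
      refine ⟨operator_mem_inv ih.1, ?_, ?_⟩
      · rw [bdry_singSd, ih.2.1, map_zero]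
      · rw [bdry_singSd, ih.2.2, singSd_push]
  -- Both components must be subdivided equally often to remain a cone cycle.
  obtain ⟨i₁, i₂, i₃⟩ := hinv (k₂ + k₁)
  refine .of_iterate (k₂ + k₁) hx hxi hy hdx hdy (small _ ?_ i₁ _ ?_ i₂ i₃)
  · rw [pow_add]; exact iterate_singSd_mem_sup _ h₁
  · rw [add_comm, pow_add]; exact iterate_singSd_mem_sup _ h₂

omit [Group P] [Fintype P] in
lemma ConeAcyclic.empty : ConeAcyclic π ρ (∅ : Set Y) := by
  have key : ∀ {Z : Type} [TopologicalSpace Z] (c : SingChain Z), c ∈ chainsIn (∅ : Set Z) →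
      c = 0 := by
    intro Z _ c hc
    refine Finsupp.support_eq_empty.1 (Finset.eq_empty_of_forall_notMem fun σ hσ => ?_)
    exact hc hσ ⟨stdSimplex.barycenter, rfl⟩
  intro x hx _ y hy _ _
  refine ⟨0, zero_mem _, zero_mem _, 0, zero_mem _, ?_, ?_⟩
  · rw [key x hx, map_zero]
  · rw [key y hy, map_zero, map_zero, sub_zero]

/-- Acyclicity of the mapping cone can be checked on the intersections of a finite open cover. -/
lemma ConeAcyclic.biUnion (h : IsOrbitMap π ρ) {ι : Type} {V : ι → Set Y}
    (hV : ∀ i, IsOpen (V i))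
    (hc : ∀ S : Finset ι, S.Nonempty → ConeAcyclic π ρ (⋂ i ∈ S, V i)) (T : Finset ι) :
    ConeAcyclic π ρ (⋃ i ∈ T, V i) := by
  classical
  -- The extra intersection over `S` makes the overlap in Mayer–Vietoris an instance of the
  -- induction hypothesis, with `j` moved into `S`.
  suffices H : ∀ S : Finset ι, ConeAcyclic π ρ ((⋂ i ∈ S, V i) ∩ ⋃ i ∈ T, V i) by
    simpa using H ∅
  induction T using Finset.induction_on with
  | empty => intro S; simpa using ConeAcyclic.empty
  | insert j T _ ih =>
    intro S
    have hSo : ∀ S : Finset ι, IsOpen (⋂ i ∈ S, V i) := fun S =>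
      isOpen_biInter_finset fun i _ => hV i
    have e₁ : (⋂ i ∈ S, V i) ∩ V j = ⋂ i ∈ insert j S, V i := by
      rw [Finset.set_biInter_insert, Set.inter_comm]
    rw [Finset.set_biUnion_insert, Set.inter_union_distrib_left, e₁]
    refine .union h (hSo _) ((hSo S).inter (isOpen_biUnion fun i _ => hV i))
      (hc _ (Finset.insert_nonempty _ _)) (ih S) ?_
    rw [← Set.inter_assoc]
    convert ih (insert j S) using 2
    rw [← e₁]
    exact Set.inter_eq_left.2 Set.inter_subset_left

/-! #### Contractible pieces -/

/-- The preimage of `V` and `V` can be deformed compatibly into discrete sets. -/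
def HasContraction (π : C(X, Y)) (ρ : P → C(X, X)) (V : Set Y) : Prop :=
  ∃ (H' : C((π ⁻¹' V) × unitInterval, X)) (H : C(V × unitInterval, Y)),
    (∀ x t, π (H' (x, t)) = H (⟨π x.1, x.2⟩, t)) ∧
    (∀ y t, H (y, t) ∈ V) ∧
    (∀ g x x' t, ρ g x.1 = x'.1 → ρ g (H' (x, t)) = H' (x', t)) ∧
    (∀ x, H' (x, 0) = x.1) ∧ (∀ y, H (y, 0) = y.1) ∧
    IsLocallyConstant (fun x => H' (x, 1)) ∧ IsLocallyConstant (fun y => H (y, 1))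

/-- The inclusion of a subset. -/
def incl {Z : Type} [TopologicalSpace Z] (V : Set Z) : C(V, Z) := ⟨Subtype.val, by fun_prop⟩

lemma push_incl_injective {Z : Type} [TopologicalSpace Z] (V : Set Z) :
    Function.Injective (push (incl V)) := by
  refine Finsupp.mapDomain_injective ?_
  rintro ⟨m, σ⟩ ⟨m', σ'⟩ h
  obtain ⟨rfl, h⟩ := Sigma.mk.inj_iff.1 h
  congr 1
  ext t
  exact congrArg (· t) (eq_of_heq h)

lemma exists_push_incl {Z : Type} [TopologicalSpace Z] {V : Set Z} {c : SingChain Z}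
    (hc : c ∈ chainsIn V) : ∃ c₀, push (incl V) c₀ = c := by
  refine LinearMap.mem_range.1 (map_mem_of_single (M := LinearMap.range (push (incl V)))
    LinearMap.id (fun σ hσ => ?_) hc)
  refine ⟨Finsupp.single ⟨σ.1, ⟨fun t => ⟨σ.2 t, hσ ⟨t, rfl⟩⟩, by fun_prop⟩⟩ 1, ?_⟩
  rw [push_single]
  rfl

/-- The chains that consist of constant simplices. -/
def constChains (Z : Type) [TopologicalSpace Z] : Submodule ℚ (SingChain Z) :=
  Submodule.span ℚ {c | ∃ (m : ℕ) (z : Z), c = Finsupp.single ⟨m, .const _ z⟩ 1}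

/-- Standard simplices are connected. -/
lemma push_mem_constChains {Z : Type} [TopologicalSpace Z] {f : C(Z, X)}
    (hf : IsLocallyConstant f) (c : SingChain Z) : push f c ∈ constChains X := by
  refine map_mem_of_single (V := Set.univ) (push f) (fun σ _ => ?_) fun _ _ => Set.subset_univ _
  refine Submodule.subset_span ⟨σ.1, f (σ.2 stdSimplex.barycenter), ?_⟩
  rw [push_single]
  congr 1
  refine Sigma.ext rfl (heq_of_eq ?_)
  ext t
  exact (hf.comp_continuous σ.2.continuous).apply_eq_of_isPreconnected isPreconnected_univ
    trivial trivial

/-- The map on constant simplices given by an arbitrary map of sets. -/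
def pushConst (s : Y → X) : SingChain Y →ₗ[ℚ] SingChain X :=
  Finsupp.linearCombination ℚ fun σ =>
    Finsupp.single ⟨σ.1, .const _ (s (σ.2 stdSimplex.barycenter))⟩ 1

@[simp]
lemma pushConst_single (s : Y → X) (σ : SingSimplex Y) : pushConst s (Finsupp.single σ 1) =
    Finsupp.single ⟨σ.1, .const _ (s (σ.2 stdSimplex.barycenter))⟩ 1 := by
  simp [pushConst]

/-- No continuity of `s` is needed on constant simplices; it will be a section of `π` obtained by
choice. -/
lemma bdry_pushConst (s : Y → X) {c : SingChain Y} (hc : c ∈ constChains Y) :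
    bdry (pushConst s c) = pushConst s (bdry c) := by
  refine LinearMap.eqOn_span (f := bdry ∘ₗ pushConst s) (g := pushConst s ∘ₗ bdry) ?_ hc
  rintro _ ⟨m, z, rfl⟩
  obtain _ | m := m
  · simp [simplexBdry]
  · simp only [LinearMap.comp_apply, pushConst_single, bdry_single, simplexBdry, map_sum, map_smul]
    rfl

/-- The prisms of the two homotopies replace a cone cycle by one made of constant simplices. These
see only the underlying sets, where lifting by a section and averaging gives a filling. -/
lemma HasContraction.coneAcyclic (h : IsOrbitMap π ρ) {V : Set Y} (hV : HasContraction π ρ V) :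
    ConeAcyclic π ρ V := by
  obtain ⟨H', H, hπ, hHV, hg, h0', h0, h1', h1⟩ := hV
  intro x hx hxi y hy hdx hdy
  rw [mem_invChains] at hxi
  obtain ⟨x, rfl⟩ := exists_push_incl hx
  obtain ⟨y, rfl⟩ := exists_push_incl hy
  have hHV' : ∀ x t, H' (x, t) ∈ π ⁻¹' V := fun x t => by
    rw [Set.mem_preimage, hπ]; exact hHV _ _
  let πV : C(π ⁻¹' V, V) := ⟨fun x => ⟨π x.1, x.2⟩, by fun_prop⟩
  let ρV : P → C(π ⁻¹' V, π ⁻¹' V) := fun g =>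
    ⟨fun x => ⟨ρ g x.1, by rw [Set.mem_preimage, h.map_act]; exact x.2⟩, by fun_prop⟩
  have hdx₀ : bdry x = 0 := push_incl_injective _ (by rw [← bdry_push, hdx, map_zero])
  have hdy₀ : bdry y = push πV x := push_incl_injective _ (by
    rw [← bdry_push, hdy, push_push, push_push]; rfl)
  have hxi₀ : ∀ g, push (ρV g) x = x := fun g => push_incl_injective _ (by
    rw [push_push]
    refine Eq.trans ?_ (hxi g)
    rw [push_push]; rfl)
  have hπH : π.comp H' = H.comp (πV.prodMap (.id _)) := by
    ext ⟨x, t⟩; exact hπ x t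
  have hgH : ∀ g, (ρ g).comp H' = H'.comp ((ρV g).prodMap (.id _)) := fun g => by
    ext ⟨x, t⟩; exact hg g x _ t rfl
  have ht0' : atTime H' 0 = incl _ := by ext x; exact h0' x
  have ht0 : atTime H 0 = incl _ := by ext x; exact h0 x
  have hprism : push π (prism H' x) = prism H (bdry y) := by
    rw [push_prism, hπH, ← prism_push, hdy₀]
  have mem' : prism H' x ∈ chainsIn (π ⁻¹' V) :=
    map_mem_of_single (V := Set.univ) (prism H') (fun σ _ => by
      rw [prism_single]
      exact realize_mem fun l _ => listSimplex_mem (fun p => hHV' (σ.2 p.1) p.2) l)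
      fun _ _ => Set.subset_univ _
  have mem : prism H y ∈ chainsIn V :=
    map_mem_of_single (V := Set.univ) (prism H) (fun σ _ => by
      rw [prism_single]
      exact realize_mem fun l _ => listSimplex_mem (fun p => hHV (σ.2 p.1) p.2) l)
      fun _ _ => Set.subset_univ _
  -- The filling is the pair of negative prisms: invariant because `H'` is equivariant, and
  -- compatible because `π ∘ H' = H ∘ π`.
  have r₁ : ConeBounds π ρ V (push (incl _) x - push (atTime H' 1) x)
      (push (incl _) y - push (atTime H 1) y) := by
    refine ⟨-prism H' x, neg_mem mem', neg_mem (mem_invChains.2 fun g => ?_), -prism H y,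
      neg_mem mem, ?_, ?_⟩
    · rw [push_prism, hgH, ← prism_push, hxi₀]
    · rw [map_neg, bdry_prism, hdx₀, ht0', map_zero]; abel
    · rw [map_neg, bdry_prism, ht0, map_neg, hprism]; abel
  set x' := push (atTime H' 1) x with hx'
  set y' := push (atTime H 1) y with hy'
  have hx'c : x' ∈ constChains X := push_mem_constChains h1' x
  have hy'c : y' ∈ constChains Y := push_mem_constChains h1 y
  have hy'V : y' ∈ chainsIn V := map_mem_of_single (V := Set.univ) (push (atTime H 1))
    (fun σ _ => by
      rw [push_single]
      refine single_mem_chainsIn ?_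
      rintro _ ⟨t, rfl⟩
      exact hHV _ _) fun _ _ => Set.subset_univ _
  have hdy' : bdry y' = push π x' := by
    rw [hy', bdry_push, hdy₀, hx', push_push, push_push]
    congr 2
    ext z
    exact (hπ z 1).symm
  have hx'i : x' ∈ invChains ρ := mem_invChains.2 fun g => by
    conv_rhs => rw [hx', ← hxi₀ g, push_push]
    rw [hx', push_push]
    congr 2
    ext z
    exact hg g z _ 1 rfl
  let s : Y → X := Function.surjInv h.surjective
  have hs : ∀ y, π (s y) = y := Function.surjInv_eq h.surjective
  -- The points `z` and `s (π z)` lie in one orbit, so the averages of the constant simplices at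
  -- them coincide.
  have hEπ : avg ρ (pushConst s (push π x')) = avg ρ x' := by
    refine LinearMap.eqOn_span (f := avg ρ ∘ₗ pushConst s ∘ₗ push π) (g := avg ρ) ?_ hx'c
    rintro _ ⟨m, z, rfl⟩
    obtain ⟨g, hg⟩ := h.transitive z (s (π z)) (hs _).symm
    rw [← h.avg_push_act g (Finsupp.single _ _)]
    simp only [LinearMap.comp_apply, push_single, pushConst_single]
    congr 2
    refine Sigma.ext rfl (heq_of_eq ?_)
    ext t
    exact hg.symm
  have hπE : push π (pushConst s y') = y' := by
    refine LinearMap.eqOn_span (f := push π ∘ₗ pushConst s) (g := LinearMap.id) ?_ hy'c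
    rintro _ ⟨m, z, rfl⟩
    simp only [LinearMap.comp_apply, push_single, pushConst_single, LinearMap.id_apply]
    congr 1
    refine Sigma.ext rfl (heq_of_eq ?_)
    ext t
    exact hs z
  -- The averaged lift `u` of `y'` satisfies `∂ u = x'` and `π u = y'` exactly, so the second
  -- component of the filling is zero.
  have r₂ : ConeBounds π ρ V x' y' := by
    refine ⟨avg ρ (pushConst s y'), h.avg_mem_chainsIn ?_, h.avg_mem _, 0, zero_mem _, ?_, ?_⟩
    · refine map_mem_of_single (pushConst s) (fun σ hσ => ?_) hy'V
      rw [pushConst_single]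
      refine single_mem_chainsIn ?_
      rintro _ ⟨t, rfl⟩
      change π (s _) ∈ V
      rw [hs]
      exact hσ ⟨_, rfl⟩
    · rw [bdry_avg, bdry_pushConst s hy'c, hdy', hEπ, avg_of_mem hx'i]
    · rw [h.push_avg, hπE, sub_self, map_zero]
  simpa using r₁.add r₂

/-- A quotient by a finite group has an acyclic mapping cone if it has a finite open cover whose
intersections can be deformed equivariantly into discrete sets. -/
theorem IsOrbitMap.coneAcyclic (h : IsOrbitMap π ρ) {ι : Type} [Fintype ι] {V : ι → Set Y}
    (hV : ∀ i, IsOpen (V i)) (hcov : ⋃ i, V i = Set.univ)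
    (hc : ∀ S : Finset ι, S.Nonempty → HasContraction π ρ (⋂ i ∈ S, V i)) :
    ConeAcyclic π ρ Set.univ := by
  have := ConeAcyclic.biUnion h hV (fun S hS => (hc S hS).coneAcyclic h) Finset.univ
  simpa [hcov] using this

end Quotient

end

/-! ### Comparison with the singular chain complex, and the transfer on homology. -/

noncomputable section

/-! ### Comparison with the singular chain complex -/

section Comparison

variable {X Y : Type} [TopologicalSpace X] [TopologicalSpace Y]

/-- The continuous maps from the standard simplex as simplices of the singular simplicial set. -/
def simplexEquiv (X : Type) [TopologicalSpace X] (k : ℕ) :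
    (TopCat.toSSet.obj (TopCat.of X)).obj (.op (SimplexCategory.mk k)) ≃
      C(stdSimplex ℝ (Fin (k + 1)), X) :=
  TopCat.toSSetObjEquiv (TopCat.of X) (.op (SimplexCategory.mk k))

lemma simplexEquiv_map {k : ℕ} (f : C(X, Y))
    (x : (TopCat.toSSet.obj (TopCat.of X)).obj (.op (SimplexCategory.mk k))) :
    simplexEquiv Y k ((TopCat.toSSet.map (TopCat.ofHom f)).app _ x) =
      f.comp (simplexEquiv X k x) := rfl

lemma simplexEquiv_δ {k : ℕ} (i : Fin (k + 2))
    (x : (TopCat.toSSet.obj (TopCat.of X)).obj (.op (SimplexCategory.mk (k + 1)))) :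
    simplexEquiv X k ((TopCat.toSSet.obj (TopCat.of X)).δ i x) =
      (simplexEquiv X (k + 1) x).comp (faceMap i) := rfl

/-- The chain given by a singular simplex. -/
def generator {k : ℕ} (σ : C(stdSimplex ℝ (Fin (k + 1)), X)) : (chains X).X k :=
  (SSet.ιChainComplex (R := ModuleCat.of ℚ ℚ) (TopCat.toSSet.obj (TopCat.of X))
    ((simplexEquiv X k).symm σ)).hom (1 : ℚ)

lemma chains_hom_ext {k : ℕ} {M : Type} [AddCommGroup M] [Module ℚ M]
    {f g : (chains X).X k →ₗ[ℚ] M} (h : ∀ σ, f (generator σ) = g (generator σ)) : f = g := by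
  have : ModuleCat.ofHom f = ModuleCat.ofHom g := by
    refine SSet.chainComplex_hom_ext fun x => ?_
    ext
    have := h (simplexEquiv X k x)
    simp only [generator, Equiv.symm_apply_apply] at this
    exact this
  exact congrArg ModuleCat.Hom.hom this

lemma d_generator {k : ℕ} (σ : C(stdSimplex ℝ (Fin (k + 2)), X)) :
    ((chains X).d (k + 1) k).hom (generator σ) =
      ∑ i : Fin (k + 2), (-1 : ℚ) ^ (i : ℕ) • generator (σ.comp (faceMap i)) := by
  have h := congrArg (fun f => f.hom (1 : ℚ)) (SSet.ιChainComplex_d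
    (X := TopCat.toSSet.obj (TopCat.of X)) (R := ModuleCat.of ℚ ℚ)
    ((simplexEquiv X (k + 1)).symm σ))
  refine h.trans ?_
  simp only [ModuleCat.hom_sum, LinearMap.sum_apply]
  refine Finset.sum_congr rfl fun i _ => ?_
  have e : (TopCat.toSSet.obj (TopCat.of X)).δ i ((simplexEquiv X (k + 1)).symm σ) =
      (simplexEquiv X k).symm (σ.comp (faceMap i)) := by
    rw [Equiv.eq_symm_apply, simplexEquiv_δ, Equiv.apply_symm_apply]
  rw [e]
  -- The signs are integers on one side and rationals on the other; the two mixed cases are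
  -- contradictory.
  obtain hi | hi := neg_one_pow_eq_or ℤ (i : ℕ) <;> obtain hi' | hi' := neg_one_pow_eq_or ℚ (i : ℕ)
  · rw [hi, hi', one_smul, one_smul]; rfl
  · have := congrArg (Int.cast : ℤ → ℚ) hi
    push_cast at this
    rw [this] at hi'; norm_num at hi'
  · have := congrArg (Int.cast : ℤ → ℚ) hi
    push_cast at this
    rw [this] at hi'; norm_num at hi'
  · rw [hi, hi', neg_smul, neg_smul, one_smul, one_smul]; rfl

lemma chainPush_generator {k : ℕ} (f : C(X, Y)) (σ : C(stdSimplex ℝ (Fin (k + 1)), X)) :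
    chainPush k f (generator σ) = generator (f.comp σ) := by
  have h := congrArg (fun f => f.hom (1 : ℚ)) (SSet.ι_chainComplexMap_f _ _
    (TopCat.toSSet.map (TopCat.ofHom f)) (ModuleCat.of ℚ ℚ) ((simplexEquiv X k).symm σ))
  refine h.trans ?_
  have e : (TopCat.toSSet.map (TopCat.ofHom f)).app _ ((simplexEquiv X k).symm σ) =
      (simplexEquiv Y k).symm (f.comp σ) := by
    rw [Equiv.eq_symm_apply, simplexEquiv_map, Equiv.apply_symm_apply]
  simp only [generator, ← e]

/-- The inclusion of the `k`-chains into the chains of all dimensions. -/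
def toSing (k : ℕ) : (chains X).X k →ₗ[ℚ] SingChain X :=
  ((SSet.isColimitChainComplexXCofan (TopCat.toSSet.obj (TopCat.of X))
    (ModuleCat.of ℚ ℚ) k).desc (Limits.Cofan.mk (ModuleCat.of ℚ (SingChain X)) fun x =>
      ModuleCat.ofHom (LinearMap.toSpanSingleton ℚ (SingChain X)
        (Finsupp.single ⟨k, simplexEquiv X k x⟩ 1)))).hom

@[simp]
lemma toSing_generator {k : ℕ} (σ : C(stdSimplex ℝ (Fin (k + 1)), X)) :
    toSing k (generator σ) = Finsupp.single ⟨k, σ⟩ 1 := by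
  have h := congrArg (fun f => f.hom (1 : ℚ))
    ((SSet.isColimitChainComplexXCofan (TopCat.toSSet.obj (TopCat.of X))
    (ModuleCat.of ℚ ℚ) k).fac (Limits.Cofan.mk (ModuleCat.of ℚ (SingChain X)) fun x =>
      ModuleCat.ofHom (LinearMap.toSpanSingleton ℚ (SingChain X)
        (Finsupp.single ⟨k, simplexEquiv X k x⟩ 1))) ⟨(simplexEquiv X k).symm σ⟩)
  refine h.trans ?_
  simp [Limits.Cofan.mk]

/-- The projection of the chains of all dimensions to the `k`-chains. -/
def ofSing (k : ℕ) : SingChain X →ₗ[ℚ] (chains X).X k :=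
  Finsupp.linearCombination ℚ fun σ =>
    if h : σ.1 = k then generator (h ▸ σ.2 : C(stdSimplex ℝ (Fin (k + 1)), X)) else 0

@[simp]
lemma ofSing_single {k : ℕ} (σ : C(stdSimplex ℝ (Fin (k + 1)), X)) :
    ofSing k (Finsupp.single ⟨k, σ⟩ 1) = generator σ := by
  simp [ofSing]

lemma ofSing_single_of_ne {k : ℕ} {σ : SingSimplex X} (h : σ.1 ≠ k) :
    ofSing k (Finsupp.single σ 1) = 0 := by
  simp [ofSing, h]

lemma ofSing_toSing {k : ℕ} (c : (chains X).X k) : ofSing k (toSing k c) = c := by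
  refine LinearMap.congr_fun (f := ofSing k ∘ₗ toSing k) (g := LinearMap.id) ?_ c
  exact chains_hom_ext fun σ => by simp

lemma bdry_toSing {k : ℕ} (c : (chains X).X (k + 1)) :
    bdry (toSing (k + 1) c) = toSing k (((chains X).d (k + 1) k).hom c) := by
  refine LinearMap.congr_fun (f := bdry ∘ₗ toSing (k + 1))
    (g := toSing k ∘ₗ ((chains X).d (k + 1) k).hom) ?_ c
  exact chains_hom_ext fun σ => by simp [d_generator, simplexBdry]

lemma bdry_toSing_zero (c : (chains X).X 0) : bdry (toSing 0 c) = 0 := by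
  refine LinearMap.congr_fun (f := bdry ∘ₗ toSing 0) (g := 0) ?_ c
  exact chains_hom_ext fun σ => by simp [simplexBdry]

lemma push_toSing {k : ℕ} (f : C(X, Y)) (c : (chains X).X k) :
    push f (toSing k c) = toSing k (chainPush k f c) := by
  refine LinearMap.congr_fun (f := push f ∘ₗ toSing k) (g := toSing k ∘ₗ chainPush k f) ?_ c
  exact chains_hom_ext fun σ => by simp [chainPush_generator, SingSimplex.push]

lemma ofSing_push {k : ℕ} (f : C(X, Y)) (c : SingChain X) :
    ofSing k (push f c) = chainPush k f (ofSing k c) := by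
  refine LinearMap.congr_fun (f := ofSing k ∘ₗ push f) (g := chainPush k f ∘ₗ ofSing k) ?_ c
  ext σ : 2
  obtain ⟨m, σ⟩ := σ
  simp only [LinearMap.comp_apply, Finsupp.lsingle_apply, push_single]
  obtain rfl | h := eq_or_ne m k
  · simp [chainPush_generator, SingSimplex.push]
  · rw [ofSing_single_of_ne h, ofSing_single_of_ne (by exact h), map_zero]

lemma ofSing_bdry {k : ℕ} (c : SingChain X) :
    ofSing k (bdry c) = ((chains X).d (k + 1) k).hom (ofSing (k + 1) c) := by
  refine LinearMap.congr_fun (f := ofSing k ∘ₗ bdry)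
    (g := ((chains X).d (k + 1) k).hom ∘ₗ ofSing (k + 1)) ?_ c
  ext σ : 2
  obtain ⟨m, σ⟩ := σ
  simp only [LinearMap.comp_apply, Finsupp.lsingle_apply, bdry_single]
  obtain rfl | h := eq_or_ne m (k + 1)
  · simp only [simplexBdry, map_sum, map_smul, ofSing_single, d_generator]
  · rw [ofSing_single_of_ne h, map_zero]
    obtain _ | m := m
    · simp [simplexBdry]
    · simp only [simplexBdry, map_sum, map_smul]
      refine Finset.sum_eq_zero fun i _ => ?_
      rw [ofSing_single_of_ne (by simpa using h), smul_zero]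

/-! #### Cycles and homology classes -/

lemma exists_cycleClass {k : ℕ} (a : Hlgy k X) : ∃ z, cycleClass z = a :=
  (ModuleCat.epi_iff_surjective ((chains X).homologyπ k)).1 inferInstance a

lemma cycleChain_injective {k : ℕ} : Function.Injective (cycleChain (k := k) (X := X)) :=
  (ModuleCat.mono_iff_injective ((chains X).iCycles k)).1 inferInstance

lemma map_cycleClass {k : ℕ} (f : C(X, Y)) (z : (chains X).cycles k) :
    ∃ z' : (chains Y).cycles k, cycleChain z' = chainPush k f (cycleChain z) ∧
      Hlgy.map k f (cycleClass z) = cycleClass z' := by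
  refine ⟨(HomologicalComplex.cyclesMap (chainsMap f) k).hom z, ?_, ?_⟩
  · exact congrArg (fun h => h.hom z) (HomologicalComplex.cyclesMap_i (chainsMap f) k)
  · exact congrArg (fun h => h.hom z) (HomologicalComplex.homologyπ_naturality (chainsMap f) k)

lemma bdry_toSing_cycleChain {k : ℕ} (z : (chains X).cycles k) :
    bdry (toSing k (cycleChain z)) = 0 := by
  obtain _ | k := k
  · exact bdry_toSing_zero _
  · rw [bdry_toSing]
    have : ((chains X).d (k + 1) k).hom (cycleChain z) = 0 :=
      congrArg (fun h => h.hom z) ((chains X).iCycles_d (k + 1) k)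
    rw [this, map_zero]

lemma exists_cycleChain_ofSing {k : ℕ} {c : SingChain X} (hc : bdry c = 0) :
    ∃ z : (chains X).cycles k, cycleChain z = ofSing k c := by
  have h : ((chains X).d k ((ComplexShape.down ℕ).next k)).hom (ofSing k c) = 0 := by
    obtain _ | k := k
    -- Degree zero has no successor in `ComplexShape.down ℕ`, so the differential is zero by
    -- `shape`.
    · rw [(chains X).shape _ _ (by simp)]; rfl
    · rw [ChainComplex.next_nat_succ, ← ofSing_bdry, hc, map_zero]
  -- The chain is encoded as a morphism from `ℚ`, to which `liftCycles` applies.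
  let f : ModuleCat.of ℚ ℚ ⟶ (chains X).X k :=
    ModuleCat.ofHom (LinearMap.toSpanSingleton ℚ _ (ofSing k c))
  have hf : f ≫ (chains X).d k ((ComplexShape.down ℕ).next k) = 0 := by
    ext
    change ((chains X).d k _).hom ((1 : ℚ) • ofSing k c) = 0
    rw [one_smul, h]
  refine ⟨((chains X).liftCycles f _ rfl hf).hom (1 : ℚ), ?_⟩
  refine (congrArg (fun h => h.hom (1 : ℚ)) ((chains X).liftCycles_i f _ rfl hf)).trans ?_
  exact one_smul _ _

lemma cycleClass_eq_of_bdry {k : ℕ} {z z' : (chains X).cycles k} {v : (chains X).X (k + 1)}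
    (h : ((chains X).d (k + 1) k).hom v = cycleChain z - cycleChain z') :
    cycleClass z = cycleClass z' := by
  have e : ((chains X).toCycles (k + 1) k).hom v = z - z' := by
    apply cycleChain_injective
    refine (congrArg (fun h => h.hom v) ((chains X).toCycles_i (k + 1) k)).trans (h.trans ?_)
    exact (map_sub ((chains X).iCycles k).hom z z').symm
  have h₂ : ((chains X).homologyπ k).hom (((chains X).toCycles (k + 1) k).hom v) = 0 :=
    congrArg (fun h => h.hom v) ((chains X).toCycles_comp_homologyπ (k + 1) k)
  rw [e, map_sub, sub_eq_zero] at h₂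
  exact h₂

lemma exists_bdry_of_cycleClass_eq_zero {k : ℕ} {z : (chains X).cycles k}
    (h : cycleClass z = 0) :
    ∃ v : (chains X).X (k + 1), ((chains X).d (k + 1) k).hom v = cycleChain z := by
  have hexact := (ShortComplex.moduleCat_exact_iff _).1
    (ShortComplex.exact_of_g_is_cokernel
      (ShortComplex.mk _ _ ((chains X).toCycles_comp_homologyπ (k + 1) k)) ((chains X).homologyIsCokernel (k + 1) k (by simp)))
  obtain ⟨v, hv⟩ := hexact z h
  refine ⟨v, ?_⟩
  rw [← hv]
  exact (congrArg (fun h => h.hom v) ((chains X).toCycles_i (k + 1) k)).symm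

end Comparison

/-! ### Transfer -/

section Transfer

variable {X Y P : Type} [TopologicalSpace X] [TopologicalSpace Y] [Group P] [Fintype P]
  {π : C(X, Y)} {ρ : P → C(X, X)}

-- For a cycle `z` in `Y` the pair `(0, z)` is a cone cycle. A filling `(u, v)` consists of a cycle
-- `u` and a chain `v` with boundary `z - π u`.
omit [Group P] [Fintype P] in
lemma surjective_map_of_coneAcyclic (hc : ConeAcyclic π ρ Set.univ) (k : ℕ) :
    Function.Surjective (Hlgy.map k π) := by
  intro a
  obtain ⟨z, rfl⟩ := exists_cycleClass a
  obtain ⟨u, -, -, v, -, hu, hv⟩ := hc 0 (zero_mem _) (zero_mem _) (toSing k (cycleChain z))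
    (fun _ _ => Set.subset_univ _) (map_zero _) (by rw [bdry_toSing_cycleChain, map_zero])
  obtain ⟨w, hw⟩ := exists_cycleChain_ofSing (k := k) hu
  obtain ⟨w', hw', hww'⟩ := map_cycleClass π w
  refine ⟨cycleClass w, hww'.trans (cycleClass_eq_of_bdry (v := ofSing (k + 1) v) ?_).symm⟩
  rw [← ofSing_bdry, hv, map_sub, ofSing_toSing, ofSing_push, hw', hw]

/-- If `∂ y = π z`, then `(avg z, y)` is a cone cycle, as `z` and its average have the same image; a
filling bounds the average. -/
lemma IsOrbitMap.sum_map_eq_zero (h : IsOrbitMap π ρ) (hc : ConeAcyclic π ρ Set.univ) {k : ℕ}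
    {a : Hlgy k X} (ha : Hlgy.map k π a = 0) : ∑ g, Hlgy.map k (ρ g) a = 0 := by
  obtain ⟨z, rfl⟩ := exists_cycleClass a
  obtain ⟨z', hz', e⟩ := map_cycleClass π z
  obtain ⟨y, hy⟩ := exists_bdry_of_cycleClass_eq_zero (e.symm.trans ha)
  obtain ⟨u, -, -, -, -, hu, -⟩ := hc (avg ρ (toSing k (cycleChain z)))
    (fun _ _ => Set.subset_univ _) (h.avg_mem _) (toSing (k + 1) y)
    (fun _ _ => Set.subset_univ _) (by rw [bdry_avg, bdry_toSing_cycleChain, map_zero])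
    (by rw [bdry_toSing, hy, hz', h.push_avg, push_toSing])
  choose w hw hww using fun g => map_cycleClass (ρ g) z
  have hs : ∑ g, Hlgy.map k (ρ g) (cycleClass z) = cycleClass (∑ g, w g) := by
    simp only [hww]
    exact (map_sum ((chains X).homologyπ k).hom _ _).symm
  rw [hs]
  have h0 : cycleClass (0 : (chains X).cycles k) = 0 := map_zero ((chains X).homologyπ k).hom
  rw [← h0]
  refine cycleClass_eq_of_bdry (v := (Fintype.card P : ℚ) • ofSing (k + 1) u) ?_
  have e₀ : cycleChain (0 : (chains X).cycles k) = 0 := map_zero ((chains X).iCycles k).hom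
  have e₁ : cycleChain (∑ g, w g) = ∑ g, chainPush k (ρ g) (cycleChain z) := by
    simp only [← hw]
    exact map_sum ((chains X).iCycles k).hom _ _
  rw [map_smul, ← ofSing_bdry, hu, avg_apply, map_smul, smul_smul,
    mul_inv_cancel₀ (card_ne_zero_rat (P := P)), one_smul, map_sum, e₀, e₁, sub_zero]
  simp only [push_toSing, ofSing_toSing]

/-- The transfer of a quotient by a finite group. -/
theorem IsOrbitMap.exists_transfer (h : IsOrbitMap π ρ) (hc : ConeAcyclic π ρ Set.univ) (k : ℕ) :
    ∃ τ : Hlgy k Y →ₗ[ℚ] Hlgy k X, Hlgy.map k π ∘ₗ τ = LinearMap.id ∧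
      τ ∘ₗ Hlgy.map k π = (1 / (Fintype.card P : ℚ)) • ∑ g, Hlgy.map k (ρ g) := by
  set N : Hlgy k X →ₗ[ℚ] Hlgy k X := (1 / (Fintype.card P : ℚ)) • ∑ g, Hlgy.map k (ρ g) with hN
  have hsurj := surjective_map_of_coneAcyclic hc k
  -- Hence `N` factors through the surjection `π_*`, and the factor is the transfer.
  have hker : LinearMap.ker (Hlgy.map k π) ≤ LinearMap.ker N := fun a ha => by
    rw [LinearMap.mem_ker] at ha ⊢
    rw [hN, LinearMap.smul_apply, LinearMap.sum_apply, h.sum_map_eq_zero hc ha, smul_zero]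
  let e := (Hlgy.map k π).quotKerEquivOfSurjective hsurj
  let τ : Hlgy k Y →ₗ[ℚ] Hlgy k X := (Submodule.liftQ _ N hker) ∘ₗ e.symm.toLinearMap
  have hτ : τ ∘ₗ Hlgy.map k π = N := by
    ext a
    have : e.symm (Hlgy.map k π a) = Submodule.Quotient.mk a := by
      rw [LinearEquiv.symm_apply_eq]; rfl
    simp only [τ, LinearMap.comp_apply, LinearEquiv.coe_coe, this]
    exact Submodule.liftQ_apply _ _ _
  refine ⟨τ, ?_, hτ⟩
  ext b
  obtain ⟨a, rfl⟩ := hsurj b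
  have h₁ : τ (Hlgy.map k π a) = N a := LinearMap.congr_fun hτ a
  have h₂ : ∀ g, Hlgy.map k π (Hlgy.map k (ρ g) a) = Hlgy.map k π a := fun g => by
    obtain ⟨z, rfl⟩ := exists_cycleClass a
    obtain ⟨z₁, e₁, f₁⟩ := map_cycleClass (ρ g) z
    obtain ⟨z₂, e₂, f₂⟩ := map_cycleClass π z₁
    obtain ⟨z₃, e₃, f₃⟩ := map_cycleClass π z
    rw [f₁, f₂, f₃]
    congr 1
    apply cycleChain_injective
    rw [e₂, e₁, e₃, ← ofSing_toSing (chainPush k π (cycleChain z)), ← push_toSing,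
      ← h.push_push g, push_toSing, push_toSing, ofSing_toSing]
  simp only [LinearMap.comp_apply, h₁, LinearMap.id_apply, hN, LinearMap.smul_apply,
    LinearMap.sum_apply, map_smul, map_sum, h₂, Finset.sum_const, Finset.card_univ,
    ← Nat.cast_smul_eq_nsmul ℚ, smul_smul, one_div,
    inv_mul_cancel₀ (card_ne_zero_rat (P := P)), one_smul]

end Transfer

end

/-! ### Collapsing edges, sets of longest edges, and the deformation of lengths. -/

noncomputable section

/-! ### Collapsing isomorphisms -/

namespace LGraph

variable {s : ℕ} {V E V' E' : Type} {G : LGraph s V E} {G' : LGraph s V' E'}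

lemma comp_surjective (Z : Set E) : Function.Surjective (G.comp Z) := Quot.mk_surjective

lemma comp_eq_of_mem {Z : Set E} {e : E} {x y : V} (he : e ∈ Z) (hx : x ∈ G.ends e)
    (hy : y ∈ G.ends e) : G.comp Z x = G.comp Z y := by
  induction h : G.ends e with
  | h a b =>
    have hab : G.comp Z a = G.comp Z b := Quot.sound ⟨e, he, h⟩
    rw [h, Sym2.mem_iff] at hx hy
    obtain rfl | rfl := hx <;> obtain rfl | rfl := hy
    exacts [rfl, hab, hab.symm, rfl]

/-- The map of components if more edges are collapsed. -/
def Comp.proj {Z F : Set E} (h : Z ⊆ F) : G.Comp Z → G.Comp F :=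
  Quot.map id fun _ _ ⟨e, he, hxy⟩ => ⟨e, h he, hxy⟩

@[simp]
lemma Comp.proj_comp {Z F : Set E} (h : Z ⊆ F) (v : V) :
    Comp.proj h (G.comp Z v) = G.comp F v := rfl

variable {Z F : Set E} {Z' F' : Set E'}

/-- The end points of corresponding edges correspond. -/
lemma Iso.exists_mem_ends (φ : Iso (G.contract Z) (G'.contract Z')) (e : {e // e ∉ Z}) {x : V}
    (hx : x ∈ G.ends e.1) :
    ∃ a ∈ G'.ends (φ.edge e).1, G'.comp Z' a = φ.vert (G.comp Z x) := by
  have h : φ.vert (G.comp Z x) ∈ (G'.contract Z').ends (φ.edge e) := by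
    rw [φ.ends_edge]
    exact Sym2.mem_map.2 ⟨_, Sym2.mem_map.2 ⟨x, hx, rfl⟩, rfl⟩
  exact Sym2.mem_map.1 h

/-- The map of components induced by an isomorphism if matching sets of edges are collapsed. -/
def collapseVert (φ : Iso (G.contract Z) (G'.contract Z')) (hF' : Z' ⊆ F')
    (h : ∀ e : {e // e ∉ Z}, (φ.edge e).1 ∈ F' ↔ e.1 ∈ F) : G.Comp F → G'.Comp F' :=
  Quot.lift (fun v => Comp.proj hF' (φ.vert (G.comp Z v))) <| by
    rintro x y ⟨e, he, hxy⟩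
    have hx : x ∈ G.ends e := hxy ▸ Sym2.mem_mk_left x y
    have hy : y ∈ G.ends e := hxy ▸ Sym2.mem_mk_right x y
    by_cases heZ : e ∈ Z
    · rw [comp_eq_of_mem heZ hx hy]
    · obtain ⟨a, ha, hax⟩ := φ.exists_mem_ends ⟨e, heZ⟩ hx
      obtain ⟨b, hb, hby⟩ := φ.exists_mem_ends ⟨e, heZ⟩ hy
      rw [← hax, ← hby]
      exact comp_eq_of_mem ((h ⟨e, heZ⟩).2 he) ha hb

lemma collapseVert_comp (φ : Iso (G.contract Z) (G'.contract Z')) (hF' : Z' ⊆ F')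
    (h : ∀ e : {e // e ∉ Z}, (φ.edge e).1 ∈ F' ↔ e.1 ∈ F) (v : V) :
    collapseVert φ hF' h (G.comp F v) = Comp.proj hF' (φ.vert (G.comp Z v)) := rfl

lemma collapseVert_leftInverse (φ : Iso (G.contract Z) (G'.contract Z')) (hF : Z ⊆ F)
    (hF' : Z' ⊆ F') (h : ∀ e : {e // e ∉ Z}, (φ.edge e).1 ∈ F' ↔ e.1 ∈ F)
    (h' : ∀ e : {e // e ∉ Z'}, (φ.symm.edge e).1 ∈ F ↔ e.1 ∈ F') (q) :
    collapseVert φ.symm hF h' (collapseVert φ hF' h q) = q := by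
  obtain ⟨v, rfl⟩ := comp_surjective F q
  obtain ⟨w, hw⟩ := comp_surjective Z' (φ.vert (G.comp Z v))
  rw [collapseVert_comp, ← hw, Comp.proj_comp, collapseVert_comp, hw]
  change Comp.proj hF (φ.vert.symm _) = _
  rw [Equiv.symm_apply_apply, Comp.proj_comp]

lemma symm_edge_mem_iff (φ : Iso (G.contract Z) (G'.contract Z'))
    (h : ∀ e : {e // e ∉ Z}, (φ.edge e).1 ∈ F' ↔ e.1 ∈ F) (e : {e // e ∉ Z'}) :
    (φ.symm.edge e).1 ∈ F ↔ e.1 ∈ F' := by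
  rw [← h]
  change (φ.edge (φ.edge.symm e)).1 ∈ F' ↔ _
  rw [Equiv.apply_symm_apply]

/-- The isomorphism induced by an isomorphism if matching sets of edges are collapsed. -/
def collapseIso (φ : Iso (G.contract Z) (G'.contract Z')) (hF : Z ⊆ F) (hF' : Z' ⊆ F')
    (h : ∀ e : {e // e ∉ Z}, (φ.edge e).1 ∈ F' ↔ e.1 ∈ F) :
    Iso (G.contract F) (G'.contract F') where
  vert :=
    { toFun := collapseVert φ hF' h
      invFun := collapseVert φ.symm hF (symm_edge_mem_iff φ h)
      left_inv := collapseVert_leftInverse φ hF hF' h _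
      right_inv := collapseVert_leftInverse φ.symm hF' hF _ h }
  edge :=
    { toFun e := ⟨(φ.edge ⟨e.1, fun he => e.2 (hF he)⟩).1, fun he => e.2 ((h _).1 he)⟩
      invFun e := ⟨(φ.edge.symm ⟨e.1, fun he => e.2 (hF' he)⟩).1, fun he =>
        e.2 ((symm_edge_mem_iff φ h _).1 he)⟩
      left_inv e := Subtype.ext (by simp)
      right_inv e := Subtype.ext (by simp) }
  ends_edge e := by
    have h₁ := congrArg (Sym2.map (Comp.proj hF')) (φ.ends_edge ⟨e.1, fun he => e.2 (hF he)⟩)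
    change (Sym2.map (G'.comp Z') _).map _ = ((Sym2.map (G.comp Z) _).map _).map _ at h₁
    change Sym2.map (G'.comp F') _ = (Sym2.map (G.comp F) _).map (collapseVert φ hF' h)
    rw [Sym2.map_map, Sym2.map_map, Sym2.map_map] at h₁
    rw [Sym2.map_map]
    exact h₁
  leg_eq i := congrArg (Comp.proj hF') (φ.leg_eq i)

lemma collapseIso_vert (φ : Iso (G.contract Z) (G'.contract Z')) (hF : Z ⊆ F) (hF' : Z' ⊆ F')
    (h : ∀ e : {e // e ∉ Z}, (φ.edge e).1 ∈ F' ↔ e.1 ∈ F) (q : G.Comp Z) :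
    (collapseIso φ hF hF' h).vert (Comp.proj hF q) = Comp.proj hF' (φ.vert q) := by
  obtain ⟨v, rfl⟩ := comp_surjective Z q
  rfl

end LGraph

namespace AdmGraph

variable {n s : ℕ}

lemma card_edges (G : AdmGraph n s) : (G.numE : ℤ) + 1 = n + G.numV := by
  have h := G.loops_eq
  obtain ⟨⟨v⟩, hs⟩ := G.admissible.connected
  have hc : Nat.card (G.graph.Comp Set.univ) = 1 :=
    Nat.card_eq_one_iff_unique.2 ⟨hs, ⟨G.graph.comp _ v⟩⟩
  rw [LGraph.loops, hc, Set.ncard_univ, Nat.card_fin, Nat.card_fin] at h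
  push_cast at h
  linarith

/-- As `G` is connected with `n` loops, the equation says that `G / F` still has `n` loops. Being a
forest thus depends only on the collapsed graph and passes along isomorphisms. -/
lemma isForest_iff (G : AdmGraph n s) (F : Set (Fin G.numE)) :
    G.graph.IsForest F ↔
      (Nat.card (G.graph.Comp F) : ℤ) + n = 1 + Nat.card {e // e ∉ F} := by
  have h := G.card_edges
  have h₂ := Set.ncard_add_ncard_compl F
  rw [Nat.card_fin] at h₂
  have h₃ : Nat.card {e // e ∉ F} = Fᶜ.ncard := rfl
  rw [LGraph.IsForest, LGraph.loops, Nat.card_fin, h₃]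
  omega

lemma isForest_of_iso {G G' : AdmGraph n s} {F : Set (Fin G.numE)} {F' : Set (Fin G'.numE)}
    (φ : LGraph.Iso (G.graph.contract F) (G'.graph.contract F')) (h : G.graph.IsForest F) :
    G'.graph.IsForest F' := by
  rw [isForest_iff] at h ⊢
  rwa [← Nat.card_congr φ.vert, ← Nat.card_congr φ.edge]

lemma not_isForest_univ (hn : 1 ≤ n) (G : AdmGraph n s) : ¬ G.graph.IsForest Set.univ := by
  rw [LGraph.IsForest, G.loops_eq]
  omega

end AdmGraph

/-! ### The longest edges -/

section TopEdges

variable {E : Type} [Fintype E]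

open Classical in
/-- The edges of positive length that belong to the `m` longest edges. -/
def topEdges (m : ℕ) (l : E → ℝ) : Finset E :=
  Finset.univ.filter fun e => 0 < l e ∧ (Finset.univ.filter fun f => l e ≤ l f).card ≤ m

lemma mem_topEdges {m : ℕ} {l : E → ℝ} {e : E} : e ∈ topEdges m l ↔
    0 < l e ∧ (Finset.univ.filter fun f => l e ≤ l f).card ≤ m := by
  classical
  simp only [topEdges, Finset.mem_filter_univ]

lemma topEdges_upward {m : ℕ} {l : E → ℝ} {e f : E} (he : e ∈ topEdges m l) (h : l e ≤ l f) :
    f ∈ topEdges m l := by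
  rw [mem_topEdges] at he ⊢
  refine ⟨he.1.trans_le h, (Finset.card_le_card fun x hx => ?_).trans he.2⟩
  simp only [Finset.mem_filter_univ] at hx ⊢
  exact h.trans hx

lemma topEdges_lt {m : ℕ} {l : E → ℝ} {e f : E} (he : e ∈ topEdges m l) (hf : f ∉ topEdges m l) :
    l f < l e := lt_of_not_ge fun h => hf (topEdges_upward he h)

lemma topEdges_mono {m m' : ℕ} (h : m ≤ m') (l : E → ℝ) : topEdges m l ⊆ topEdges m' l := by
  intro e he
  rw [mem_topEdges] at he ⊢
  exact ⟨he.1, he.2.trans h⟩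

/-- Such a set `T` exists only without a tie across the `m`-th place; with a tie, `topEdges` has
fewer than `m` elements. -/
lemma topEdges_eq {m : ℕ} {l : E → ℝ} {T : Finset E} (hT : T.card = m) (hpos : ∀ e ∈ T, 0 < l e)
    (hlt : ∀ e ∈ T, ∀ f ∉ T, l f < l e) : topEdges m l = T := by
  classical
  ext e
  rw [mem_topEdges]
  refine ⟨fun ⟨_, h⟩ => ?_, fun he => ⟨hpos e he, ?_⟩⟩
  · by_contra he
    have : insert e T ⊆ Finset.univ.filter fun f => l e ≤ l f := by
      intro f hf
      rw [Finset.mem_filter_univ]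
      obtain rfl | hf := Finset.mem_insert.1 hf
      exacts [le_rfl, (hlt f hf e he).le]
    have := (Finset.card_le_card this).trans h
    rw [Finset.card_insert_of_notMem he, hT] at this
    omega
  · rw [← hT]
    refine Finset.card_le_card fun f hf => ?_
    rw [Finset.mem_filter_univ] at hf
    by_contra hfT
    exact (hlt e he f hfT).not_ge hf

/-- The set is determined by finitely many strict inequalities, which persist nearby. -/
lemma topEdges_eventually_eq {m : ℕ} {l : E → ℝ} (h : (topEdges m l).card = m) :
    ∀ᶠ l' in nhds l, topEdges m l' = topEdges m l := by
  have h₁ : ∀ e ∈ topEdges m l, ∀ᶠ l' in nhds l, 0 < l' e := fun e he =>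
    (continuous_apply e).continuousAt.eventually_const_lt (mem_topEdges.1 he).1
  have h₂ : ∀ e ∈ topEdges m l, ∀ f ∈ (topEdges m l : Set E)ᶜ, ∀ᶠ l' in nhds l, l' f < l' e :=
    fun e he f hf => (continuous_apply f).continuousAt.eventually_lt
      (continuous_apply e).continuousAt (topEdges_lt he hf)
  have h₂' : ∀ e ∈ topEdges m l, ∀ᶠ l' in nhds l, ∀ f ∈ (topEdges m l : Set E)ᶜ, l' f < l' e :=
    fun e he => (Filter.eventually_all_finite (Set.toFinite _)).2 (h₂ e he)
  filter_upwards [(Filter.eventually_all_finset _).2 h₁, (Filter.eventually_all_finset _).2 h₂']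
    with l' hp hl
  exact topEdges_eq h hp hl

/-- An edge at least as long as one of positive length is not collapsed, so a bijection of the
uncollapsed edges suffices for the count. -/
lemma mem_topEdges_congr {E' : Type} [Fintype E'] {m : ℕ} {l : E → ℝ} {l' : E' → ℝ} {Z : Set E}
    {Z' : Set E'} (hZ : ∀ e, e ∈ Z ↔ l e = 0) (hZ' : ∀ e, e ∈ Z' ↔ l' e = 0)
    (φ : {e // e ∉ Z} ≃ {e // e ∉ Z'}) {a : ℝ} (ha : 0 < a)
    (h : ∀ e, l' (φ e).1 = a * l e.1) (e : {e // e ∉ Z}) :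
    (φ e).1 ∈ topEdges m l' ↔ e.1 ∈ topEdges m l := by
  rw [mem_topEdges, mem_topEdges, h, mul_pos_iff_of_pos_left ha]
  refine and_congr_right fun hpos => ?_
  suffices H : (Finset.univ.filter fun f => l e.1 ≤ l f).card =
      (Finset.univ.filter fun f => a * l e.1 ≤ l' f).card by rw [H]
  have hm : ∀ f, l e.1 ≤ l f → f ∉ Z := fun f hf hfZ => by
    rw [(hZ f).1 hfZ] at hf; linarith
  have hm' : ∀ f, a * l e.1 ≤ l' f → f ∉ Z' := fun f hf hfZ => by
    rw [(hZ' f).1 hfZ] at hf; nlinarith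
  refine Finset.card_bij (fun f hf => (φ ⟨f, hm f (by simpa using hf)⟩).1) ?_ ?_ ?_
  · intro f hf
    rw [Finset.mem_filter_univ] at hf ⊢
    rw [h]
    exact mul_le_mul_of_nonneg_left hf ha.le
  · intro f hf g hg hfg
    exact congrArg Subtype.val (φ.injective (Subtype.ext hfg))
  · intro f hf
    rw [Finset.mem_filter_univ] at hf
    obtain ⟨g, hg⟩ := φ.surjective ⟨f, hm' f hf⟩
    have hg' : l' f = a * l g.1 := by rw [← h, hg]
    refine ⟨g.1, ?_, by simp [hg]⟩
    rw [Finset.mem_filter_univ]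
    rw [hg'] at hf
    exact le_of_mul_le_mul_left hf ha

/-- The number of sets of longest edges, with sizes in `S`, to which an edge belongs. -/
def edgeLevel (S : Finset ℕ) (l : E → ℝ) (e : E) : ℕ := by
  classical exact (S.filter fun m => e ∈ topEdges m l).card

lemma edgeLevel_eq_zero {S : Finset ℕ} {l : E → ℝ} {e : E} :
    edgeLevel S l e = 0 ↔ ∀ m ∈ S, e ∉ topEdges m l := by
  simp [edgeLevel, Finset.filter_eq_empty_iff]

lemma edgeLevel_congr {S : Finset ℕ} {l l' : E → ℝ}
    (h : ∀ m ∈ S, topEdges m l = topEdges m l') (e : E) : edgeLevel S l e = edgeLevel S l' e := by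
  classical
  unfold edgeLevel
  congr 1
  refine Finset.filter_congr fun m hm => ?_
  rw [h m hm]

/-- Sets of longest edges are upward closed: `e` lies in every one that contains `f`, and also in
the one of size parameter `m`. -/
lemma edgeLevel_lt {S : Finset ℕ} {l : E → ℝ} {m : ℕ} (hm : m ∈ S) {e f : E}
    (he : e ∈ topEdges m l) (hf : f ∉ topEdges m l) : edgeLevel S l f < edgeLevel S l e := by
  classical
  refine Finset.card_lt_card ((Finset.ssubset_iff_of_subset fun m' hm' => ?_).2 ⟨m, ?_, ?_⟩)
  · rw [Finset.mem_filter] at hm' ⊢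
    exact ⟨hm'.1, topEdges_upward hm'.2 (topEdges_lt he hf).le⟩
  · rw [Finset.mem_filter]; exact ⟨hm, he⟩
  · rw [Finset.mem_filter]; exact fun h => hf h.2

/-- The lengths at time `t` of the deformation that makes the lengths of edges proportional to
their levels. -/
def flowLen (S : Finset ℕ) (l : E → ℝ) (t : ℝ) (e : E) : ℝ :=
  (1 - t) * l e + t * ((∑ f, l f) * edgeLevel S l e)

lemma flowLen_nonneg {S : Finset ℕ} {l : E → ℝ} (hl : ∀ e, 0 ≤ l e) {t : ℝ} (h0 : 0 ≤ t)
    (h1 : t ≤ 1) (e : E) : 0 ≤ flowLen S l t e := by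
  have := Finset.sum_nonneg fun e (_ : e ∈ Finset.univ) => hl e
  have := hl e
  have : 0 ≤ 1 - t := by linarith
  unfold flowLen
  positivity

lemma flowLen_pos {S : Finset ℕ} {l : E → ℝ} (hl : ∀ e, 0 ≤ l e) {t : ℝ} (h0 : 0 ≤ t)
    (h1 : t ≤ 1) {m : ℕ} (hm : m ∈ S) {e : E} (he : e ∈ topEdges m l) : 0 < flowLen S l t e := by
  have hpos := (mem_topEdges.1 he).1
  have hsum : 0 < ∑ f, l f := hpos.trans_le
    (Finset.single_le_sum (fun f _ => hl f) (Finset.mem_univ e))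
  have hlev : (0 : ℝ) < edgeLevel S l e := by
    exact_mod_cast Nat.pos_of_ne_zero fun h => edgeLevel_eq_zero.1 h m hm he
  unfold flowLen
  obtain rfl | h1 := h1.eq_or_lt
  · rw [sub_self, zero_mul, zero_add, one_mul]; positivity
  · have : 0 < 1 - t := by linarith
    positivity

lemma flowLen_lt {S : Finset ℕ} {l : E → ℝ} (hl : ∀ e, 0 ≤ l e) {t : ℝ} (h0 : 0 ≤ t)
    (h1 : t ≤ 1) {m : ℕ} (hm : m ∈ S) {e f : E} (he : e ∈ topEdges m l)
    (hf : f ∉ topEdges m l) : flowLen S l t f < flowLen S l t e := by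
  have hpos := (mem_topEdges.1 he).1
  have hsum : 0 < ∑ f, l f := hpos.trans_le
    (Finset.single_le_sum (fun f _ => hl f) (Finset.mem_univ e))
  have hlt := topEdges_lt he hf
  have hlev : (edgeLevel S l f : ℝ) < edgeLevel S l e := by exact_mod_cast edgeLevel_lt hm he hf
  unfold flowLen
  -- At time 1 strictness comes from the levels, before that from the lengths.
  obtain rfl | h1 := h1.eq_or_lt
  · have := mul_lt_mul_of_pos_left hlev hsum
    linarith
  · have h₁ : (1 - t) * l f < (1 - t) * l e := mul_lt_mul_of_pos_left hlt (by linarith)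
    have h₂ : t * ((∑ f, l f) * edgeLevel S l f) ≤ t * ((∑ f, l f) * edgeLevel S l e) := by
      gcongr
    linarith

lemma topEdges_flowLen {S : Finset ℕ} {l : E → ℝ} (hl : ∀ e, 0 ≤ l e) {t : ℝ} (h0 : 0 ≤ t)
    (h1 : t ≤ 1) {m : ℕ} (hm : m ∈ S) (hc : (topEdges m l).card = m) :
    topEdges m (flowLen S l t) = topEdges m l :=
  topEdges_eq hc (fun _ he => flowLen_pos hl h0 h1 hm he)
    fun _ he _ hf => flowLen_lt hl h0 h1 hm he hf

lemma flowLen_eq_zero_of_eq_zero {S : Finset ℕ} {l : E → ℝ} {t : ℝ} {e : E} (he : l e = 0) :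
    flowLen S l t e = 0 := by
  have : edgeLevel S l e = 0 := edgeLevel_eq_zero.2 fun m _ h => (mem_topEdges.1 h).1.ne' he
  simp [flowLen, he, this]

lemma flowLen_eq_zero_iff {S : Finset ℕ} {l : E → ℝ} (hl : ∀ e, 0 ≤ l e) {t : ℝ} (h0 : 0 ≤ t)
    (h1 : t < 1) {e : E} : flowLen S l t e = 0 ↔ l e = 0 := by
  refine ⟨fun h => ?_, flowLen_eq_zero_of_eq_zero⟩
  have h₁ : 0 ≤ ∑ f, l f := Finset.sum_nonneg fun e _ => hl e
  have h₂ : 0 ≤ t * ((∑ f, l f) * edgeLevel S l e) := by positivity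
  have h₃ : 0 ≤ (1 - t) * l e := mul_nonneg (by linarith) (hl e)
  unfold flowLen at h
  have : (1 - t) * l e = 0 := by linarith
  exact (mul_eq_zero.1 this).resolve_left (by linarith)

/-- The sets of longest edges increase with `m`, so level zero means lying outside the largest of
them. -/
lemma flowLen_one_eq_zero_iff {S : Finset ℕ} {l : E → ℝ} (hl : ∀ e, 0 ≤ l e) (hS : S.Nonempty)
    {e : E} : flowLen S l 1 e = 0 ↔ e ∉ topEdges (S.max' hS) l := by
  constructor
  · exact fun h he => (flowLen_pos hl zero_le_one le_rfl (S.max'_mem hS) he).ne' h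
  · intro h
    have : edgeLevel S l e = 0 := edgeLevel_eq_zero.2 fun m hm he =>
      h (topEdges_mono (S.le_max' m hm) l he)
    simp [flowLen, this]

/-- The total length in `flowLen` makes the deformation homogeneous of degree one, so that it
descends to homothety classes. Collapsed edges do not contribute to the total. -/
lemma flowLen_congr {E' : Type} [Fintype E'] {S : Finset ℕ} {l : E → ℝ} {l' : E' → ℝ} {Z : Set E}
    {Z' : Set E'} (hZ : ∀ e, e ∈ Z ↔ l e = 0) (hZ' : ∀ e, e ∈ Z' ↔ l' e = 0)
    (φ : {e // e ∉ Z} ≃ {e // e ∉ Z'}) {a : ℝ} (ha : 0 < a)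
    (h : ∀ e, l' (φ e).1 = a * l e.1) (t : ℝ) (e : {e // e ∉ Z}) :
    flowLen S l' t (φ e).1 = a * flowLen S l t e.1 := by
  classical
  have hlev : edgeLevel S l' (φ e).1 = edgeLevel S l e.1 := by
    simp only [edgeLevel, mem_topEdges_congr hZ hZ' φ ha h]
  have hsum : ∑ f, l' f = a * ∑ f, l f := by
    rw [Finset.mul_sum, ← Finset.sum_filter_add_sum_filter_not _ (· ∈ Z'),
      ← Finset.sum_filter_add_sum_filter_not (f := fun f => a * l f) _ (· ∈ Z)]
    congr 1
    · rw [Finset.sum_eq_zero, Finset.sum_eq_zero]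
      · intro f hf
        rw [(hZ f).1 (Finset.mem_filter.1 hf).2, mul_zero]
      · intro f hf
        exact (hZ' f).1 (Finset.mem_filter.1 hf).2
    · rw [Finset.sum_subtype (p := (· ∉ Z')) _ (by simp),
        Finset.sum_subtype (p := (· ∉ Z)) _ (by simp)]
      exact (Fintype.sum_equiv φ _ _ fun f => (h f).symm).symm
  unfold flowLen
  rw [hlev, hsum, h]
  ring

end TopEdges

end

/-! ### Cut metrics, and the deformation on spaces of decorated graphs. -/

noncomputable section

variable {n s : ℕ}

namespace RegMetric

variable {G G' : AdmGraph n s}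

lemma len_nonneg (l : RegMetric G) (e : Fin G.numE) : 0 ≤ l.len e := l.2.1 e

lemma isForest_zero (l : RegMetric G) : G.graph.IsForest l.zero := l.2.2

lemma mem_zero {l : RegMetric G} {e : Fin G.numE} : e ∈ l.zero ↔ l.len e = 0 := Iff.rfl

lemma continuous_len : Continuous (fun l : RegMetric G => l.len) := continuous_subtype_val

/-- The `m` longest edges are well-defined, have positive lengths, and the other edges form a
forest. -/
def IsCut (m : ℕ) (l : RegMetric G) : Prop :=
  (topEdges m l.len).card = m ∧ G.graph.IsForest {e | e ∉ topEdges m l.len}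

lemma isOpen_isCut (m : ℕ) : IsOpen {l : RegMetric G | l.IsCut m} := by
  rw [isOpen_iff_eventually]
  intro l hl
  filter_upwards [continuous_len.continuousAt.eventually (topEdges_eventually_eq hl.1)] with l' h
  rw [IsCut, h]
  exact hl

/-- The homothety matches the sets of longest edges. It therefore induces an isomorphism after all
other edges are collapsed, and this preserves the forest condition. -/
lemma IsHomothety.isCut {l : RegMetric G} {l' : RegMetric G'}
    {φ : LGraph.Iso l.shrunk l'.shrunk} (h : l.IsHomothety l' φ) {m : ℕ} (hl : l.IsCut m) :
    l'.IsCut m := by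
  obtain ⟨a, ha, h⟩ := h
  have key := mem_topEdges_congr (m := m) (fun e => mem_zero) (fun e => mem_zero) φ.edge ha h
  have hsub : ∀ {G : AdmGraph n s} (l : RegMetric G), ∀ e ∈ topEdges m l.len, e ∉ l.zero :=
    fun l e he => (mem_topEdges.1 he).1.ne'
  constructor
  · refine (Finset.card_bij (fun e he => (φ.edge ⟨e, hsub l e he⟩).1) ?_ ?_ ?_).symm.trans hl.1
    · exact fun e he => (key _).2 he
    · intro e he f hf hef
      exact congrArg Subtype.val (φ.edge.injective (Subtype.ext hef))
    · intro f hf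
      obtain ⟨e, he⟩ := φ.edge.surjective ⟨f, hsub l' f hf⟩
      have he' : (φ.edge e).1 = f := congrArg Subtype.val he
      refine ⟨e.1, (key e).1 (he' ▸ hf), ?_⟩
      exact he'
  · exact AdmGraph.isForest_of_iso (LGraph.collapseIso φ
      (F := {e | e ∉ topEdges m l.len}) (F' := {e | e ∉ topEdges m l'.len})
      (fun e he h => hsub l e h he) (fun e he h => hsub l' e h he)
      fun e => not_congr (key e)) hl.2

lemma isCut_congr {l : RegMetric G} {l' : RegMetric G'}
    {φ : LGraph.Iso l.shrunk l'.shrunk} (h : l.IsHomothety l' φ) {m : ℕ} :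
    l.IsCut m ↔ l'.IsCut m := ⟨h.isCut, h.symm.isCut⟩

/-- Take `m` to be the number of edges of positive length; the others are the zero set of a regular
metric. -/
lemma exists_isCut (l : RegMetric G) : ∃ m ≤ G.numE, l.IsCut m := by
  classical
  set T : Finset (Fin G.numE) := Finset.univ.filter fun e => 0 < l.len e with hT
  have hmem : ∀ e, e ∈ T ↔ 0 < l.len e := fun e => by simp [hT]
  have h0 : ∀ e ∉ T, l.len e = 0 := fun e he =>
    le_antisymm (not_lt.1 fun h => he ((hmem e).2 h)) (l.len_nonneg e)
  have htop : topEdges T.card l.len = T := topEdges_eq rfl (fun e he => (hmem e).1 he)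
    fun e he f hf => by rw [h0 f hf]; exact (hmem e).1 he
  refine ⟨T.card, by simpa using Finset.card_le_univ T, by rw [htop], ?_⟩
  rw [htop]
  convert l.isForest_zero using 1
  ext e
  exact ⟨h0 e, fun he h => ((hmem e).1 h).ne' he⟩

/-- The deformation of metrics at time `t`. -/
def flow (S : Finset ℕ) (hS : S.Nonempty) (l : RegMetric G) (hl : ∀ m ∈ S, l.IsCut m)
    (t : unitInterval) : RegMetric G :=
  ⟨flowLen S l.len t, flowLen_nonneg l.len_nonneg t.2.1 t.2.2, by
    -- Before time 1 the zero set does not change; at time 1 it is the complement of the largest set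
    -- of longest edges, a forest by the cut condition for `max S`.
    obtain h | h := t.2.2.eq_or_lt
    · rw [h]
      simp only [flowLen_one_eq_zero_iff l.len_nonneg hS]
      exact (hl _ (S.max'_mem hS)).2
    · simp only [flowLen_eq_zero_iff l.len_nonneg t.2.1 h]
      exact l.2.2⟩

variable {S : Finset ℕ} {hS : S.Nonempty}

lemma len_flow (l : RegMetric G) (hl : ∀ m ∈ S, l.IsCut m) (t : unitInterval) :
    (l.flow S hS hl t).len = flowLen S l.len t := rfl

lemma isCut_flow {l : RegMetric G} (hl : ∀ m ∈ S, l.IsCut m) (t : unitInterval) {m : ℕ}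
    (hm : m ∈ S) : (l.flow S hS hl t).IsCut m := by
  rw [IsCut, len_flow, topEdges_flowLen l.len_nonneg t.2.1 t.2.2 hm (hl m hm).1]
  exact hl m hm

lemma flow_zero (l : RegMetric G) (hl : ∀ m ∈ S, l.IsCut m) : l.flow S hS hl 0 = l := by
  apply Subtype.ext
  funext e
  change flowLen S l.len (0 : ℝ) e = l.len e
  simp [flowLen]

lemma zero_subset_zero_flow (l : RegMetric G) (hl : ∀ m ∈ S, l.IsCut m) (t : unitInterval) :
    l.zero ⊆ (l.flow S hS hl t).zero := fun _ he => flowLen_eq_zero_of_eq_zero he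

lemma continuous_flow :
    Continuous fun p : {l : RegMetric G // ∀ m ∈ S, l.IsCut m} × unitInterval =>
      p.1.1.flow S hS p.1.2 p.2 := by
  refine Continuous.subtype_mk (continuous_pi fun e => ?_) _
  have hc : ∀ f, Continuous fun p : {l : RegMetric G // ∀ m ∈ S, l.IsCut m} × unitInterval =>
      p.1.1.len f := fun f =>
    (continuous_apply f).comp (continuous_len.comp (continuous_subtype_val.comp continuous_fst))
  have ht : Continuous fun p : {l : RegMetric G // ∀ m ∈ S, l.IsCut m} × unitInterval =>
      (p.2 : ℝ) := continuous_subtype_val.comp continuous_snd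
  -- On cut metrics the sets of longest edges, hence the levels, are locally constant.
  have hlev : Continuous fun p : {l : RegMetric G // ∀ m ∈ S, l.IsCut m} × unitInterval =>
      (edgeLevel S p.1.1.len e : ℝ) := by
    refine Continuous.comp (g := fun k : ℕ => (k : ℝ)) continuous_of_discreteTopology ?_
    refine (IsLocallyConstant.continuous ?_ : Continuous
      fun l : {l : RegMetric G // ∀ m ∈ S, l.IsCut m} => edgeLevel S l.1.len e).comp continuous_fst
    refine (IsLocallyConstant.iff_eventually_eq _).2 fun l => ?_
    have := (Filter.eventually_all_finset S).2 fun m hm =>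
      ((continuous_len (G := G)).comp continuous_subtype_val).continuousAt.eventually
        (topEdges_eventually_eq (l.2 m hm).1)
    filter_upwards [this] with l' h'
    exact edgeLevel_congr h' e
  exact ((continuous_const.sub ht).mul (hc e)).add
    (ht.mul ((continuous_finsetSum _ fun f _ => hc f).mul hlev))

/-- A graph of positive loop number is not a forest, so not all lengths vanish. -/
lemma sum_len_pos (hn : 1 ≤ n) (l : RegMetric G) : 0 < ∑ e, l.len e := by
  refine (Finset.sum_nonneg fun e _ => l.len_nonneg e).lt_of_ne' fun h => ?_
  rw [Finset.sum_eq_zero_iff_of_nonneg fun e _ => l.len_nonneg e] at h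
  have hz : l.zero = Set.univ := Set.eq_univ_of_forall fun e => h e (Finset.mem_univ e)
  exact G.not_isForest_univ hn (hz ▸ l.isForest_zero)

end RegMetric

/-! ### Decorated graphs -/

/-- A kind of decorations of admissible graphs, and when isomorphisms of collapsed graphs are
compatible with decorations. -/
structure Decoration (n s : ℕ) where
  /-- The decorated graphs. -/
  Idx : Type
  /-- The underlying graph. -/
  gr : Idx → AdmGraph n s
  /-- The isomorphisms that respect the decorations. -/
  compat : ∀ (i j : Idx) (Z : Set (Fin (gr i).numE)) (Z' : Set (Fin (gr j).numE)),
    LGraph.Iso ((gr i).graph.contract Z) ((gr j).graph.contract Z') → Prop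
  compat_refl : ∀ i Z, compat i i Z Z (.refl _)
  compat_collapse : ∀ i j Z Z' φ F F' hF hF' h, compat i j Z Z' φ →
    compat i j F F' (LGraph.collapseIso φ hF hF' h)
  /-- The equivalence relation on decorated metric graphs. -/
  setoid : Setoid (Σ i, RegMetric (gr i))
  rel_iff : ∀ p q, setoid.r p q ↔
    ∃ φ, p.2.IsHomothety q.2 φ ∧ compat p.1 q.1 p.2.zero q.2.zero φ

namespace Decoration

variable (D : Decoration n s)

/-- Decorated metric graphs. -/
abbrev Metric : Type := Σ i, RegMetric (D.gr i)

/-- The moduli space of decorated metric graphs. -/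
abbrev Space : Type := Quotient D.setoid

variable {D}

lemma mk_eq_mk {p q : D.Metric} :
    (Quotient.mk D.setoid p = Quotient.mk D.setoid q) ↔
      ∃ φ, p.2.IsHomothety q.2 φ ∧ D.compat p.1 q.1 p.2.zero q.2.zero φ :=
  Quotient.eq.trans (D.rel_iff p q)

lemma isCut_congr {p q : D.Metric} (h : Quotient.mk D.setoid p = Quotient.mk D.setoid q) {m : ℕ} :
    p.2.IsCut m ↔ q.2.IsCut m := by
  obtain ⟨φ, h, -⟩ := mk_eq_mk.1 h
  exact RegMetric.isCut_congr h

/-- By homogeneity the same isomorphism matches the deformed lengths. Where the deformation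
collapses more edges, it descends by `collapseIso` and stays compatible with the decorations. -/
lemma mk_flow_eq_mk_flow {S : Finset ℕ} {hS : S.Nonempty} {p q : D.Metric}
    (hp : ∀ m ∈ S, p.2.IsCut m) (hq : ∀ m ∈ S, q.2.IsCut m)
    (h : Quotient.mk D.setoid p = Quotient.mk D.setoid q) (t : unitInterval) :
    Quotient.mk D.setoid ⟨p.1, p.2.flow S hS hp t⟩ =
      Quotient.mk D.setoid ⟨q.1, q.2.flow S hS hq t⟩ := by
  obtain ⟨φ, ⟨a, ha, h⟩, hc⟩ := mk_eq_mk.1 h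
  have key := flowLen_congr (S := S) (fun e => RegMetric.mem_zero) (fun e => RegMetric.mem_zero)
    φ.edge ha h t
  have hz : ∀ e, (φ.edge e).1 ∈ (q.2.flow S hS hq t).zero ↔ e.1 ∈ (p.2.flow S hS hp t).zero :=
    fun e => by
      rw [RegMetric.mem_zero, RegMetric.mem_zero, RegMetric.len_flow, RegMetric.len_flow, key,
        mul_eq_zero, or_iff_right ha.ne']
  refine mk_eq_mk.2 ⟨LGraph.collapseIso φ (RegMetric.zero_subset_zero_flow (hS := hS) _ hp t)
    (RegMetric.zero_subset_zero_flow (hS := hS) _ hq t) hz, ⟨a, ha, fun e => ?_⟩,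
    D.compat_collapse _ _ _ _ _ _ _ (RegMetric.zero_subset_zero_flow (hS := hS) _ hp t)
      (RegMetric.zero_subset_zero_flow (hS := hS) _ hq t) _ hc⟩
  exact key ⟨e.1, fun he => e.2 (RegMetric.zero_subset_zero_flow (hS := hS) _ hp t he)⟩

/-- Metrics on a graph that differ by a factor represent the same point. -/
lemma mk_eq_mk_of_smul {i : D.Idx} {l l' : RegMetric (D.gr i)} {a : ℝ} (ha : 0 < a)
    (h : ∀ e, l'.len e = a * l.len e) :
    Quotient.mk D.setoid ⟨i, l⟩ = Quotient.mk D.setoid ⟨i, l'⟩ := by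
  -- The zero sets of `l` and `l'` are equal but not syntactically; descending the identity from the
  -- graph with nothing collapsed avoids transport.
  refine mk_eq_mk.2 ⟨LGraph.collapseIso (.refl ((D.gr i).graph.contract ∅)) (Set.empty_subset _)
    (Set.empty_subset _) fun e => ?_, ⟨a, ha, fun e => h _⟩,
    D.compat_collapse _ _ _ _ _ _ _ _ _ _ (D.compat_refl _ _)⟩
  change l'.len e.1 = 0 ↔ l.len e.1 = 0
  rw [h, mul_eq_zero, or_iff_right ha.ne']

lemma isOpen_iff {W : Set D.Space} :
    IsOpen W ↔ ∀ i, IsOpen {l : RegMetric (D.gr i) | Quotient.mk D.setoid ⟨i, l⟩ ∈ W} := by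
  rw [← isQuotientMap_quotient_mk'.isOpen_preimage, isOpen_sigma_iff]
  rfl

section Flow

variable {S : Finset ℕ} {W : Set D.Space}
  (hW : ∀ p : D.Metric, Quotient.mk D.setoid p ∈ W ↔ ∀ m ∈ S, p.2.IsCut m)

/-- The metrics that represent points of `W`. -/
def cutMk (S : Finset ℕ) (hW : ∀ p : D.Metric, Quotient.mk D.setoid p ∈ W ↔ ∀ m ∈ S, p.2.IsCut m)
    (x : Σ i, {l : RegMetric (D.gr i) // ∀ m ∈ S, l.IsCut m}) : W :=
  ⟨Quotient.mk D.setoid ⟨x.1, x.2.1⟩, (hW _).2 x.2.2⟩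

include hW

lemma isOpen_cut : IsOpen W := by
  rw [isOpen_iff]
  intro i
  simp only [hW]
  have : {l : RegMetric (D.gr i) | ∀ m ∈ S, l.IsCut m} =
      ⋂ m ∈ S, {l : RegMetric (D.gr i) | l.IsCut m} := by
    ext; simp
  rw [this]
  exact isOpen_biInter_finset fun m _ => RegMetric.isOpen_isCut m

/-- A quotient map restricts to a quotient map over an open subset of its target. -/
lemma isQuotientMap_cutMk : Topology.IsQuotientMap (cutMk S hW) := by
  rw [Topology.isQuotientMap_iff]
  refine ⟨.of_isOpen_preimage_iff_isOpen fun U =>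
    ⟨fun hU => ?_, fun hU => hU.preimage ?_⟩, ?_⟩
  rotate_right
  · rintro ⟨y, hy⟩
    obtain ⟨p, rfl⟩ := Quotient.exists_rep y
    exact ⟨⟨p.1, p.2, (hW p).1 hy⟩, rfl⟩
  · refine (isOpen_cut hW).isOpenEmbedding_subtypeVal.isOpen_iff_image_isOpen.2 ?_
    rw [isOpen_iff]
    intro i
    have hcut : IsOpen {l : RegMetric (D.gr i) | ∀ m ∈ S, l.IsCut m} := by
      have := isOpen_iff.1 (isOpen_cut hW) i
      simpa only [hW] using this
    convert hcut.isOpenMap_subtype_val _ (isOpen_sigma_iff.1 hU i) using 1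
    ext l
    constructor
    · rintro ⟨y, hy, hyl⟩
      have hl : ∀ m ∈ S, l.IsCut m := (hW ⟨i, l⟩).1 (hyl ▸ y.2)
      refine ⟨⟨l, hl⟩, ?_, rfl⟩
      have : cutMk S hW ⟨i, l, hl⟩ = y := Subtype.ext hyl.symm
      change cutMk S hW ⟨i, l, hl⟩ ∈ U
      rwa [this]
    · rintro ⟨l, hl, rfl⟩
      exact ⟨_, hl, rfl⟩
  · refine Continuous.subtype_mk (continuous_quotient_mk'.comp
      (continuous_sigma fun i => ?_)) _
    exact (continuous_sigmaMk (σ := fun i => RegMetric (D.gr i))).comp continuous_subtype_val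

lemma isCut_out (y : W) : ∀ m ∈ S, (y.1.out : D.Metric).2.IsCut m :=
  (hW _).1 (by rw [Quotient.out_eq]; exact y.2)

/-- The deformation of `W`. -/
def spaceFlow (hS : S.Nonempty) (y : W × unitInterval) : D.Space :=
  Quotient.mk D.setoid ⟨y.1.1.out.1, y.1.1.out.2.flow S hS (isCut_out hW y.1) y.2⟩

variable {hS : S.Nonempty}

/-- The representative chosen in `spaceFlow` does not matter. -/
lemma spaceFlow_mk {y : W} {p : D.Metric} (hp : Quotient.mk D.setoid p = y.1) (t : unitInterval) :
    spaceFlow hW hS (y, t) = Quotient.mk D.setoid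
      ⟨p.1, p.2.flow S hS ((hW p).1 (hp ▸ y.2)) t⟩ :=
  mk_flow_eq_mk_flow _ _ (by rw [Quotient.out_eq, hp]) t

lemma continuous_spaceFlow : Continuous (spaceFlow hW hS) := by
  -- The interval is locally compact, so the product of a quotient map with it is again a quotient
  -- map.
  refine (isQuotientMap_cutMk hW).continuous_lift_prod_left ?_
  have : Continuous fun p : Σ i, {l : RegMetric (D.gr i) // ∀ m ∈ S, l.IsCut m} × unitInterval =>
      Quotient.mk D.setoid ⟨p.1, p.2.1.1.flow S hS p.2.1.2 p.2.2⟩ :=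
    continuous_sigma fun i => continuous_quotient_mk'.comp
      (continuous_sigmaMk.comp RegMetric.continuous_flow)
  refine (this.comp (Homeomorph.sigmaProdDistrib (X := fun i =>
    {l : RegMetric (D.gr i) // ∀ m ∈ S, l.IsCut m}) (Y := unitInterval)).continuous).congr ?_
  rintro ⟨⟨i, l⟩, t⟩
  exact (spaceFlow_mk hW (p := ⟨i, l.1⟩) rfl t).symm

lemma spaceFlow_mem (y : W) (t : unitInterval) : spaceFlow hW hS (y, t) ∈ W :=
  (hW _).2 fun _ hm => RegMetric.isCut_flow (hS := hS) (isCut_out hW y) t hm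

lemma spaceFlow_zero (y : W) : spaceFlow hW hS (y, 0) = y.1 := by
  obtain ⟨p, hp⟩ := Quotient.exists_rep y.1
  rw [spaceFlow_mk hW hp, RegMetric.flow_zero]
  exact hp

/-- At time 1 the metric is the total length times the locally constant level, and scaling by the
total length does not affect the class. -/
lemma isLocallyConstant_spaceFlow (hn : 1 ≤ n) :
    IsLocallyConstant fun y => spaceFlow hW hS (y, 1) := by
  intro U
  rw [← (isQuotientMap_cutMk hW).isOpen_preimage, isOpen_sigma_iff]
  intro i
  refine (IsLocallyConstant.iff_eventually_eq
    (fun l : {l : RegMetric (D.gr i) // ∀ m ∈ S, l.IsCut m} =>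
      spaceFlow hW hS (cutMk S hW ⟨i, l⟩, 1))).2 (fun l => ?_) U
  have := (Filter.eventually_all_finset S).2 fun m hm =>
    ((RegMetric.continuous_len (G := D.gr i)).comp continuous_subtype_val).continuousAt.eventually
      (topEdges_eventually_eq (l.2 m hm).1)
  filter_upwards [this] with l' h'
  rw [spaceFlow_mk hW (p := ⟨i, l'.1⟩) rfl, spaceFlow_mk hW (p := ⟨i, l.1⟩) rfl]
  have h₁ := l.1.sum_len_pos hn
  have h₂ := l'.1.sum_len_pos hn
  refine mk_eq_mk_of_smul (a := (∑ e, l.1.len e) / ∑ e, l'.1.len e) (by positivity) fun e => ?_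
  have hlev : edgeLevel S l'.1.len e = edgeLevel S l.1.len e := edgeLevel_congr h' e
  rw [RegMetric.len_flow, RegMetric.len_flow]
  simp only [flowLen, Set.Icc.coe_one, sub_self, zero_mul, zero_add, one_mul, hlev]
  field_simp

end Flow

end Decoration

end

/-! ### The cover of the moduli space, and the argument for a general kind of coloring. -/

noncomputable section

variable {n s : ℕ}

/-! ### Numbers of edges -/

lemma _root_.Sym2.sum_count_toMultiset {V : Type} [Fintype V] [DecidableEq V] (z : Sym2 V) :
    ∑ v, z.toMultiset.count v = 2 := by
  induction z with
  | h a b =>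
    rw [Multiset.sum_count_eq_card fun _ _ => Finset.mem_univ _]
    rfl

namespace AdmGraph

lemma sum_valency (G : AdmGraph n s) : ∑ v, G.graph.valency v = 2 * G.numE + s := by
  simp only [LGraph.valency, Finset.sum_add_distrib]
  rw [Finset.sum_comm]
  simp only [Sym2.sum_count_toMultiset]
  rw [← Finset.card_eq_sum_card_fiberwise fun _ _ => Finset.mem_coe.2 (Finset.mem_univ _)]
  simp [mul_comm]

lemma three_mul_numV_le (G : AdmGraph n s) : 3 * G.numV ≤ 2 * G.numE + s := by
  rw [← G.sum_valency]
  have := Finset.sum_le_sum fun v (_ : v ∈ Finset.univ) => G.admissible.three_le_valency v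
  simpa [mul_comm] using this

/-- Eliminate `|V|` from `|E| + 1 = n + |V|` and `3 |V| ≤ 2 |E| + s`. -/
lemma numE_le (hn : 1 ≤ n) (G : AdmGraph n s) : G.numE ≤ 3 * (n - 1) + s := by
  have := G.card_edges
  have := G.three_mul_numV_le
  omega

/-- The number of colors is the number of edges of a trivalent graph that collapses to `G`. -/
lemma numE_add_sum (hn : 1 ≤ n) (G : AdmGraph n s) :
    G.numE + ∑ v, (G.graph.valency v - 3) = 3 * (n - 1) + s := by
  have h : ∑ v, (G.graph.valency v - 3) + ∑ _v : Fin G.numV, 3 = 2 * G.numE + s := by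
    rw [← G.sum_valency, ← Finset.sum_add_distrib]
    exact Finset.sum_congr rfl fun v _ => Nat.sub_add_cancel (G.admissible.three_le_valency v)
  have := G.card_edges
  simp only [Finset.sum_const, Finset.card_univ, Fintype.card_fin, smul_eq_mul] at h
  omega

end AdmGraph

/-! ### The moduli space of graphs as a space of decorated graphs -/

/-- The trivial decorations. -/
def trivialDecoration (n s : ℕ) : Decoration n s where
  Idx := AdmGraph n s
  gr G := G
  compat _ _ _ _ _ := True
  compat_refl _ _ := trivial
  compat_collapse _ _ _ _ _ _ _ _ _ _ _ := trivial
  setoid := metricGraphSetoid n s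
  rel_iff _ _ := ⟨fun ⟨φ, h⟩ => ⟨φ, h, trivial⟩, fun ⟨φ, h, _⟩ => ⟨φ, h⟩⟩

lemma MG.exists_cell (y : MG n s) : ∃ G l, y = MG.cell G l := by
  obtain ⟨⟨G, l⟩, rfl⟩ := Quotient.exists_rep y
  exact ⟨G, l, rfl⟩

/-- The graphs whose `m` longest edges form a cut. -/
def MG.cutSet (n s m : ℕ) : Set (MG n s) :=
  {y | ∃ p : MetricGraph n s, Quotient.mk _ p = y ∧ p.2.IsCut m}

lemma MG.mk_mem_cutSet {m : ℕ} (p : MetricGraph n s) :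
    (Quotient.mk _ p : MG n s) ∈ MG.cutSet n s m ↔ p.2.IsCut m :=
  ⟨fun ⟨_, hq, h⟩ => (Decoration.isCut_congr (D := trivialDecoration n s) hq).1 h,
    fun h => ⟨p, rfl, h⟩⟩

lemma MG.isOpen_cutSet (m : ℕ) : IsOpen (MG.cutSet n s m) :=
  Decoration.isOpen_cut (D := trivialDecoration n s) (S := {m})
    (fun p => (MG.mk_mem_cutSet p).trans (by simp only [Finset.mem_singleton, forall_eq]; rfl))

lemma MG.iUnion_cutSet (hn : 1 ≤ n) :
    ⋃ m : Fin (3 * (n - 1) + s + 1), MG.cutSet n s m = Set.univ := by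
  refine Set.eq_univ_of_forall fun y => ?_
  obtain ⟨p, rfl⟩ := Quotient.exists_rep y
  obtain ⟨m, hm, h⟩ := p.2.exists_isCut
  exact Set.mem_iUnion.2 ⟨⟨m, by have := p.1.numE_le hn; omega⟩, (MG.mk_mem_cutSet p).2 h⟩

/-! ### Spaces of colored graphs -/

lemma chainPush_comp_apply {X Y Z : Type} [TopologicalSpace X] [TopologicalSpace Y]
    [TopologicalSpace Z] {k : ℕ} (g : C(Y, Z)) (f : C(X, Y)) (c : (chains X).X k) :
    chainPush k g (chainPush k f c) = chainPush k (g.comp f) c := by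
  refine LinearMap.congr_fun (f := chainPush k g ∘ₗ chainPush k f) ?_ c
  exact chains_hom_ext fun σ => by simp [chainPush_generator, ContinuousMap.comp_assoc]

/-- A kind of colorings of admissible graphs, with an action of the permutations of the colors that
is transitive on the colorings of each graph with collapsed edges. -/
structure ColoringKind (n s : ℕ) where
  /-- The colorings of a graph. -/
  Col : AdmGraph n s → Type
  nonempty : ∀ G, Nonempty (Col G)
  /-- The isomorphisms that respect the colors. -/
  compat : ∀ (i j : Σ G, Col G) (Z : Set (Fin i.1.numE)) (Z' : Set (Fin j.1.numE)),
    LGraph.Iso (i.1.graph.contract Z) (j.1.graph.contract Z') → Prop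
  compat_refl : ∀ i Z, compat i i Z Z (.refl _)
  compat_collapse : ∀ i j Z Z' φ F F' hF hF' h, compat i j Z Z' φ →
    compat i j F F' (LGraph.collapseIso φ hF hF' h)
  /-- The equivalence relation on colored metric graphs. -/
  setoid : Setoid (Σ p : (Σ G, Col G), RegMetric p.1)
  rel_iff : ∀ p q, setoid.r p q ↔
    ∃ φ, p.2.IsHomothety q.2 φ ∧ compat p.1 q.1 p.2.zero q.2.zero φ
  /-- The action of permutations of the colors. -/
  act : Equiv.Perm (Color n s) → ∀ {G}, Col G → Col G
  act_mul : ∀ g h {G} (c : Col G), act (g * h) c = act g (act h c)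
  act_one : ∀ {G} (c : Col G), act 1 c = c
  exists_compat : ∀ (i j : Σ G, Col G) (Z : Set (Fin i.1.numE)) (Z' : Set (Fin j.1.numE))
    (φ : LGraph.Iso (i.1.graph.contract Z) (j.1.graph.contract Z')),
    i.1.graph.IsForest Z → ∃ g, compat ⟨i.1, act g i.2⟩ j Z Z' φ

namespace ColoringKind

variable {K : ColoringKind n s}

variable (K) in
/-- Colorings as decorations. -/
def decoration : Decoration n s where
  Idx := Σ G, K.Col G
  gr := Sigma.fst
  compat := K.compat
  compat_refl := K.compat_refl
  compat_collapse := K.compat_collapse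
  setoid := K.setoid
  rel_iff := K.rel_iff

variable (K) in
/-- The moduli space of colored graphs. -/
abbrev Space : Type := K.decoration.Space

/-- The point represented by a colored metric graph. -/
def pt (G : AdmGraph n s) (c : K.Col G) (l : RegMetric G) : K.Space :=
  Quotient.mk K.setoid ⟨⟨G, c⟩, l⟩

lemma exists_pt (x : K.Space) : ∃ G c l, x = pt (K := K) G c l := by
  obtain ⟨⟨⟨G, c⟩, l⟩, rfl⟩ := Quotient.exists_rep x
  exact ⟨G, c, l, rfl⟩

variable {π : C(K.Space, MG n s)} {ρ : Equiv.Perm (Color n s) → C(K.Space, K.Space)}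
  (hπ : ∀ G (c : K.Col G) l, π (pt G c l) = MG.cell G l)
  (hρ : ∀ g G (c : K.Col G) l, ρ g (pt G c l) = pt G (K.act g c) l)

-- Every cell of `MG` lifts to a colored cell, and openness is tested cell by cell.
include hπ in
lemma isQuotientMap : Topology.IsQuotientMap π := by
  rw [Topology.isQuotientMap_iff]
  refine ⟨.of_isOpen_preimage_iff_isOpen fun U =>
    ⟨fun hU => ?_, fun hU => hU.preimage π.continuous⟩, fun y => ?_⟩
  · refine (Decoration.isOpen_iff (D := trivialDecoration n s)).2 fun (G : AdmGraph n s) => ?_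
    obtain ⟨c⟩ := K.nonempty G
    have h : IsOpen {l : RegMetric G | π (pt G c l) ∈ U} :=
      Decoration.isOpen_iff (D := K.decoration).1 hU ⟨G, c⟩
    simp only [hπ] at h
    exact h
  · obtain ⟨G, l, rfl⟩ := MG.exists_cell y
    obtain ⟨c⟩ := K.nonempty G
    exact ⟨pt G c l, hπ G c l⟩

include hπ hρ in
lemma isOrbitMap : IsOrbitMap π ρ where
  mul g h := by
    ext x
    obtain ⟨G, c, l, rfl⟩ := exists_pt x
    rw [ContinuousMap.comp_apply, hρ, hρ, hρ, K.act_mul]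
  map_act g x := by
    obtain ⟨G, c, l, rfl⟩ := exists_pt x
    rw [hρ, hπ, hπ]
  transitive x x' h := by
    obtain ⟨G, c, l, rfl⟩ := exists_pt x
    obtain ⟨G', c', l', rfl⟩ := exists_pt x'
    rw [hπ, hπ] at h
    -- Equal images give a homothety of the collapsed graphs; permuting the colors makes it respect
    -- the colorings.
    obtain ⟨φ, hφ⟩ := Quotient.exact h
    obtain ⟨g, hg⟩ := K.exists_compat ⟨G, c⟩ ⟨G', c'⟩ _ _ φ l.isForest_zero
    refine ⟨g, ?_⟩
    rw [hρ]
    exact (Decoration.mk_eq_mk (D := K.decoration)).2 ⟨φ, hφ, hg⟩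
  surjective := (isQuotientMap hπ).surjective

-- The deformation alters only lengths, hence commutes with forgetting and with permuting colors.
include hπ hρ in
lemma hasContraction (hn : 1 ≤ n) {S : Finset ℕ} (hS : S.Nonempty) {V : Set (MG n s)}
    (hV : ∀ p : MetricGraph n s, (Quotient.mk _ p : MG n s) ∈ V ↔ ∀ m ∈ S, p.2.IsCut m) :
    HasContraction π ρ V := by
  have hW : ∀ p : K.decoration.Metric, Quotient.mk K.setoid p ∈ π ⁻¹' V ↔
      ∀ m ∈ S, p.2.IsCut m := fun ⟨⟨G, c⟩, l⟩ => by
    have h := hV ⟨G, l⟩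
    have e : (Quotient.mk _ ⟨G, l⟩ : MG n s) = π (pt G c l) := (hπ G c l).symm
    rw [e] at h
    exact h
  have flowX : ∀ (G) (c : K.Col G) (l : RegMetric G) (hx : pt G c l ∈ π ⁻¹' V) t,
      Decoration.spaceFlow (D := K.decoration) hW hS (⟨pt G c l, hx⟩, t) =
        pt G c (l.flow S hS ((hW ⟨⟨G, c⟩, l⟩).1 hx) t) := fun G c l hx t =>
    Decoration.spaceFlow_mk (D := K.decoration) hW (p := ⟨⟨G, c⟩, l⟩) rfl t
  have flowY : ∀ (G) (l : RegMetric G) (y : V) (hy : MG.cell G l = y.1) t,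
      Decoration.spaceFlow (D := trivialDecoration n s) hV hS (y, t) =
        MG.cell G (l.flow S hS ((hV ⟨G, l⟩).1
          (show MG.cell G l ∈ V from hy ▸ y.2)) t) := fun G l y hy t =>
    Decoration.spaceFlow_mk (D := trivialDecoration n s) hV (p := ⟨G, l⟩) hy t
  refine ⟨⟨Decoration.spaceFlow (D := K.decoration) hW hS, Decoration.continuous_spaceFlow _⟩,
    ⟨Decoration.spaceFlow (D := trivialDecoration n s) hV hS, Decoration.continuous_spaceFlow _⟩,
    ?_, fun y t => Decoration.spaceFlow_mem (D := trivialDecoration n s) hV y t, ?_,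
    fun x => Decoration.spaceFlow_zero (D := K.decoration) hW x,
    fun y => Decoration.spaceFlow_zero (D := trivialDecoration n s) hV y,
    Decoration.isLocallyConstant_spaceFlow (D := K.decoration) hW hn,
    Decoration.isLocallyConstant_spaceFlow (D := trivialDecoration n s) hV hn⟩
  · rintro ⟨x, hx⟩ t
    obtain ⟨G, c, l, rfl⟩ := exists_pt x
    refine (congrArg π (flowX G c l hx t)).trans ?_
    rw [hπ]
    exact (flowY G l _ (hπ G c l).symm t).symm
  · rintro g ⟨x, hx⟩ ⟨x', hx'⟩ t h
    obtain ⟨G, c, l, rfl⟩ := exists_pt x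
    dsimp only at h
    rw [hρ] at h
    subst h
    refine (congrArg (ρ g) (flowX G c l hx t)).trans ?_
    rw [hρ]
    exact (flowX G _ l hx' t).symm

include hπ hρ in
lemma coneAcyclic (hn : 1 ≤ n) : ConeAcyclic π ρ Set.univ := by
  classical
  refine (isOrbitMap hπ hρ).coneAcyclic (V := fun m : Fin (3 * (n - 1) + s + 1) =>
    MG.cutSet n s m) (fun m => MG.isOpen_cutSet _) (MG.iUnion_cutSet hn) fun S hS =>
    hasContraction hπ hρ hn (S := S.image Fin.val) (hS.image _) fun p => ?_
  refine Set.mem_iInter₂.trans ((forall₂_congr fun m _ => MG.mk_mem_cutSet p).trans ?_)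
  simp

-- `π` sends `ζ'` to `ζ`, and a permutation only reorders the sum over colorings. So `τ[ζ] = τ
-- π_*[ζ']` is the group average of the invariant class `[ζ']`.
include hπ hρ in
lemma isColoringAverage [∀ G, Fintype (K.Col G)] {k : ℕ}
    {cell : ∀ G, K.Col G → C(RegMetric G, K.Space)}
    (hcell : ∀ G c l, cell G c l = pt G c l)
    {τ : Hlgy k (MG n s) →ₗ[ℚ] Hlgy k K.Space}
    (hτ : τ ∘ₗ Hlgy.map k π = (1 / (Fintype.card (Equiv.Perm (Color n s)) : ℚ)) •
      ∑ g, Hlgy.map k (ρ g)) : IsColoringAverage K.Col cell τ := by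
  intro F z ζ ζ' hζ hζ'
  have hπc : ∀ G c, π.comp (cell G c) = MG.cell G := fun G c => by
    ext l
    change π (cell G c l) = _
    rw [hcell, hπ]
  have hρc : ∀ g G c, (ρ g).comp (cell G c) = cell G (K.act g c) := fun g G c => by
    ext l
    change ρ g (cell G c l) = _
    rw [hcell, hρ, hcell]
  have h₁ : Hlgy.map k π (cycleClass ζ') = cycleClass ζ := by
    obtain ⟨z', hz', e⟩ := map_cycleClass π ζ'
    rw [e]
    congr 1
    apply cycleChain_injective
    rw [hz', hζ, hζ', map_sum]
    refine Finset.sum_congr rfl fun G _ => ?_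
    simp only [map_sum, map_smul, chainPush_comp_apply, hπc]
    rw [Finset.sum_const, Finset.card_univ, ← Nat.cast_smul_eq_nsmul ℚ, smul_smul]
    have := K.nonempty G
    rw [mul_one_div_cancel (by exact_mod_cast Fintype.card_ne_zero), one_smul]
  have h₂ : ∀ g, Hlgy.map k (ρ g) (cycleClass ζ') = cycleClass ζ' := fun g => by
    obtain ⟨z', hz', e⟩ := map_cycleClass (ρ g) ζ'
    rw [e]
    congr 1
    apply cycleChain_injective
    rw [hz', hζ', map_sum]
    refine Finset.sum_congr rfl fun G _ => ?_
    simp only [map_sum, map_smul, chainPush_comp_apply, hρc]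
    exact Fintype.sum_equiv ⟨K.act g, K.act g⁻¹,
      fun c => by rw [← K.act_mul, inv_mul_cancel, K.act_one],
      fun c => by rw [← K.act_mul, mul_inv_cancel, K.act_one]⟩ _ _ fun _ => rfl
  rw [← h₁]
  refine (LinearMap.congr_fun hτ _).trans ?_
  rw [LinearMap.smul_apply, LinearMap.sum_apply, Finset.sum_congr rfl fun g _ => h₂ g,
    Finset.sum_const, Finset.card_univ, ← Nat.cast_smul_eq_nsmul ℚ, smul_smul,
    one_div_mul_cancel (by exact_mod_cast Fintype.card_ne_zero), one_smul]

end ColoringKind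

end

/-! ### The two kinds of colorings, and valencies and labels in collapsed graphs. -/

noncomputable section

variable {n s : ℕ}

lemma exists_perm_comp_eq {A C : Type} [Finite C] {f f' : A → C} (hf : Function.Injective f)
    (hf' : Function.Injective f') : ∃ g : Equiv.Perm C, ∀ a, g (f a) = f' a := by
  classical
  cases nonempty_fintype C
  refine ⟨((Equiv.ofInjective f hf).symm.trans (Equiv.ofInjective f' hf')).extendSubtype,
    fun a => ?_⟩
  rw [Equiv.extendSubtype_apply_of_mem _ _ ⟨a, rfl⟩]
  have : (Equiv.ofInjective f hf).symm ⟨f a, a, rfl⟩ = a :=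
    (Equiv.ofInjective f hf).symm_apply_apply a
  simp [this]

/-- Holocolorings. -/
def holoKind (hn : 1 ≤ n) (s : ℕ) : ColoringKind n s where
  Col := HoloColoring
  nonempty G := ⟨Fin.castLEEmb (G.numE_le hn)⟩
  compat i j Z _ φ := ∀ e : {e // e ∉ Z}, j.2 (φ.edge e).1 = i.2 e.1
  compat_refl _ _ _ := rfl
  compat_collapse _ _ _ _ _ _ _ _ _ _ h _ := h _
  setoid := holoGraphSetoid n s
  rel_iff _ _ := Iff.rfl
  act g _ c := c.trans g.toEmbedding
  act_mul _ _ _ _ := rfl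
  act_one _ := rfl
  exists_compat i j Z Z' φ _ := by
    obtain ⟨g, hg⟩ := exists_perm_comp_eq (f := fun e : {e // e ∉ Z} => i.2 e.1)
      (f' := fun e => j.2 (φ.edge e).1) (i.2.injective.comp Subtype.val_injective)
      (j.2.injective.comp (Subtype.val_injective.comp φ.edge.injective))
    exact ⟨g, fun e => (hg e).symm⟩

/-! ### Valencies in collapsed graphs -/

namespace LGraph

variable {V E V' E' : Type} {G : LGraph s V E} {G' : LGraph s V' E'}

instance [Finite V] (Z : Set E) : Finite (G.Comp Z) := Finite.of_surjective _ (comp_surjective Z)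

lemma Iso.valency_eq [Fintype E] [Fintype E'] [DecidableEq V] [DecidableEq V'] (φ : Iso G G')
    (v : V) : G'.valency (φ.vert v) = G.valency v := by
  unfold valency
  congr 1
  · refine (Fintype.sum_equiv φ.edge _ _ fun e => ?_).symm
    rw [φ.ends_edge]
    induction G.ends e with
    | h a b =>
      change Multiset.count v {a, b} = Multiset.count (φ.vert v) {φ.vert a, φ.vert b}
      simp [Multiset.count_cons, Multiset.count_singleton]
  · simp [φ.leg_eq]

lemma card_comp_le_insert [Finite V] (Z : Set E) (e : E) :
    Nat.card (G.Comp Z) ≤ Nat.card (G.Comp (insert e Z)) + 1 := by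
  classical
  induction he : G.ends e with
  | h a b =>
    -- Adding `e` merges at most the components of `a` and `b`; `r` undoes this for every component
    -- other than that of `a`.
    let r : G.Comp (insert e Z) → G.Comp Z := Quot.lift
      (fun v => if G.comp Z v = G.comp Z a then G.comp Z b else G.comp Z v) <| by
        rintro x y ⟨f, hf | hf, hxy⟩
        · rw [hf, he, Sym2.eq_iff] at hxy
          obtain ⟨rfl, rfl⟩ | ⟨rfl, rfl⟩ := hxy <;> simp
        · have : G.comp Z x = G.comp Z y := Quot.sound ⟨f, hf, hxy⟩
          simp only [this]
    have hr : ∀ q : G.Comp Z, q ≠ G.comp Z a →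
        r (Comp.proj (Set.subset_insert e Z) q) = q := by
      intro q hq
      obtain ⟨v, rfl⟩ := comp_surjective Z q
      exact if_neg hq
    rw [← Finite.card_option]
    refine Nat.card_le_card_of_injective
      (fun q => if q = G.comp Z a then none else some (Comp.proj (Set.subset_insert e Z) q)) ?_
    intro q q' h
    dsimp only at h
    split_ifs at h with h₁ h₂ h₂
    · rw [h₁, h₂]
    · rw [← hr q h₁, Option.some_inj.1 h, hr q' h₂]

/-- Loop numbers are nonnegative. -/
lemma card_le_card_add_card_comp [Finite V] (Z : Finset E) :
    Nat.card V ≤ Z.card + Nat.card (G.Comp (Z : Set E)) := by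
  classical
  induction Z using Finset.induction_on with
  | empty =>
    rw [Finset.card_empty, zero_add]
    refine Nat.card_le_card_of_injective (G.comp _) fun v w h => ?_
    exact congrArg (Quot.lift id fun x y ⟨e, he, _⟩ => absurd he (by simp)) h
  | insert e Z he ih =>
    rw [Finset.card_insert_of_notMem he, Finset.coe_insert]
    have := G.card_comp_le_insert (Z : Set E) e
    omega

section Fibers

variable [Fintype V] [Fintype E] (Z : Set E) (q : G.Comp Z)

open Classical in
/-- The vertices in a component. -/
def vertsIn : Finset V := Finset.univ.filter fun v => G.comp Z v = q

open Classical in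
/-- The edges in a component. -/
def edgesIn : Finset E := Finset.univ.filter fun e => e ∈ Z ∧ G.comp Z (G.ends e).out.1 = q

variable {Z q}

omit [Fintype E] in
lemma mem_vertsIn {v : V} : v ∈ G.vertsIn Z q ↔ G.comp Z v = q := by simp [vertsIn]

omit [Fintype V] in
lemma mem_edgesIn {e : E} : e ∈ G.edgesIn Z q ↔ e ∈ Z ∧ ∀ v ∈ G.ends e, G.comp Z v = q := by
  simp only [edgesIn, Finset.mem_filter_univ]
  refine and_congr_right fun he => ⟨fun h v hv => ?_, fun h => h _ (Sym2.out_fst_mem _)⟩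
  rw [← h]
  exact comp_eq_of_mem he hv (Sym2.out_fst_mem _)

/-- The edges of the component already connect its vertices, so the subgraph with only these edges
has at most one component more than there are vertices outside. Nonnegativity of its loop number
gives the bound. -/
lemma card_vertsIn_le : (G.vertsIn Z q).card ≤ (G.edgesIn Z q).card + 1 := by
  classical
  set F : Set E := (G.edgesIn Z q : Set E) with hF
  have hconn : ∀ v w, G.comp Z v = q → G.comp Z w = q → G.comp F v = G.comp F w := by
    let r : G.Comp Z → Option (G.Comp F) := Quot.lift
      (fun v => if G.comp Z v = q then some (G.comp F v) else none) <| by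
        rintro x y ⟨e, he, hxy⟩
        have h : G.comp Z x = G.comp Z y := Quot.sound ⟨e, he, hxy⟩
        have hx : x ∈ G.ends e := hxy ▸ Sym2.mem_mk_left x y
        have hy : y ∈ G.ends e := hxy ▸ Sym2.mem_mk_right x y
        by_cases hq : G.comp Z y = q
        · have heF : e ∈ F := by
            rw [hF, Finset.mem_coe, mem_edgesIn]
            exact ⟨he, fun v hv => (comp_eq_of_mem he hv hy).trans hq⟩
          rw [if_pos hq, if_pos (h.trans hq), comp_eq_of_mem heF hx hy]
        · rw [if_neg hq, if_neg fun hx => hq (h ▸ hx)]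
    intro v w hv hw
    have h : r (G.comp Z v) = r (G.comp Z w) := by rw [hv, hw]
    have hv' : r (G.comp Z v) = some (G.comp F v) := if_pos hv
    have hw' : r (G.comp Z w) = some (G.comp F w) := if_pos hw
    rw [hv', hw'] at h
    exact Option.some_inj.1 h
  obtain ⟨v₀, hv₀⟩ := comp_surjective Z q
  have h₁ : Nat.card (G.Comp F) ≤ Nat.card {v // v ∉ G.vertsIn Z q} + 1 := by
    rw [← Finite.card_option]
    refine Nat.card_le_card_of_surjective
      (fun v : Option {v // v ∉ G.vertsIn Z q} => v.elim (G.comp F v₀) fun v => G.comp F v.1) ?_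
    intro p
    obtain ⟨v, rfl⟩ := comp_surjective F p
    by_cases hv : v ∈ G.vertsIn Z q
    · exact ⟨none, hconn _ _ hv₀ (mem_vertsIn.1 hv)⟩
    · exact ⟨some ⟨v, hv⟩, rfl⟩
  have h₂ := G.card_le_card_add_card_comp (G.edgesIn Z q)
  rw [Nat.card_eq_fintype_card (α := {v // v ∉ _}), Fintype.card_subtype_compl, Fintype.card_coe]
    at h₁
  rw [Nat.card_eq_fintype_card, ← hF] at h₂
  have h₃ := (G.vertsIn Z q).card_le_univ
  omega

/-- The components of a forest are trees. -/
lemma IsForest.card_edgesIn (hZ : G.IsForest Z) (q : G.Comp Z) :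
    (G.edgesIn Z q).card + 1 = (G.vertsIn Z q).card := by
  classical
  have := Fintype.ofFinite (G.Comp Z)
  have hV : ∑ q : G.Comp Z, (G.vertsIn Z q).card = Fintype.card V :=
    (Finset.card_eq_sum_card_fiberwise fun _ _ => Finset.mem_coe.2 (Finset.mem_univ _)).symm
  have hE : ∑ q : G.Comp Z, (G.edgesIn Z q).card = Z.ncard := by
    rw [Set.ncard_eq_toFinset_card', Finset.card_eq_sum_card_fiberwise
      (f := fun e => G.comp Z (G.ends e).out.1) (t := Finset.univ)
      fun _ _ => Finset.mem_coe.2 (Finset.mem_univ _)]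
    refine Finset.sum_congr rfl fun q _ => congrArg Finset.card ?_
    ext e
    simp [edgesIn]
  have hsum : ∑ q : G.Comp Z, (G.vertsIn Z q).card =
      ∑ q : G.Comp Z, ((G.edgesIn Z q).card + 1) := by
    rw [Finset.sum_add_distrib, hV, hE, Finset.sum_const, Finset.card_univ, smul_eq_mul, mul_one]
    rw [IsForest, loops, Nat.card_eq_fintype_card, Nat.card_eq_fintype_card] at hZ
    omega
  -- The inequality holds for each component and the sums agree, so each is an equality.
  exact ((Finset.sum_eq_sum_iff_of_le fun q _ => card_vertsIn_le).1 hsum q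
    (Finset.mem_univ q)).symm

omit [Fintype E] in
lemma sum_count_vertsIn [DecidableEq V] [DecidableEq (G.Comp Z)] (z : Sym2 V) :
    ∑ v ∈ G.vertsIn Z q, z.toMultiset.count v = (z.map (G.comp Z)).toMultiset.count q := by
  induction z with
  | h a b =>
    change ∑ v ∈ _, Multiset.count v {a, b} = Multiset.count q {G.comp Z a, G.comp Z b}
    have h : ∀ a, (∑ v ∈ G.vertsIn Z q, if v = a then 1 else 0) =
        if q = G.comp Z a then 1 else 0 := fun a => by
      simp [mem_vertsIn, eq_comm]
    simp only [Multiset.insert_eq_cons, Multiset.count_cons, Multiset.count_singleton,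
      Finset.sum_add_distrib, h]

/-- Each collapsed edge of the component has both ends in it; every other edge end or leg at the
component remains at the vertex `q`. -/
lemma sum_valency_vertsIn [DecidableEq V] [DecidableEq (G.Comp Z)] [Fintype {e // e ∉ Z}] :
    ∑ v ∈ G.vertsIn Z q, G.valency v =
      2 * (G.edgesIn Z q).card + (G.contract Z).valency q := by
  classical
  have hlegs : ∑ v ∈ G.vertsIn Z q, (Finset.univ.filter fun i => G.leg i = v).card =
      (Finset.univ.filter fun i => (G.contract Z).leg i = q).card := by
    rw [Finset.sum_card_fiberwise_eq_card_filter]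
    simp only [mem_vertsIn]
    rfl
  have hin : ∀ e ∈ Z, ((G.ends e).map (G.comp Z)).toMultiset.count q =
      if e ∈ G.edgesIn Z q then 2 else 0 := by
    intro e he
    simp only [mem_edgesIn, he, true_and]
    have h : ∀ x y, x ∈ G.ends e → y ∈ G.ends e → G.comp Z x = G.comp Z y :=
      fun x y => comp_eq_of_mem he
    revert h
    induction G.ends e with
    | h a b =>
      intro h
      change Multiset.count q {G.comp Z a, G.comp Z b} = _
      rw [h b a (Sym2.mem_mk_right a b) (Sym2.mem_mk_left a b)]
      have : (∀ v ∈ s(a, b), G.comp Z v = q) ↔ G.comp Z a = q :=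
        ⟨fun h => h a (Sym2.mem_mk_left a b),
          fun ha v hv => (h v a hv (Sym2.mem_mk_left a b)).trans ha⟩
      simp only [this]
      by_cases hq : G.comp Z a = q
      · simp [hq]
      · simp [hq, Ne.symm hq]
  simp only [valency, Finset.sum_add_distrib]
  rw [Finset.sum_comm, hlegs, ← add_assoc]
  congr 1
  simp only [sum_count_vertsIn]
  rw [← Finset.sum_filter_add_sum_filter_not _ (· ∈ Z)]
  congr 1
  · rw [Finset.sum_congr rfl fun e he => hin e (Finset.mem_filter.1 he).2, ← Finset.sum_filter,
      Finset.sum_const, smul_eq_mul, mul_comm]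
    congr 2
    ext e
    simp only [Finset.mem_filter, Finset.mem_univ, true_and, and_iff_right_iff_imp]
    exact fun h => (mem_edgesIn.1 h).1
  · exact Finset.sum_subtype (p := (· ∉ Z)) _ (by simp) _

end Fibers

end LGraph

/-! ### Remembering holocolorings -/

namespace RemColoring

variable {G G' : AdmGraph n s} (c : RemColoring G) {Z F : Set (Fin G.numE)}

/-- The required edge colors and label elements add up to exactly the number of colors. -/
lemma nonempty (hn : 1 ≤ n) (G : AdmGraph n s) : Nonempty (RemColoring G) := by
  let f : Fin G.numE ⊕ (Σ v, Fin (G.graph.valency v - 3)) ≃ Color n s :=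
    Fintype.equivOfCardEq (by simpa using G.numE_add_sum hn)
  have hv : ∀ v, Function.Injective fun i => f (.inr ⟨v, i⟩) := fun v i j h => by
    simpa using f.injective h
  exact ⟨{
    color := ⟨fun e => f (.inl e), f.injective.comp Sum.inl_injective⟩
    type v := Finset.univ.map ⟨fun i => f (.inr ⟨v, i⟩), hv v⟩
    card_type v := by
      rw [Finset.card_map, Finset.card_univ, Fintype.card_fin]
      exact Nat.sub_add_cancel (G.admissible.three_le_valency v)
    color_notMem e v := by simp
    type_disjoint v w h := by
      rw [Finset.disjoint_left]
      rintro x hx hx'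
      simp only [Finset.mem_map, Finset.mem_univ, true_and, Function.Embedding.coeFn_mk]
        at hx hx'
      obtain ⟨i, rfl⟩ := hx
      obtain ⟨j, hj⟩ := hx'
      have := f.injective hj
      simp only [Sum.inr.injEq, Sigma.mk.injEq] at this
      exact h this.1.symm }⟩

/-- All colors are used. -/
lemma exists_color_or_type (hn : 1 ≤ n) (x : Color n s) :
    (∃ e, c.color e = x) ∨ ∃ v, x ∈ c.type v := by
  classical
  let f : Fin G.numE ⊕ (Σ v, c.type v) → Color n s := Sum.elim c.color fun p => p.2.1
  have hf : Function.Injective f := by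
    rintro (e | ⟨v, x, hx⟩) (e' | ⟨v', x', hx'⟩) h
    · exact congrArg _ (c.color.injective h)
    · exact absurd hx' (by change c.color e = x' at h; exact h ▸ c.color_notMem e v')
    · exact absurd hx (by change x = c.color e' at h; exact h ▸ c.color_notMem e' v)
    · change x = x' at h
      subst h
      obtain rfl : v = v' := by
        by_contra hne
        exact Finset.disjoint_left.1 (c.type_disjoint v v' hne) hx hx'
      rfl
  have hcard : Fintype.card (Fin G.numE ⊕ (Σ v, c.type v)) = Fintype.card (Color n s) := by
    simp only [Fintype.card_sum, Fintype.card_fin, Fintype.card_sigma, Fintype.card_coe]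
    rw [← G.numE_add_sum hn]
    congr 1
    exact Finset.sum_congr rfl fun v _ => by have := c.card_type v; omega
  obtain ⟨e | ⟨v, y⟩, h⟩ := ((Fintype.bijective_iff_injective_and_card f).2 ⟨hf, hcard⟩).2 x
  · exact .inl ⟨e, h⟩
  · exact .inr ⟨v, by rw [← h]; exact y.2⟩

lemma color_notMem_shrunkType {e : Fin G.numE} (he : e ∉ Z) (q : G.graph.Comp Z) :
    c.color e ∉ c.shrunkType Z q := by
  rintro (⟨v, -, hv⟩ | ⟨f, hf, hfe, -⟩)
  · exact c.color_notMem e v hv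
  · exact he (c.color.injective hfe ▸ hf)

lemma eq_of_mem_shrunkType {x : Color n s} {q q' : G.graph.Comp Z} (h : x ∈ c.shrunkType Z q)
    (h' : x ∈ c.shrunkType Z q') : q = q' := by
  obtain ⟨v, rfl, hv⟩ | ⟨e, -, rfl, hq⟩ := h <;> obtain ⟨w, rfl, hw⟩ | ⟨f, -, hf, hq'⟩ := h'
  · by_contra hne
    exact Finset.disjoint_left.1 (c.type_disjoint v w fun h => hne (h ▸ rfl)) hv hw
  · exact absurd hv (hf ▸ c.color_notMem f v)
  · exact absurd hw (c.color_notMem e w)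
  · obtain rfl := c.color.injective hf
    exact (hq _ (Sym2.out_fst_mem _)).symm.trans (hq' _ (Sym2.out_fst_mem _))

lemma exists_mem_shrunkType (hn : 1 ≤ n) (Z : Set (Fin G.numE)) (x : Color n s) :
    (∃ e ∉ Z, c.color e = x) ∨ ∃ q, x ∈ c.shrunkType Z q := by
  obtain ⟨e, rfl⟩ | ⟨v, hv⟩ := c.exists_color_or_type hn x
  · by_cases he : e ∈ Z
    · exact .inr ⟨_, .inr ⟨e, he, rfl, fun v hv =>
        LGraph.comp_eq_of_mem he hv (Sym2.out_fst_mem _)⟩⟩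
    · exact .inl ⟨e, he, rfl⟩
  · exact .inr ⟨_, .inl ⟨v, rfl, hv⟩⟩

/-- With `k` collapsed edges the component is a tree on `k + 1` vertices. The old labels contribute
`2k + |q| - 3(k + 1)` elements and the edge colors `k`, in total `|q| - 3`. -/
lemma ncard_shrunkType [DecidableEq (G.graph.Comp Z)] [Fintype {e // e ∉ Z}]
    (hZ : G.graph.IsForest Z) (q : G.graph.Comp Z) :
    (c.shrunkType Z q).ncard + 3 = (G.graph.contract Z).valency q := by
  classical
  have h : c.shrunkType Z q =
      (((G.graph.vertsIn Z q).biUnion c.type ∪ (G.graph.edgesIn Z q).map c.color : Finset _) :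
        Set (Color n s)) := by
    ext x
    simp only [shrunkType, Set.mem_ofPred_eq, Finset.coe_union, Set.mem_union, Finset.mem_coe,
      Finset.mem_biUnion, Finset.mem_map, LGraph.mem_vertsIn, LGraph.mem_edgesIn]
    refine or_congr_right (exists_congr fun e => ?_)
    tauto
  rw [h, Set.ncard_coe_finset, Finset.card_union_of_disjoint, Finset.card_map,
    Finset.card_biUnion fun v _ w _ hvw => c.type_disjoint v w hvw]
  · have h₁ := G.graph.sum_valency_vertsIn (Z := Z) (q := q)
    have h₂ := hZ.card_edgesIn q
    simp only [← c.card_type, Finset.sum_add_distrib, Finset.sum_const, smul_eq_mul] at h₁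
    omega
  · rw [Finset.disjoint_left]
    intro x hx hx'
    obtain ⟨v, -, hv⟩ := Finset.mem_biUnion.1 hx
    obtain ⟨e, -, rfl⟩ := Finset.mem_map.1 hx'
    exact c.color_notMem e v hv

/-- The colors are the colors of the remaining edges and the labels of the vertices of a collapsed
graph. -/
def colorEquiv (hn : 1 ≤ n) (Z : Set (Fin G.numE)) :
    {e // e ∉ Z} ⊕ (Σ q, c.shrunkType Z q) ≃ Color n s :=
  Equiv.ofBijective (Sum.elim (fun e => c.color e.1) fun p => p.2.1) <| by
    constructor
    · rintro (e | ⟨q, x, hx⟩) (e' | ⟨q', x', hx'⟩) h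
      · exact congrArg _ (Subtype.ext (c.color.injective h))
      · exact absurd hx' (by
          change c.color e.1 = x' at h; exact h ▸ c.color_notMem_shrunkType e.2 q')
      · exact absurd hx (by
          change x = c.color e'.1 at h; exact h ▸ c.color_notMem_shrunkType e'.2 q)
      · change x = x' at h
        subst h
        obtain rfl := c.eq_of_mem_shrunkType hx hx'
        rfl
    · intro x
      obtain ⟨e, he, rfl⟩ | ⟨q, hq⟩ := c.exists_mem_shrunkType hn Z x
      exacts [⟨.inl ⟨e, he⟩, rfl⟩, ⟨.inr ⟨q, x, hq⟩, rfl⟩]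

/-- Collapsing `F` can be done in two stages, `Z` and then the rest. -/
lemma mem_shrunkType_iff (h : Z ⊆ F) {q : G.graph.Comp F} {x : Color n s} :
    x ∈ c.shrunkType F q ↔
      (∃ p : G.graph.Comp Z, LGraph.Comp.proj h p = q ∧ x ∈ c.shrunkType Z p) ∨
        ∃ e : {e // e ∉ Z}, e.1 ∈ F ∧ c.color e.1 = x ∧
          ∀ v ∈ G.graph.ends e.1, G.graph.comp F v = q := by
  constructor
  · rintro (⟨v, hv, hx⟩ | ⟨e, he, hx, hq⟩)
    · exact .inl ⟨G.graph.comp Z v, hv, .inl ⟨v, rfl, hx⟩⟩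
    · by_cases heZ : e ∈ Z
      · exact .inl ⟨G.graph.comp Z (G.graph.ends e).out.1, hq _ (Sym2.out_fst_mem _),
          .inr ⟨e, heZ, hx, fun v hv => LGraph.comp_eq_of_mem heZ hv (Sym2.out_fst_mem _)⟩⟩
      · exact .inr ⟨⟨e, heZ⟩, he, hx, hq⟩
  · rintro (⟨p, rfl, ⟨v, rfl, hx⟩ | ⟨e, he, hx, hp⟩⟩ | ⟨e, he, hx, hq⟩)
    · exact .inl ⟨v, rfl, hx⟩
    · exact .inr ⟨e, h he, hx, fun v hv => by rw [← hp v hv]; rfl⟩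
    · exact .inr ⟨e.1, he, hx, hq⟩

/-- The two-stage description involves only labels after the first collapse and colors of the edges
surviving it, and `φ` preserves both. -/
lemma shrunkType_collapseIso {c' : RemColoring G'} {Z' F' : Set (Fin G'.numE)}
    {φ : LGraph.Iso (G.graph.contract Z) (G'.graph.contract Z')} (hF : Z ⊆ F) (hF' : Z' ⊆ F')
    (h : ∀ e : {e // e ∉ Z}, (φ.edge e).1 ∈ F' ↔ e.1 ∈ F)
    (hc : ∀ e, c'.color (φ.edge e).1 = c.color e.1)
    (ht : ∀ q, c'.shrunkType Z' (φ.vert q) = c.shrunkType Z q) (q : G.graph.Comp F) :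
    c'.shrunkType F' ((LGraph.collapseIso φ hF hF' h).vert q) = c.shrunkType F q := by
  ext x
  rw [mem_shrunkType_iff _ hF', mem_shrunkType_iff _ hF]
  refine or_congr (φ.vert.exists_congr fun p => ?_).symm (φ.edge.exists_congr fun e => ?_).symm
  · rw [ht, ← LGraph.collapseIso_vert φ hF hF' h, Equiv.apply_eq_iff_eq]
  · rw [h, hc]
    refine and_congr_right fun he => and_congr_right fun _ => ?_
    have he' := (h e).2 he
    obtain ⟨a, ha, hax⟩ := φ.exists_mem_ends e (Sym2.out_fst_mem _)
    have hcomp : G'.graph.comp F' a = (LGraph.collapseIso φ hF hF' h).vert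
        (G.graph.comp F (G.graph.ends e.1).out.1) := by
      rw [← LGraph.Comp.proj_comp hF, LGraph.collapseIso_vert, ← hax, LGraph.Comp.proj_comp]
    constructor
    · intro hq b hb
      rw [LGraph.comp_eq_of_mem he' hb ha, hcomp, hq _ (Sym2.out_fst_mem _)]
    · intro hq v hv
      rw [LGraph.comp_eq_of_mem he hv (Sym2.out_fst_mem _)]
      exact (LGraph.collapseIso φ hF hF' h).vert.injective (hcomp.symm.trans (hq a ha))

end RemColoring

/-- Remembering holocolorings. -/
def remKind (hn : 1 ≤ n) (s : ℕ) : ColoringKind n s where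
  Col := RemColoring
  nonempty := RemColoring.nonempty hn
  compat i j Z Z' φ := (∀ e : {e // e ∉ Z}, j.2.color (φ.edge e).1 = i.2.color e.1) ∧
    ∀ q, j.2.shrunkType Z' (φ.vert q) = i.2.shrunkType Z q
  compat_refl _ _ := ⟨fun _ => rfl, fun _ => rfl⟩
  compat_collapse _ _ _ _ _ _ _ hF hF' h hc :=
    ⟨fun _ => hc.1 _, RemColoring.shrunkType_collapseIso _ hF hF' h hc.1 hc.2⟩
  setoid := remGraphSetoid n s
  rel_iff _ _ := Iff.rfl
  act g _ c := c.recolor g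
  act_mul g h _ c := RemColoring.ext rfl (funext fun v =>
    (Finset.map_map h.toEmbedding g.toEmbedding (c.type v)).symm)
  act_one c := RemColoring.ext rfl (funext fun v => Finset.map_refl)
  exists_compat i j Z Z' φ hZ := by
    classical
    have hZ' := AdmGraph.isForest_of_iso φ hZ
    have hcard : ∀ q, Nat.card (i.2.shrunkType Z q) = Nat.card (j.2.shrunkType Z' (φ.vert q)) :=
      fun q => by
        have h₁ := i.2.ncard_shrunkType hZ q
        have h₂ := j.2.ncard_shrunkType hZ' (φ.vert q)
        rw [φ.valency_eq, ← h₁] at h₂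
        exact (Nat.add_right_cancel h₂).symm
    -- Labels of corresponding vertices have equal size, as the valencies agree, and any bijections
    -- between them will do.
    let f : (Σ q, i.2.shrunkType Z q) ≃ Σ q, j.2.shrunkType Z' q :=
      Equiv.sigmaCongr φ.vert fun q => (Finite.card_eq.1 (hcard q)).some
    let g : Equiv.Perm (Color n s) := (i.2.colorEquiv hn Z).symm.trans
      ((φ.edge.sumCongr f).trans (j.2.colorEquiv hn Z'))
    have hg : ∀ y, g (i.2.colorEquiv hn Z y) = j.2.colorEquiv hn Z' (φ.edge.sumCongr f y) :=
      fun y => by simp [g]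
    refine ⟨g, fun e => (hg (.inl e)).symm, fun q => ?_⟩
    change _ = (i.2.recolor g).shrunkType Z q
    rw [RemColoring.shrunkType_recolor]
    symm
    -- By construction `g` maps each label into the corresponding one; equal cardinality gives
    -- equality.
    refine Set.eq_of_subset_of_ncard_le ?_ ?_
    · rintro _ ⟨x, hx, rfl⟩
      have h := hg (.inr ⟨q, x, hx⟩)
      change g x = (f ⟨q, x, hx⟩).2.1 at h
      rw [h]
      exact (f ⟨q, x, hx⟩).2.2
    · rw [Set.ncard_image_of_injective _ g.injective]
      exact (hcard q).ge

instance (hn : 1 ≤ n) (G : AdmGraph n s) : Fintype ((holoKind hn s).Col G) :=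
  inferInstanceAs (Fintype (HoloColoring G))

instance (hn : 1 ≤ n) (G : AdmGraph n s) : Fintype ((remKind hn s).Col G) :=
  inferInstanceAs (Fintype (RemColoring G))

/-- The conclusions for a space of colored graphs. -/
theorem ColoringKind.exists_transfer (hn : 1 ≤ n) (k : ℕ) (K : ColoringKind n s)
    [∀ G, Fintype (K.Col G)] {π : C(K.Space, MG n s)}
    {ρ : Equiv.Perm (Color n s) → C(K.Space, K.Space)}
    {cell : ∀ G, K.Col G → C(RegMetric G, K.Space)} (hcell : ∀ G c l, cell G c l = pt G c l)
    (hπ : ∀ G (c : K.Col G) l, π (pt G c l) = MG.cell G l)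
    (hρ : ∀ g G (c : K.Col G) l, ρ g (pt G c l) = pt G (K.act g c) l) :
    Topology.IsQuotientMap π ∧ Function.Surjective (Hlgy.map k π) ∧
      ∃ τ : Hlgy k (MG n s) →ₗ[ℚ] Hlgy k K.Space, Hlgy.map k π ∘ₗ τ = LinearMap.id ∧
        IsColoringAverage K.Col cell τ ∧
        τ ∘ₗ Hlgy.map k π = (1 / (Fintype.card (Equiv.Perm (Color n s)) : ℚ)) •
          ∑ g : Equiv.Perm (Color n s), Hlgy.map k (ρ g) := by
  have hc := coneAcyclic hπ hρ hn
  obtain ⟨τ, h₁, h₂⟩ := (isOrbitMap hπ hρ).exists_transfer hc k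
  exact ⟨isQuotientMap hπ, surjective_map_of_coneAcyclic hc k, τ, h₁,
    isColoringAverage hπ hρ hcell h₂, h₂⟩

end

end GraphModuli

theorem mainTheorem8 (n s : ℕ) (hn : 1 ≤ n) (k : ℕ) :
    (Topology.IsQuotientMap (MHG.forget n s) ∧
      Function.Surjective (Hlgy.map k (MHG.forget n s)) ∧
      ∃ τ : Hlgy k (MG n s) →ₗ[ℚ] Hlgy k (MHG n s),
        Hlgy.map k (MHG.forget n s) ∘ₗ τ = LinearMap.id ∧
        IsColoringAverage HoloColoring MHG.cell τ ∧
        τ ∘ₗ Hlgy.map k (MHG.forget n s) =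
          (1 / (Fintype.card (Equiv.Perm (Color n s)) : ℚ)) •
            ∑ g : Equiv.Perm (Color n s), Hlgy.map k (MHG.recolor g)) ∧
    (Topology.IsQuotientMap (MRG.forget n s) ∧
      Function.Surjective (Hlgy.map k (MRG.forget n s)) ∧
      ∃ τ : Hlgy k (MG n s) →ₗ[ℚ] Hlgy k (MRG n s),
        Hlgy.map k (MRG.forget n s) ∘ₗ τ = LinearMap.id ∧
        IsColoringAverage RemColoring MRG.cell τ ∧
        τ ∘ₗ Hlgy.map k (MRG.forget n s) =
          (1 / (Fintype.card (Equiv.Perm (Color n s)) : ℚ)) •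
            ∑ g : Equiv.Perm (Color n s), Hlgy.map k (MRG.recolor g)) := by
  refine ⟨?_, ?_⟩
  · exact ColoringKind.exists_transfer hn k (holoKind hn s) (π := MHG.forget n s)
      (ρ := MHG.recolor) (cell := MHG.cell) (fun _ _ _ => rfl) (fun _ _ _ => rfl)
      fun _ _ _ _ => rfl
  · exact ColoringKind.exists_transfer hn k (remKind hn s) (π := MRG.forget n s)
      (ρ := MRG.recolor) (cell := MRG.cell) (fun _ _ _ => rfl) (fun _ _ _ => rfl)
      fun _ _ _ _ => rfl
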